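/- **Conventions.** Let $\mathcal A$ be a (strict) 2-category with finite products in the strict sense (the universal properties of the terminal 0-cell $1$ and of $\mathcal C\times\mathcal D$ are isomorphisms of hom-categories). Composition of 1-cells and 2-cells is written in the usual applicative order; a 1-cell $A:\mathcal X\to\mathcal C$ is treated as an object of $\mathcal C$ at stage $\mathcal X$, so that for 1-cells $A,B:\mathcal X\to\mathcal C$ and $\otimes:\mathcal C\times\mathcal C\to\mathcal C$ one has $A\otimes B=\otimes\circ\langle A,B\rangle:\mathcal X\to\mathcal C$, and a 1-cell $I:1\to\mathcal C$ also denotes $I\circ{!}:\mathcal X\to\mathcal C$. A 2-cell with such indices denotes the corresponding whiskering. A *monoidal object* $(\mathcal C,\otimes,I,\alpha,\lambda,\rho)$ consists of a 0-cell, 1-cells $\otimes:\mathcal C\times\mathcal C\to\mathcal C$, $I:1\to\mathcal C$ and invertible 2-cells $\alpha_{A,B,C}:A\otimes(B\otimes C)\to(A\otimes B)\otimes C$, $\lambda_A:I\otimes A\to A$, $\rho_A:A\otimes I\to A$ satisfying the pentagon and the triangle. A *lax monoidal 1-cell* is a 1-cell $F$ with 2-cells $\phi_{A,B}:F(A)\otimes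 F(B)\to F(A\otimes B)$, $\bar\phi:I\to F(I)$ compatible with $\alpha,\lambda,\rho$; it is *strong* if $\phi,\bar\phi$ are invertible. *Monoidal 2-cells* are 2-cells compatible with these. They form the 2-category $\mathrm{Mon}_l(\mathcal A)$; a *lax monoidal monad* is a monad in it. A 0-cell $\mathcal E$ is *rc* if all categories $\mathcal A(\mathcal X,\mathcal E)$ have coequalizers of reflexive pairs and all precomposition functors $\mathcal A(\mathcal X,\mathcal E)\to\mathcal A(\mathcal Y,\mathcal E)$ with 1-cells $\mathcal Y\to\mathcal X$ preserve them; a 1-cell is *rc* if all postcomposition functors with it preserve coequalizers of reflexive pairs. For a monad $(R,\eta,\mu)$ on $\mathcal C$ in a 2-category, a *subequalizing* at $\mathcal X$ is a 1-cell $u:\mathcal X\to\mathcal C$ with a 2-cell $\nu:Ru\to u$ such that $\nu\circ\eta_u=1$ and $\nu\circ R(\nu)=\nu\circ\mu_u$; a morphism $(u,\nu)\to(u',\nu')$ is a 2-cell $\sigma:u\to u'$ with $\nu'\circ R(\sigma)=\sigma\circ\nu$. A subequalizing $(U,\beta)$ at $\mathcal E$ is an *Eilenberg–Moore object* for $R$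 if for every 0-cell $\mathcal X$ the functor $L\mapsto(UL,\beta_L)$, $n\mapsto U(n)$, is an isomorphism from the category of 1-cells $\mathcal X\to\mathcal E$ to the category of subequalizings at $\mathcal X$. Then $F^R:\mathcal C\to\mathcal E$ denotes the unique 1-cell with $UF^R=R$ and $\beta_{F^R}=\mu$. **Theorem.** Let $(\mathcal C,\otimes,I,\alpha,\lambda,\rho)$ be a monoidal object in $\mathcal A$ such that $\mathcal C$ and $\otimes$ are rc. Let $(R,\phi,\bar\phi,\eta,\mu)$ be a lax monoidal monad on it whose 1-cell $R:\mathcal C\to\mathcal C$ is rc, and suppose that the underlying monad $(R,\eta,\mu)$ in $\mathcal A$ has an Eilenberg–Moore object $(\mathcal C^R,\ U=U^R:\mathcal C^R\to\mathcal C,\ \beta:RU\to U)$. Let $A,B$ be the composites of $U$ with the two projections of $\mathcal C^R\times\mathcal C^R$, and $a:R(A)\to A$, $b:R(B)\to B$ the whiskerings of $\beta$. Then the pair of 2-cells $$\mu\circ R(\phi_{A,B}),\quad R(a\otimes b)\ :\ R(R(A)\otimes R(B))\rightrightarrows R(A\otimes B)$$ is reflexive. For each coequalizer $q_{A,B}:R(A\otimes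 B)\to Q$ of it in $\mathcal A(\mathcal C^R\times\mathcal C^R,\mathcal C)$ there is a monoidal structure $(\ddot\otimes,\ddot I,\ddot\alpha,\ddot\lambda,\ddot\rho)$ on $\mathcal C^R$ with the following properties (and a coequalizer, hence such a structure, exists): * $U\circ\ddot\otimes=Q$ and $q_{A,B}$ is a morphism of $R$-algebras: $\beta_{\ddot\otimes}\circ R(q_{A,B})=q_{A,B}\circ\mu_{A\otimes B}$; * $\ddot I=F^R\circ I$; * for the 1-cell $\mathbb A=1_{\mathcal C^R}$, with $A=U$, $a=\beta$, $$U(\ddot\lambda_{\mathbb A})\circ q_{\ddot I,\mathbb A}=a\circ\mu_A\circ R^2(\lambda_A)\circ R(\phi_{I,A})\circ R(1\otimes\eta_A),\qquad U(\ddot\rho_{\mathbb A})\circ q_{\mathbb A,\ddot I}=a\circ\mu_A\circ R^2(\rho_A)\circ R(\phi_{A,I})\circ R(\eta_A\otimes1);$$ * with $\ddot u_{\mathbb A,\mathbb B}:=q_{\mathbb A,\mathbb B}\circ\eta_{A\otimes B}:A\otimes B\to U(\mathbb A\mathbin{\ddot\otimes}\mathbb B)$, and $\mathbb A,\mathbb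 B,\mathbb C$ the projections from $\mathcal C^R\times\mathcal C^R\times\mathcal C^R$ and $A,B,C$ their composites with $U$, $$U(\ddot\alpha_{\mathbb A,\mathbb B,\mathbb C})\circ q_{\mathbb A,\mathbb B\ddot\otimes\mathbb C}\circ R(1\otimes\ddot u_{\mathbb B,\mathbb C})=q_{\mathbb A\ddot\otimes\mathbb B,\mathbb C}\circ R(\ddot u_{\mathbb A,\mathbb B}\otimes1)\circ R(\alpha_{A,B,C}).$$ Moreover, for every monoidal structure on $\mathcal C^R$ with these properties for some coequalizer $q$ of the above pair: 1. $U^R$ with the coherence 2-cells $\ddot u$ and $\eta_I:I\to R(I)=U(\ddot I)$ is a lax monoidal 1-cell, and $\beta$ is a monoidal 2-cell; 2. $((\mathcal C^R,\ddot\otimes,\ddot I,\ddot\alpha,\ddot\lambda,\ddot\rho),(U^R,\ddot u,\eta_I),\beta)$ is an Eilenberg–Moore object for the lax monoidal monad $(R,\phi,\bar\phi,\eta,\mu)$ in $\mathrm{Mon}_l(\mathcal A)$; 3. $F^R$ carries a strong monoidal structure $\ddot v$ such that $(U^R,\ddot u)\circ(F^R,\ddot v)=(R,\phi)$ as lax monoidal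 1-cells and $(F^R,\ddot v)$ is left adjoint to $(U^R,\ddot u)$ in $\mathrm{Mon}_l(\mathcal A)$, with unit $\eta$ and with counit $\varepsilon^R:F^RU^R\to1$ satisfying $U^R(\varepsilon^R)=\beta$. -/

import Mathlib

open CategoryTheory Bicategory Limits

attribute [instance 2000] CategoryStruct.toQuiver

universe w v u

namespace MonLax

/-! ### Strict finite products -/

/-- A functor is an isomorphism of categories: bijective on objects, full and faithful. -/
def IsCatIso {C : Type*} {D : Type*} [Category C] [Category D] (F : C ⥤ D) : Prop :=
  Function.Bijective F.obj ∧ F.Full ∧ F.Faithful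

/-- A choice of finite products, in the strict 2-categorical sense, in a strict 2-category:
a terminal 0-cell and binary products of 0-cells, whose universal properties are isomorphisms of
hom-categories. -/
class FiniteProducts (A : Type u) [Bicategory.{w, v} A] [Bicategory.Strict A] where
  pt : A
  isCatIso_pt : ∀ X : A, IsCatIso (Functor.star (X ⟶ pt) : (X ⟶ pt) ⥤ Discrete PUnit.{1})
  prod : A → A → A
  fst : ∀ C D : A, prod C D ⟶ C
  snd : ∀ C D : A, prod C D ⟶ D
  isCatIso_prod : ∀ C D X : A, IsCatIso ((postcomp X (fst C D)).prod' (postcomp X (snd C D)))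

section Products

variable {A : Type u} [Bicategory.{w, v} A]

theorem assoc₂ {X Y : A} {f g h k : X ⟶ Y} (σ : f ⟶ g) (τ : g ⟶ h) (υ : h ⟶ k) :
    (σ ≫ τ) ≫ υ = σ ≫ τ ≫ υ := Category.assoc σ τ υ

variable [Bicategory.Strict A]

theorem assoc₁ {X Y Z W : A} (f : X ⟶ Y) (g : Y ⟶ Z) (h : Z ⟶ W) :
    (f ≫ g) ≫ h = f ≫ g ≫ h := Bicategory.Strict.assoc f g h

theorem id_comp₁ {X Y : A} (f : X ⟶ Y) : 𝟙 X ≫ f = f := Bicategory.Strict.id_comp f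

theorem comp_id₁ {X Y : A} (f : X ⟶ Y) : f ≫ 𝟙 Y = f := Bicategory.Strict.comp_id f

variable [FiniteProducts A]

/-- The terminal 0-cell. -/
abbrev pt (A : Type u) [Bicategory.{w, v} A] [Bicategory.Strict A] [FiniteProducts A] : A :=
  FiniteProducts.pt

/-- The product of two 0-cells. -/
abbrev pr (C D : A) : A := FiniteProducts.prod C D

/-- The first projection. -/
abbrev p₁ {C D : A} : pr C D ⟶ C := FiniteProducts.fst C D

/-- The second projection. -/
abbrev p₂ {C D : A} : pr C D ⟶ D := FiniteProducts.snd C D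

/-- The unique 1-cell into the terminal 0-cell. -/
noncomputable def bang (X : A) : X ⟶ pt A :=
  ((FiniteProducts.isCatIso_pt X).1.surjective ⟨⟨⟩⟩).choose

theorem bang_uniq {X : A} (f g : X ⟶ pt A) : f = g :=
  (FiniteProducts.isCatIso_pt X).1.injective rfl

theorem bang_uniq₂ {X : A} {f g : X ⟶ pt A} (σ τ : f ⟶ g) : σ = τ :=
  (FiniteProducts.isCatIso_pt X).2.2.map_injective rfl

/-- The 1-cell into a product with the given components. -/
noncomputable def lift {X C D : A} (f : X ⟶ C) (g : X ⟶ D) : X ⟶ pr C D :=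
  ((FiniteProducts.isCatIso_prod C D X).1.surjective (f, g)).choose

theorem lift_spec {X C D : A} (f : X ⟶ C) (g : X ⟶ D) :
    ((postcomp X (p₁ (C := C) (D := D))).prod' (postcomp X p₂)).obj (lift f g) = (f, g) :=
  ((FiniteProducts.isCatIso_prod C D X).1.surjective (f, g)).choose_spec

theorem lift_p₁ {X C D : A} (f : X ⟶ C) (g : X ⟶ D) : lift f g ≫ p₁ = f :=
  congrArg Prod.fst (lift_spec f g)

theorem lift_p₂ {X C D : A} (f : X ⟶ C) (g : X ⟶ D) : lift f g ≫ p₂ = g :=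
  congrArg Prod.snd (lift_spec f g)

theorem prod_ext {X C D : A} {h k : X ⟶ pr C D} (h₁ : h ≫ p₁ = k ≫ p₁) (h₂ : h ≫ p₂ = k ≫ p₂) :
    h = k :=
  (FiniteProducts.isCatIso_prod C D X).1.injective (Prod.ext h₁ h₂)

theorem prod_ext₂ {X C D : A} {h k : X ⟶ pr C D} {σ τ : h ⟶ k}
    (h₁ : σ ▷ p₁ = τ ▷ p₁) (h₂ : σ ▷ p₂ = τ ▷ p₂) : σ = τ :=
  (FiniteProducts.isCatIso_prod C D X).2.2.map_injective (Prod.ext h₁ h₂)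

/-- The 2-cell into a product with the given components. -/
noncomputable def lift₂ {X C D : A} {f f' : X ⟶ C} {g g' : X ⟶ D} (σ : f ⟶ f') (τ : g ⟶ g') :
    lift f g ⟶ lift f' g' :=
  ((FiniteProducts.isCatIso_prod C D X).2.1.map_surjective
    (show ((postcomp X (p₁ (C := C) (D := D))).prod' (postcomp X p₂)).obj (lift f g) ⟶
      ((postcomp X (p₁ (C := C) (D := D))).prod' (postcomp X p₂)).obj (lift f' g') from
      (eqToHom (lift_p₁ f g) ≫ σ ≫ eqToHom (lift_p₁ f' g').symm,
        eqToHom (lift_p₂ f g) ≫ τ ≫ eqToHom (lift_p₂ f' g').symm))).choose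

theorem lift₂_spec {X C D : A} {f f' : X ⟶ C} {g g' : X ⟶ D} (σ : f ⟶ f') (τ : g ⟶ g') :
    ((postcomp X (p₁ (C := C) (D := D))).prod' (postcomp X p₂)).map (lift₂ σ τ) =
      (eqToHom (lift_p₁ f g) ≫ σ ≫ eqToHom (lift_p₁ f' g').symm,
        eqToHom (lift_p₂ f g) ≫ τ ≫ eqToHom (lift_p₂ f' g').symm) :=
  ((FiniteProducts.isCatIso_prod C D X).2.1.map_surjective _).choose_spec

theorem lift₂_p₁ {X C D : A} {f f' : X ⟶ C} {g g' : X ⟶ D} (σ : f ⟶ f') (τ : g ⟶ g') :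
    lift₂ σ τ ▷ p₁ = eqToHom (lift_p₁ f g) ≫ σ ≫ eqToHom (lift_p₁ f' g').symm :=
  congrArg Prod.fst (lift₂_spec σ τ)

theorem lift₂_p₂ {X C D : A} {f f' : X ⟶ C} {g g' : X ⟶ D} (σ : f ⟶ f') (τ : g ⟶ g') :
    lift₂ σ τ ▷ p₂ = eqToHom (lift_p₂ f g) ≫ τ ≫ eqToHom (lift_p₂ f' g').symm :=
  congrArg Prod.snd (lift₂_spec σ τ)

theorem comp_lift {Y X C D : A} (L : Y ⟶ X) (f : X ⟶ C) (g : X ⟶ D) :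
    L ≫ lift f g = lift (L ≫ f) (L ≫ g) :=
  prod_ext (by rw [assoc₁, lift_p₁, lift_p₁]) (by rw [assoc₁, lift_p₂, lift_p₂])

theorem lift_p₁_p₂ {C D : A} : lift p₁ p₂ = 𝟙 (pr C D) :=
  prod_ext (by rw [lift_p₁, id_comp₁]) (by rw [lift_p₂, id_comp₁])

end Products

/-! ### 2-cells up to the identifications of a strict 2-category -/

section HEqs

variable {A : Type u} [Bicategory.{w, v} A]

theorem whiskerLeft_heq {X Y Z : A} {L L' : X ⟶ Y} (hL : L = L') {f f' g g' : Y ⟶ Z} (hf : f = f')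
    (hg : g = g') {σ : f ⟶ g} {σ' : f' ⟶ g'} (h : σ ≍ σ') : L ◁ σ ≍ L' ◁ σ' := by
  subst hL hf hg; cases h; rfl

theorem whiskerRight_heq {X Y Z : A} {L L' : Y ⟶ Z} (hL : L = L') {f f' g g' : X ⟶ Y} (hf : f = f')
    (hg : g = g') {σ : f ⟶ g} {σ' : f' ⟶ g'} (h : σ ≍ σ') : σ ▷ L ≍ σ' ▷ L' := by
  subst hL hf hg; cases h; rfl

theorem strip_left {X Y : A} {f f' g : X ⟶ Y} (h : f' = f) (σ : f ⟶ g) : eqToHom h ≫ σ ≍ σ := by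
  subst h; simp

theorem strip_right {X Y : A} {f g g' : X ⟶ Y} (h : g = g') (σ : f ⟶ g) : σ ≫ eqToHom h ≍ σ := by
  subst h; simp

theorem strip {X Y : A} {f f' g g' : X ⟶ Y} (h : f' = f) (h' : g = g') (σ : f ⟶ g) :
    eqToHom h ≫ σ ≫ eqToHom h' ≍ σ := by
  subst h h'; simp

theorem id_heq {X Y : A} {f g : X ⟶ Y} (h : f = g) : 𝟙 f ≍ 𝟙 g := by subst h; rfl

theorem eqToHom_heq_id {X Y : A} {f g k : X ⟶ Y} (h : f = g) (h' : f = k) :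
    eqToHom h ≍ 𝟙 k := by subst h; subst h'; rfl

variable [Bicategory.Strict A]

theorem whiskerLeft_comp_heq {X Y Z W : A} (L : X ⟶ Y) (K : Y ⟶ Z) {f g : Z ⟶ W} (σ : f ⟶ g) :
    (L ≫ K) ◁ σ ≍ L ◁ K ◁ σ := by
  rw [comp_whiskerLeft, Strict.associator_eqToIso, Strict.associator_eqToIso, eqToIso.hom,
    eqToIso.inv]
  exact strip _ _ _

theorem whiskerRight_comp_heq {X Y Z W : A} {f g : X ⟶ Y} (σ : f ⟶ g) (L : Y ⟶ Z) (K : Z ⟶ W) :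
    σ ▷ (L ≫ K) ≍ σ ▷ L ▷ K := by
  rw [whiskerRight_comp, Strict.associator_eqToIso, Strict.associator_eqToIso, eqToIso.hom,
    eqToIso.inv]
  exact strip _ _ _

theorem whisker_assoc_heq {X Y Z W : A} (L : X ⟶ Y) {f g : Y ⟶ Z} (σ : f ⟶ g) (K : Z ⟶ W) :
    (L ◁ σ) ▷ K ≍ L ◁ (σ ▷ K) := by
  rw [whisker_assoc, Strict.associator_eqToIso, Strict.associator_eqToIso, eqToIso.hom,
    eqToIso.inv]
  exact strip _ _ _

theorem id_whiskerLeft_heq {X Y : A} {f g : X ⟶ Y} (σ : f ⟶ g) : 𝟙 X ◁ σ ≍ σ := by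
  rw [id_whiskerLeft, Strict.leftUnitor_eqToIso, Strict.leftUnitor_eqToIso, eqToIso.hom,
    eqToIso.inv]
  exact strip _ _ _

theorem whiskerRight_id_heq {X Y : A} {f g : X ⟶ Y} (σ : f ⟶ g) : σ ▷ 𝟙 Y ≍ σ := by
  rw [whiskerRight_id, Strict.rightUnitor_eqToIso, Strict.rightUnitor_eqToIso, eqToIso.hom,
    eqToIso.inv]
  exact strip _ _ _

variable [FiniteProducts A]

theorem prod_hext₂ {X C D : A} {h k h' k' : X ⟶ pr C D} (eh : h = h') (ek : k = k') {σ : h ⟶ k}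
    {σ' : h' ⟶ k'} (h₁ : σ ▷ p₁ ≍ σ' ▷ p₁) (h₂ : σ ▷ p₂ ≍ σ' ▷ p₂) : σ ≍ σ' := by
  subst eh ek; exact heq_of_eq (prod_ext₂ (eq_of_heq h₁) (eq_of_heq h₂))

theorem lift₂_p₁_heq {X C D : A} {f f' : X ⟶ C} {g g' : X ⟶ D} (σ : f ⟶ f') (τ : g ⟶ g') :
    lift₂ σ τ ▷ p₁ ≍ σ := by rw [lift₂_p₁]; exact strip _ _ _

theorem lift₂_p₂_heq {X C D : A} {f f' : X ⟶ C} {g g' : X ⟶ D} (σ : f ⟶ f') (τ : g ⟶ g') :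
    lift₂ σ τ ▷ p₂ ≍ τ := by rw [lift₂_p₂]; exact strip _ _ _

theorem lift₂_heq {X C D : A} {a a' b b' : X ⟶ C} {c c' d d' : X ⟶ D} (ha : a = a') (hb : b = b')
    (hc : c = c') (hd : d = d') {σ : a ⟶ b} {σ' : a' ⟶ b'} {τ : c ⟶ d} {τ' : c' ⟶ d'}
    (h : σ ≍ σ') (h' : τ ≍ τ') : lift₂ σ τ ≍ lift₂ σ' τ' := by
  subst ha hb hc hd; cases h; cases h'; rfl

theorem whiskerLeft_lift₂ {Y X C D : A} (L : Y ⟶ X) {f f' : X ⟶ C} {g g' : X ⟶ D} (σ : f ⟶ f')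
    (τ : g ⟶ g') : L ◁ lift₂ σ τ ≍ lift₂ (L ◁ σ) (L ◁ τ) := by
  refine prod_hext₂ (comp_lift _ _ _) (comp_lift _ _ _) ?_ ?_
  · refine (whisker_assoc_heq _ _ _).trans (HEq.trans ?_ (lift₂_p₁_heq _ _).symm)
    exact whiskerLeft_heq rfl (lift_p₁ _ _) (lift_p₁ _ _) (lift₂_p₁_heq _ _)
  · refine (whisker_assoc_heq _ _ _).trans (HEq.trans ?_ (lift₂_p₂_heq _ _).symm)
    exact whiskerLeft_heq rfl (lift_p₂ _ _) (lift_p₂ _ _) (lift₂_p₂_heq _ _)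

theorem lift₂_id {X C D : A} (f : X ⟶ C) (g : X ⟶ D) : lift₂ (𝟙 f) (𝟙 g) = 𝟙 (lift f g) :=
  prod_ext₂ (by simp [lift₂_p₁]) (by simp [lift₂_p₂])

theorem lift₂_comp {X C D : A} {f f' f'' : X ⟶ C} {g g' g'' : X ⟶ D} (σ : f ⟶ f') (σ' : f' ⟶ f'')
    (τ : g ⟶ g') (τ' : g' ⟶ g'') : lift₂ (σ ≫ σ') (τ ≫ τ') = lift₂ σ τ ≫ lift₂ σ' τ' :=
  prod_ext₂ (by simp [lift₂_p₁]) (by simp [lift₂_p₂])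

end HEqs


/-! ### Monoidal objects

A 1-cell `X ⟶ C` is regarded as an object of `C` at stage `X`; the cells `tens`, `constAt`,
`assocAt`, `leftAt`, `rightAt` are the whiskerings of the structure of a monoidal object along the
1-cell classifying the given objects, up to the identifications of a strict 2-category. -/

section Stages

variable {A : Type u} [Bicategory.{w, v} A] [Bicategory.Strict A] [FiniteProducts A]

/-- `F ⊗ G` at stage `X`. -/
noncomputable def tens {X C : A} (t : pr C C ⟶ C) (F G : X ⟶ C) : X ⟶ C := lift F G ≫ t

/-- `σ ⊗ τ` at stage `X`. -/
noncomputable def tensHom {X C : A} (t : pr C C ⟶ C) {F F' G G' : X ⟶ C} (σ : F ⟶ F')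
    (τ : G ⟶ G') : tens t F G ⟶ tens t F' G' := lift₂ σ τ ▷ t

/-- The constant 1-cell at `I` with domain `X`. -/
noncomputable def constAt {C : A} (X : A) (I : pt A ⟶ C) : X ⟶ C := bang X ≫ I

theorem comp_tens {Y X C : A} (L : Y ⟶ X) (t : pr C C ⟶ C) (F G : X ⟶ C) :
    L ≫ tens t F G = tens t (L ≫ F) (L ≫ G) := by
  rw [tens, tens, ← assoc₁, comp_lift]

theorem comp_constAt {Y X C : A} (L : Y ⟶ X) (I : pt A ⟶ C) :
    L ≫ constAt X I = constAt Y I := by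
  rw [constAt, constAt, ← assoc₁, bang_uniq (L ≫ bang X) (bang Y)]

theorem tens_p₁_p₂ {C : A} (t : pr C C ⟶ C) : tens t p₁ p₂ = t := by
  rw [tens, lift_p₁_p₂, id_comp₁]

/-- The 1-cell classifying a triple of objects at stage `X`. -/
noncomputable abbrev lift3 {X C D E : A} (F : X ⟶ C) (G : X ⟶ D) (H : X ⟶ E) :
    X ⟶ pr C (pr D E) := lift F (lift G H)

theorem lift3_q₂ {X C D E : A} (F : X ⟶ C) (G : X ⟶ D) (H : X ⟶ E) :
    lift3 F G H ≫ p₂ ≫ p₁ = G := by rw [← assoc₁, lift_p₂, lift_p₁]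

theorem lift3_q₃ {X C D E : A} (F : X ⟶ C) (G : X ⟶ D) (H : X ⟶ E) :
    lift3 F G H ≫ p₂ ≫ p₂ = H := by rw [← assoc₁, lift_p₂, lift_p₂]

/-- `F ⊗ (G ⊗ H)` is the whiskering of `A ⊗ (B ⊗ C)`. -/
theorem lift3_tens_right {X C : A} (t : pr C C ⟶ C) (F G H : X ⟶ C) :
    lift3 F G H ≫ tens t p₁ (tens t (p₂ ≫ p₁) (p₂ ≫ p₂)) = tens t F (tens t G H) := by
  rw [comp_tens, comp_tens, lift_p₁, lift3_q₂, lift3_q₃]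

/-- `(F ⊗ G) ⊗ H` is the whiskering of `(A ⊗ B) ⊗ C`. -/
theorem lift3_tens_left {X C : A} (t : pr C C ⟶ C) (F G H : X ⟶ C) :
    lift3 F G H ≫ tens t (tens t p₁ (p₂ ≫ p₁)) (p₂ ≫ p₂) = tens t (tens t F G) H := by
  rw [comp_tens, comp_tens, lift_p₁, lift3_q₂, lift3_q₃]

theorem comp_tens_const_left {X C : A} (t : pr C C ⟶ C) (I : pt A ⟶ C) (F : X ⟶ C) :
    F ≫ tens t (constAt C I) (𝟙 C) = tens t (constAt X I) F := by
  rw [comp_tens, comp_constAt, comp_id₁]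

theorem comp_tens_const_right {X C : A} (t : pr C C ⟶ C) (I : pt A ⟶ C) (F : X ⟶ C) :
    F ≫ tens t (𝟙 C) (constAt C I) = tens t F (constAt X I) := by
  rw [comp_tens, comp_constAt, comp_id₁]

end Stages

/-- The data of a monoidal object on a 0-cell `C`: a tensor `C × C ⟶ C`, a unit `1 ⟶ C`, and
invertible 2-cells `A ⊗ (B ⊗ C) ⟶ (A ⊗ B) ⊗ C`, `I ⊗ A ⟶ A`, `A ⊗ I ⟶ A`, where `A`, `B`, `C`
are the projections. -/
structure MonoidalData {A : Type u} [Bicategory.{w, v} A] [Bicategory.Strict A]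
    [FiniteProducts A] (C : A) where
  tensor : pr C C ⟶ C
  unit : pt A ⟶ C
  assoc : tens tensor p₁ (tens tensor (p₂ ≫ p₁) (p₂ ≫ p₂)) ≅
    (tens tensor (tens tensor p₁ (p₂ ≫ p₁)) (p₂ ≫ p₂) : pr C (pr C C) ⟶ C)
  left : tens tensor (constAt C unit) (𝟙 C) ≅ 𝟙 C
  right : tens tensor (𝟙 C) (constAt C unit) ≅ 𝟙 C

namespace MonoidalData

variable {A : Type u} [Bicategory.{w, v} A] [Bicategory.Strict A] [FiniteProducts A] {C : A}
  (S : MonoidalData C)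

/-- `α_{F, G, H} : F ⊗ (G ⊗ H) ⟶ (F ⊗ G) ⊗ H` at stage `X`. -/
noncomputable def assocAt {X : A} (F G H : X ⟶ C) :
    tens S.tensor F (tens S.tensor G H) ⟶ tens S.tensor (tens S.tensor F G) H :=
  eqToHom (lift3_tens_right _ F G H).symm ≫ lift3 F G H ◁ S.assoc.hom ≫
    eqToHom (lift3_tens_left _ F G H)

/-- `λ_F : I ⊗ F ⟶ F` at stage `X`. -/
noncomputable def leftAt {X : A} (F : X ⟶ C) : tens S.tensor (constAt X S.unit) F ⟶ F :=
  eqToHom (comp_tens_const_left _ _ F).symm ≫ F ◁ S.left.hom ≫ eqToHom (comp_id₁ F)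

/-- `ρ_F : F ⊗ I ⟶ F` at stage `X`. -/
noncomputable def rightAt {X : A} (F : X ⟶ C) : tens S.tensor F (constAt X S.unit) ⟶ F :=
  eqToHom (comp_tens_const_right _ _ F).symm ≫ F ◁ S.right.hom ≫ eqToHom (comp_id₁ F)

/-- The pentagon for objects `F`, `G`, `H`, `K` at stage `X`. -/
def PentagonAt {X : A} (F G H K : X ⟶ C) : Prop :=
  tensHom S.tensor (𝟙 F) (S.assocAt G H K) ≫ S.assocAt F (tens S.tensor G H) K ≫
      tensHom S.tensor (S.assocAt F G H) (𝟙 K) =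
    S.assocAt F G (tens S.tensor H K) ≫ S.assocAt (tens S.tensor F G) H K

/-- The triangle for objects `F`, `G` at stage `X`. -/
def TriangleAt {X : A} (F G : X ⟶ C) : Prop :=
  S.assocAt F (constAt X S.unit) G ≫ tensHom S.tensor (S.rightAt F) (𝟙 G) =
    tensHom S.tensor (𝟙 F) (S.leftAt G)

end MonoidalData

/-- A monoidal structure on a 0-cell `C`: the pentagon and the triangle commute for the projections
from `C × (C × (C × C))` and `C × C`. -/
structure MonoidalStructure {A : Type u} [Bicategory.{w, v} A] [Bicategory.Strict A]
    [FiniteProducts A] (C : A) extends MonoidalData C where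
  pentagon : toMonoidalData.PentagonAt (X := pr C (pr C (pr C C)))
    p₁ (p₂ ≫ p₁) (p₂ ≫ p₂ ≫ p₁) (p₂ ≫ p₂ ≫ p₂)
  triangle : toMonoidalData.TriangleAt (X := pr C C) p₁ p₂

/-! ### Lax monoidal 1-cells and monoidal 2-cells -/

/-- The coherence 2-cells `F(A) ⊗ F(B) ⟶ F(A ⊗ B)` and `I ⟶ F(I)` of a lax monoidal 1-cell. -/
@[ext]
structure LaxData {A : Type u} [Bicategory.{w, v} A] [Bicategory.Strict A] [FiniteProducts A]
    {C D : A} (S : MonoidalData C) (T : MonoidalData D) (F : C ⟶ D) where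
  phi : tens T.tensor (p₁ ≫ F) (p₂ ≫ F) ⟶ S.tensor ≫ F
  phi₀ : T.unit ⟶ S.unit ≫ F

section LaxDataSection

variable {A : Type u} [Bicategory.{w, v} A] [Bicategory.Strict A] [FiniteProducts A]

theorem lift_tens_comp {X C D : A} (t : pr D D ⟶ D) (F : C ⟶ D) (G H : X ⟶ C) :
    lift G H ≫ tens t (p₁ ≫ F) (p₂ ≫ F) = tens t (G ≫ F) (H ≫ F) := by
  rw [comp_tens, ← assoc₁, ← assoc₁, lift_p₁, lift_p₂]

namespace LaxData

variable {C D : A} {S : MonoidalData C} {T : MonoidalData D} {F : C ⟶ D} (φ : LaxData S T F)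

/-- `φ_{G, H} : F(G) ⊗ F(H) ⟶ F(G ⊗ H)` at stage `X`. -/
noncomputable def phiAt {X : A} (G H : X ⟶ C) :
    tens T.tensor (G ≫ F) (H ≫ F) ⟶ tens S.tensor G H ≫ F :=
  eqToHom (lift_tens_comp _ F G H).symm ≫ lift G H ◁ φ.phi ≫ (α_ (lift G H) S.tensor F).inv

/-- `φ₀ : I ⟶ F(I)` at stage `X`. -/
noncomputable def phi₀At (X : A) : constAt X T.unit ⟶ constAt X S.unit ≫ F :=
  bang X ◁ φ.phi₀ ≫ (α_ (bang X) S.unit F).inv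

/-- Compatibility of a lax monoidal 1-cell with associativity, for objects at stage `X`. -/
def AssocAt {X : A} (G H K : X ⟶ C) : Prop :=
  T.assocAt (G ≫ F) (H ≫ F) (K ≫ F) ≫ tensHom T.tensor (φ.phiAt G H) (𝟙 (K ≫ F)) ≫
      φ.phiAt (tens S.tensor G H) K =
    tensHom T.tensor (𝟙 (G ≫ F)) (φ.phiAt H K) ≫ φ.phiAt G (tens S.tensor H K) ≫
      S.assocAt G H K ▷ F

/-- Compatibility of a lax monoidal 1-cell with the left unit, for an object at stage `X`. -/
def LeftAt {X : A} (G : X ⟶ C) : Prop :=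
  tensHom T.tensor (φ.phi₀At X) (𝟙 (G ≫ F)) ≫ φ.phiAt (constAt X S.unit) G ≫ S.leftAt G ▷ F =
    T.leftAt (G ≫ F)

/-- Compatibility of a lax monoidal 1-cell with the right unit, for an object at stage `X`. -/
def RightAt {X : A} (G : X ⟶ C) : Prop :=
  tensHom T.tensor (𝟙 (G ≫ F)) (φ.phi₀At X) ≫ φ.phiAt G (constAt X S.unit) ≫ S.rightAt G ▷ F =
    T.rightAt (G ≫ F)

end LaxData

end LaxDataSection

/-- A lax monoidal structure on a 1-cell `F` between monoidal objects. -/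
structure LaxStructure {A : Type u} [Bicategory.{w, v} A] [Bicategory.Strict A]
    [FiniteProducts A] {C D : A} (S : MonoidalData C) (T : MonoidalData D) (F : C ⟶ D)
    extends LaxData S T F where
  assoc : toLaxData.AssocAt (X := pr C (pr C C)) p₁ (p₂ ≫ p₁) (p₂ ≫ p₂)
  left : toLaxData.LeftAt (𝟙 C)
  right : toLaxData.RightAt (𝟙 C)

/-- A 2-cell `τ` between 1-cells with coherence 2-cells `φ`, `ψ` is monoidal. -/
structure IsMonoidalCell {A : Type u} [Bicategory.{w, v} A] [Bicategory.Strict A]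
    [FiniteProducts A] {C D : A} {S : MonoidalData C} {T : MonoidalData D} {F G : C ⟶ D}
    (φ : LaxData S T F) (ψ : LaxData S T G) (τ : F ⟶ G) : Prop where
  tensor : tensHom T.tensor (p₁ ◁ τ) (p₂ ◁ τ) ≫ ψ.phi = φ.phi ≫ S.tensor ◁ τ
  unit : φ.phi₀ ≫ S.unit ◁ τ = ψ.phi₀

/-! ### Whiskering of the cells at a stage -/

section StageLemmas

variable {A : Type u} [Bicategory.{w, v} A] [Bicategory.Strict A] [FiniteProducts A]

theorem tensHom_heq {X C : A} (t : pr C C ⟶ C) {a a' b b' c c' d d' : X ⟶ C} (ha : a = a')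
    (hb : b = b') (hc : c = c') (hd : d = d') {σ : a ⟶ b} {σ' : a' ⟶ b'} {τ : c ⟶ d}
    {τ' : c' ⟶ d'} (h : σ ≍ σ') (h' : τ ≍ τ') : tensHom t σ τ ≍ tensHom t σ' τ' := by
  subst ha hb hc hd; cases h; cases h'; rfl

theorem tensHom_id {X C : A} (t : pr C C ⟶ C) (F G : X ⟶ C) :
    tensHom t (𝟙 F) (𝟙 G) = 𝟙 (tens t F G) := by
  rw [tensHom, lift₂_id, id_whiskerRight]; rfl

theorem tensHom_comp {X C : A} (t : pr C C ⟶ C) {F F' F'' G G' G'' : X ⟶ C} (σ : F ⟶ F')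
    (σ' : F' ⟶ F'') (τ : G ⟶ G') (τ' : G' ⟶ G'') :
    tensHom t (σ ≫ σ') (τ ≫ τ') = tensHom t σ τ ≫ tensHom t σ' τ' := by
  rw [tensHom, lift₂_comp, comp_whiskerRight]; rfl

theorem tensHom_comp_id {X C : A} (t : pr C C ⟶ C) {F F' F'' : X ⟶ C} (G : X ⟶ C) (σ : F ⟶ F')
    (σ' : F' ⟶ F'') :
    tensHom t (σ ≫ σ') (𝟙 G) = tensHom t σ (𝟙 G) ≫ tensHom t σ' (𝟙 G) := by
  rw [← tensHom_comp, Category.comp_id]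

theorem tensHom_id_comp {X C : A} (t : pr C C ⟶ C) {F F' F'' : X ⟶ C} (G : X ⟶ C) (σ : F ⟶ F')
    (σ' : F' ⟶ F'') :
    tensHom t (𝟙 G) (σ ≫ σ') = tensHom t (𝟙 G) σ ≫ tensHom t (𝟙 G) σ' := by
  rw [← tensHom_comp, Category.comp_id]

theorem whiskerLeft_tensHom {Y X C : A} (L : Y ⟶ X) (t : pr C C ⟶ C) {F F' G G' : X ⟶ C}
    (σ : F ⟶ F') (τ : G ⟶ G') : L ◁ tensHom t σ τ ≍ tensHom t (L ◁ σ) (L ◁ τ) :=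
  (whisker_assoc_heq _ _ _).symm.trans
    (whiskerRight_heq rfl (comp_lift _ _ _) (comp_lift _ _ _) (whiskerLeft_lift₂ _ _ _))

theorem whiskerRight_lift {X Y C D : A} {f g : Y ⟶ X} (σ : f ⟶ g) (F : X ⟶ C) (G : X ⟶ D) :
    σ ▷ lift F G ≍ lift₂ (σ ▷ F) (σ ▷ G) := by
  refine prod_hext₂ (comp_lift _ _ _) (comp_lift _ _ _) ?_ ?_
  · refine (whiskerRight_comp_heq _ _ _).symm.trans (HEq.trans ?_ (lift₂_p₁_heq _ _).symm)
    rw [lift_p₁]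
  · refine (whiskerRight_comp_heq _ _ _).symm.trans (HEq.trans ?_ (lift₂_p₂_heq _ _).symm)
    rw [lift_p₂]

theorem whiskerRight_tens {X Y C : A} {f g : Y ⟶ X} (σ : f ⟶ g) (t : pr C C ⟶ C) (F G : X ⟶ C) :
    σ ▷ tens t F G ≍ tensHom t (σ ▷ F) (σ ▷ G) :=
  (whiskerRight_comp_heq _ _ _).trans
    (whiskerRight_heq rfl (comp_lift _ _ _) (comp_lift _ _ _) (whiskerRight_lift _ _ _))

namespace MonoidalData

variable {C : A} (S : MonoidalData C)

theorem assocAt_heq {X : A} (F G H : X ⟶ C) : S.assocAt F G H ≍ lift3 F G H ◁ S.assoc.hom :=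
  strip _ _ _

theorem whiskerLeft_assocAt {Y X : A} (L : Y ⟶ X) (F G H : X ⟶ C) :
    L ◁ S.assocAt F G H ≍ S.assocAt (L ≫ F) (L ≫ G) (L ≫ H) := by
  refine HEq.trans (whiskerLeft_heq rfl (lift3_tens_right _ _ _ _).symm
    (lift3_tens_left _ _ _ _).symm (S.assocAt_heq _ _ _)) ?_
  refine HEq.trans ?_ (S.assocAt_heq _ _ _).symm
  refine (whiskerLeft_comp_heq _ _ _).symm.trans ?_
  rw [lift3, comp_lift, comp_lift]

theorem assocAt_congr {X : A} {F F' G G' H H' : X ⟶ C} (hF : F = F') (hG : G = G')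
    (hH : H = H') : S.assocAt F G H ≍ S.assocAt F' G' H' := by subst hF hG hH; rfl

theorem whiskerLeft_leftAt {Y X : A} (L : Y ⟶ X) (F : X ⟶ C) :
    L ◁ S.leftAt F ≍ S.leftAt (L ≫ F) := by
  refine HEq.trans (whiskerLeft_heq rfl (comp_tens_const_left _ _ _).symm
    (comp_id₁ _).symm (strip _ _ _)) ?_
  exact HEq.trans (whiskerLeft_comp_heq _ _ _).symm (strip _ _ _).symm

theorem whiskerLeft_rightAt {Y X : A} (L : Y ⟶ X) (F : X ⟶ C) :
    L ◁ S.rightAt F ≍ S.rightAt (L ≫ F) := by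
  refine HEq.trans (whiskerLeft_heq rfl (comp_tens_const_right _ _ _).symm
    (comp_id₁ _).symm (strip _ _ _)) ?_
  exact HEq.trans (whiskerLeft_comp_heq _ _ _).symm (strip _ _ _).symm

end MonoidalData

namespace LaxData

variable {C D : A} {S : MonoidalData C} {T : MonoidalData D} {F : C ⟶ D} (φ : LaxData S T F)

theorem phiAt_heq {X : A} (G H : X ⟶ C) : φ.phiAt G H ≍ lift G H ◁ φ.phi := by
  rw [phiAt, Strict.associator_eqToIso, eqToIso.inv]; exact strip _ _ _

theorem phi₀At_heq (X : A) : φ.phi₀At X ≍ bang X ◁ φ.phi₀ := by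
  rw [phi₀At, Strict.associator_eqToIso, eqToIso.inv]; exact strip_right _ _

theorem phiAt_p₁_p₂ : φ.phiAt p₁ p₂ ≍ φ.phi := by
  refine (φ.phiAt_heq _ _).trans ?_
  rw [lift_p₁_p₂]
  exact id_whiskerLeft_heq _

theorem phiAt_congr {X : A} {G G' H H' : X ⟶ C} (hG : G = G') (hH : H = H') :
    φ.phiAt G H ≍ φ.phiAt G' H' := by subst hG hH; rfl

theorem whiskerLeft_phiAt {Y X : A} (L : Y ⟶ X) (G H : X ⟶ C) :
    L ◁ φ.phiAt G H ≍ φ.phiAt (L ≫ G) (L ≫ H) := by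
  refine HEq.trans (whiskerLeft_heq rfl (lift_tens_comp _ _ _ _).symm (assoc₁ _ _ _)
    (φ.phiAt_heq _ _)) ?_
  refine (whiskerLeft_comp_heq _ _ _).symm.trans (HEq.trans ?_ (φ.phiAt_heq _ _).symm)
  rw [comp_lift]

theorem whiskerLeft_phi₀At {Y X : A} (L : Y ⟶ X) : L ◁ φ.phi₀At X ≍ φ.phi₀At Y := by
  refine HEq.trans (whiskerLeft_heq rfl rfl (assoc₁ _ _ _) (φ.phi₀At_heq _)) ?_
  refine (whiskerLeft_comp_heq _ _ _).symm.trans (HEq.trans ?_ (φ.phi₀At_heq _).symm)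
  rw [bang_uniq (L ≫ bang X) (bang Y)]

theorem phiAt_naturality {X : A} {G G' H H' : X ⟶ C} (σ : G ⟶ G') (τ : H ⟶ H') :
    tensHom T.tensor (σ ▷ F) (τ ▷ F) ≫ φ.phiAt G' H' =
      φ.phiAt G H ≫ tensHom S.tensor σ τ ▷ F := by
  apply eq_of_heq
  have key := whisker_exchange (lift₂ σ τ) φ.phi
  refine HEq.trans ?_ ((heq_of_eq key.symm).trans ?_)
  · refine heq_comp (lift_tens_comp _ _ _ _).symm (lift_tens_comp _ _ _ _).symm (assoc₁ _ _ _) ?_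
      (φ.phiAt_heq _ _)
    refine HEq.trans ?_ (whiskerRight_tens _ _ _ _).symm
    refine tensHom_heq _ ?_ ?_ ?_ ?_ ?_ ?_
    any_goals rw [← assoc₁]
    any_goals rw [lift_p₁]
    any_goals rw [lift_p₂]
    · exact HEq.trans (whiskerRight_heq rfl (lift_p₁ _ _).symm (lift_p₁ _ _).symm
        (lift₂_p₁_heq _ _).symm) (whiskerRight_comp_heq _ _ _).symm
    · exact HEq.trans (whiskerRight_heq rfl (lift_p₂ _ _).symm (lift_p₂ _ _).symm
        (lift₂_p₂_heq _ _).symm) (whiskerRight_comp_heq _ _ _).symm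
  · exact heq_comp (lift_tens_comp _ _ _ _) (assoc₁ _ _ _).symm (assoc₁ _ _ _).symm
      (φ.phiAt_heq _ _).symm (whiskerRight_comp_heq _ _ _)

end LaxData

namespace LaxStructure

variable {C D : A} {S : MonoidalData C} {T : MonoidalData D} {F : C ⟶ D}
  (φ : LaxStructure S T F)

theorem assocAt_all {X : A} (G H K : X ⟶ C) : φ.AssocAt G H K := by
  have h := congrArg (lift3 G H K ◁ ·) φ.assoc
  simp only [whiskerLeft_comp] at h
  have e₁ : lift3 G H K ≫ p₁ = G := lift_p₁ _ _
  have e₂ := lift3_q₂ G H K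
  have e₃ := lift3_q₃ G H K
  have f₁ : lift3 G H K ≫ p₁ ≫ F = G ≫ F := by rw [← assoc₁, e₁]
  have f₂ : lift3 G H K ≫ (p₂ ≫ p₁) ≫ F = H ≫ F := by rw [← assoc₁, e₂]
  have f₃ : lift3 G H K ≫ (p₂ ≫ p₂) ≫ F = K ≫ F := by rw [← assoc₁, e₃]
  have f₁₂ : lift3 G H K ≫ tens S.tensor p₁ (p₂ ≫ p₁) ≫ F = tens S.tensor G H ≫ F := by
    rw [← assoc₁, comp_tens, e₁, e₂]
  have f₂₃ : lift3 G H K ≫ tens S.tensor (p₂ ≫ p₁) (p₂ ≫ p₂) ≫ F = tens S.tensor H K ≫ F := by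
    rw [← assoc₁, comp_tens, e₂, e₃]
  apply eq_of_heq
  refine HEq.trans ?_ ((heq_of_eq h).trans ?_)
  · refine heq_comp ?_ ?_ ?_ ?_ (heq_comp ?_ ?_ ?_ ?_ ?_)
    any_goals simp only [comp_tens, f₁, f₂, f₃, f₁₂]
    any_goals simp only [← assoc₁, comp_tens, e₁, e₂, e₃]
    · refine HEq.symm ((T.whiskerLeft_assocAt _ _ _ _).trans ?_)
      rw [f₁, f₂, f₃]
    · refine HEq.symm ((whiskerLeft_tensHom _ _ _ _).trans ?_)
      refine tensHom_heq _ ?_ ?_ f₃ f₃ ?_ ?_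
      · rw [comp_tens, f₁, f₂]
      · exact f₁₂
      · exact (φ.whiskerLeft_phiAt _ _ _).trans (φ.phiAt_congr e₁ e₂)
      · rw [whiskerLeft_id]; exact id_heq f₃
    · refine HEq.symm ((φ.whiskerLeft_phiAt _ _ _).trans (φ.phiAt_congr ?_ e₃))
      rw [comp_tens, e₁, e₂]
  · refine heq_comp ?_ ?_ ?_ ?_ (heq_comp ?_ ?_ ?_ ?_ ?_)
    any_goals simp only [comp_tens, f₁, f₂, f₃, f₂₃]
    any_goals simp only [← assoc₁, comp_tens, e₁, e₂, e₃]
    · refine (whiskerLeft_tensHom _ _ _ _).trans ?_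
      refine tensHom_heq _ f₁ f₁ ?_ ?_ ?_ ?_
      · rw [comp_tens, f₂, f₃]
      · exact f₂₃
      · rw [whiskerLeft_id]; exact id_heq f₁
      · exact (φ.whiskerLeft_phiAt _ _ _).trans (φ.phiAt_congr e₂ e₃)
    · refine (φ.whiskerLeft_phiAt _ _ _).trans (φ.phiAt_congr e₁ ?_)
      rw [comp_tens, e₂, e₃]
    · refine (whisker_assoc_heq _ _ _).symm.trans ?_
      refine whiskerRight_heq rfl ?_ ?_ ?_
      · simp only [comp_tens, e₁, e₂, e₃]
      · simp only [comp_tens, e₁, e₂, e₃]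
      · refine (S.whiskerLeft_assocAt _ _ _ _).trans ?_
        rw [e₁, e₂, e₃]

theorem leftAt_all {X : A} (G : X ⟶ C) : φ.LeftAt G := by
  have h := congrArg (G ◁ ·) φ.left
  simp only [whiskerLeft_comp] at h
  have f₁ : G ≫ 𝟙 C ≫ F = G ≫ F := by rw [id_comp₁]
  have f₂ : G ≫ constAt C S.unit ≫ F = constAt X S.unit ≫ F := by rw [← assoc₁, comp_constAt]
  apply eq_of_heq
  refine HEq.trans ?_ ((heq_of_eq h).trans ?_)
  · refine heq_comp ?_ ?_ ?_ ?_ (heq_comp ?_ ?_ ?_ ?_ ?_)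
    any_goals simp only [comp_tens, f₁, f₂, comp_constAt]
    any_goals simp only [← assoc₁, comp_tens, comp_constAt, comp_id₁]
    · refine HEq.symm ((whiskerLeft_tensHom _ _ _ _).trans ?_)
      refine tensHom_heq _ (comp_constAt _ _) f₂ f₁ f₁ (φ.whiskerLeft_phi₀At _) ?_
      rw [whiskerLeft_id]; exact id_heq f₁
    · exact HEq.symm ((φ.whiskerLeft_phiAt _ _ _).trans
        (φ.phiAt_congr (comp_constAt _ _) (comp_id₁ _)))
    · refine HEq.symm ((whisker_assoc_heq _ _ _).symm.trans ?_)
      refine whiskerRight_heq rfl ?_ (comp_id₁ _) ?_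
      · simp only [comp_tens, comp_constAt, comp_id₁]
      · refine (S.whiskerLeft_leftAt _ _).trans ?_
        rw [comp_id₁]
  · refine (T.whiskerLeft_leftAt _ _).trans ?_
    rw [f₁]

theorem rightAt_all {X : A} (G : X ⟶ C) : φ.RightAt G := by
  have h := congrArg (G ◁ ·) φ.right
  simp only [whiskerLeft_comp] at h
  have f₁ : G ≫ 𝟙 C ≫ F = G ≫ F := by rw [id_comp₁]
  have f₂ : G ≫ constAt C S.unit ≫ F = constAt X S.unit ≫ F := by rw [← assoc₁, comp_constAt]
  apply eq_of_heq
  refine HEq.trans ?_ ((heq_of_eq h).trans ?_)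
  · refine heq_comp ?_ ?_ ?_ ?_ (heq_comp ?_ ?_ ?_ ?_ ?_)
    any_goals simp only [comp_tens, f₁, f₂, comp_constAt]
    any_goals simp only [← assoc₁, comp_tens, comp_constAt, comp_id₁]
    · refine HEq.symm ((whiskerLeft_tensHom _ _ _ _).trans ?_)
      refine tensHom_heq _ f₁ f₁ (comp_constAt _ _) f₂ ?_ (φ.whiskerLeft_phi₀At _)
      rw [whiskerLeft_id]; exact id_heq f₁
    · exact HEq.symm ((φ.whiskerLeft_phiAt _ _ _).trans
        (φ.phiAt_congr (comp_id₁ _) (comp_constAt _ _)))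
    · refine HEq.symm ((whisker_assoc_heq _ _ _).symm.trans ?_)
      refine whiskerRight_heq rfl ?_ (comp_id₁ _) ?_
      · simp only [comp_tens, comp_constAt, comp_id₁]
      · refine (S.whiskerLeft_rightAt _ _).trans ?_
        rw [comp_id₁]
  · refine (T.whiskerLeft_rightAt _ _).trans ?_
    rw [f₁]

end LaxStructure

theorem IsMonoidalCell.tensorAt {C D : A} {S : MonoidalData C} {T : MonoidalData D} {F G : C ⟶ D}
    {φ : LaxData S T F} {ψ : LaxData S T G} {τ : F ⟶ G} (h : IsMonoidalCell φ ψ τ) {X : A}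
    (H K : X ⟶ C) :
    tensHom T.tensor (H ◁ τ) (K ◁ τ) ≫ ψ.phiAt H K =
      φ.phiAt H K ≫ tens S.tensor H K ◁ τ := by
  have h' := congrArg (lift H K ◁ ·) h.tensor
  simp only [whiskerLeft_comp] at h'
  apply eq_of_heq
  refine HEq.trans ?_ ((heq_of_eq h').trans ?_)
  · refine heq_comp (lift_tens_comp _ _ _ _).symm (lift_tens_comp _ _ _ _).symm (assoc₁ _ _ _) ?_
      (ψ.phiAt_heq _ _)
    refine HEq.symm ((whiskerLeft_tensHom _ _ _ _).trans ?_)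
    refine tensHom_heq _ ?_ ?_ ?_ ?_ ?_ ?_
    any_goals rw [← assoc₁]
    any_goals rw [lift_p₁]
    any_goals rw [lift_p₂]
    · refine (whiskerLeft_comp_heq _ _ _).symm.trans ?_
      rw [lift_p₁]
    · refine (whiskerLeft_comp_heq _ _ _).symm.trans ?_
      rw [lift_p₂]
  · exact heq_comp (lift_tens_comp _ _ _ _) (assoc₁ _ _ _).symm (assoc₁ _ _ _).symm
      (φ.phiAt_heq _ _).symm (whiskerLeft_comp_heq _ _ _).symm

end StageLemmas

/-! ### The 2-category of monoidal objects, lax monoidal 1-cells and monoidal 2-cells -/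

namespace LaxData

variable {A : Type u} [Bicategory.{w, v} A] [Bicategory.Strict A] [FiniteProducts A]
  {C D E K : A} {R : MonoidalData C} {S : MonoidalData D} {T : MonoidalData E} {V : MonoidalData K}

/-- The coherence 2-cells of an identity 1-cell. -/
noncomputable def id (S : MonoidalData C) : LaxData S S (𝟙 C) where
  phi := eqToHom (by rw [comp_id₁, comp_id₁, comp_id₁, tens_p₁_p₂])
  phi₀ := eqToHom (comp_id₁ _).symm

/-- The coherence 2-cells of a composite 1-cell: `G(F(A)) ⊗ G(F(B)) ⟶ G(F(A) ⊗ F(B)) ⟶ G(F(A ⊗ B))`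
and `I ⟶ G(I) ⟶ G(F(I))`. -/
noncomputable def comp {F : C ⟶ D} {G : D ⟶ E} (φ : LaxData R S F) (γ : LaxData S T G) :
    LaxData R T (F ≫ G) where
  phi := tensHom T.tensor (α_ p₁ F G).inv (α_ p₂ F G).inv ≫ γ.phiAt (p₁ ≫ F) (p₂ ≫ F) ≫
    φ.phi ▷ G ≫ (α_ R.tensor F G).hom
  phi₀ := γ.phi₀ ≫ φ.phi₀ ▷ G ≫ (α_ R.unit F G).hom

theorem id_phiAt_heq (S : MonoidalData C) {X : A} (G H : X ⟶ C) :
    (id S).phiAt G H ≍ 𝟙 (tens S.tensor G H) := by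
  refine ((id S).phiAt_heq _ _).trans ?_
  rw [id, whiskerLeft_eqToHom]
  exact eqToHom_heq_id _ (by rw [lift_tens_comp, comp_id₁, comp_id₁])

theorem id_phi₀At_heq (S : MonoidalData C) (X : A) :
    (id S).phi₀At X ≍ 𝟙 (constAt X S.unit) := by
  refine ((id S).phi₀At_heq _).trans ?_
  rw [id, whiskerLeft_eqToHom]
  exact eqToHom_heq_id _ rfl

theorem tensHom_assoc_heq {X : A} (t : pr E E ⟶ E) (F : C ⟶ D) (G : D ⟶ E) (H K : X ⟶ C) :
    tensHom t (α_ H F G).inv (α_ K F G).inv ≍ 𝟙 (tens t (H ≫ F ≫ G) (K ≫ F ≫ G)) := by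
  rw [← tensHom_id]
  refine tensHom_heq _ rfl (assoc₁ _ _ _) rfl (assoc₁ _ _ _) ?_ ?_
  all_goals
    rw [Strict.associator_eqToIso, eqToIso.inv]
    exact eqToHom_heq_id _ rfl

theorem comp_phi_heq {F : C ⟶ D} {G : D ⟶ E} (φ : LaxData R S F) (γ : LaxData S T G) :
    (comp φ γ).phi ≍ γ.phiAt (p₁ ≫ F) (p₂ ≫ F) ≫ φ.phi ▷ G := by
  have e : (α_ R.tensor F G).hom = eqToHom (assoc₁ _ _ _) := by
    rw [Strict.associator_eqToIso, eqToIso.hom]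
  have h₁ : tens T.tensor (p₁ ≫ F ≫ G) (p₂ ≫ F ≫ G) =
      tens T.tensor ((p₁ ≫ F) ≫ G) ((p₂ ≫ F) ≫ G) := by rw [assoc₁, assoc₁]
  rw [comp, e, ← Category.id_comp (γ.phiAt (p₁ ≫ F) (p₂ ≫ F) ≫ φ.phi ▷ G)]
  refine heq_comp h₁ rfl (assoc₁ _ _ _).symm ?_ ?_
  · exact (tensHom_assoc_heq _ _ _ _ _).trans (id_heq h₁)
  · refine heq_comp rfl rfl (assoc₁ _ _ _).symm HEq.rfl (strip_right _ _)

theorem comp_phi₀_heq {F : C ⟶ D} {G : D ⟶ E} (φ : LaxData R S F) (γ : LaxData S T G) :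
    (comp φ γ).phi₀ ≍ γ.phi₀ ≫ φ.phi₀ ▷ G := by
  have e : (α_ R.unit F G).hom = eqToHom (assoc₁ _ _ _) := by
    rw [Strict.associator_eqToIso, eqToIso.hom]
  rw [comp, e]
  exact heq_comp rfl rfl (assoc₁ _ _ _).symm HEq.rfl (strip_right _ _)

theorem comp_phiAt_heq {F : C ⟶ D} {G : D ⟶ E} (φ : LaxData R S F) (γ : LaxData S T G) {X : A}
    (H K : X ⟶ C) :
    (comp φ γ).phiAt H K ≍ γ.phiAt (H ≫ F) (K ≫ F) ≫ φ.phiAt H K ▷ G := by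
  have e₁ : lift H K ≫ p₁ ≫ F = H ≫ F := by rw [← assoc₁, lift_p₁]
  have e₂ : lift H K ≫ p₂ ≫ F = K ≫ F := by rw [← assoc₁, lift_p₂]
  refine ((comp φ γ).phiAt_heq _ _).trans ?_
  refine (whiskerLeft_heq rfl ?_ (assoc₁ _ _ _).symm (comp_phi_heq _ _)).trans ?_
  · rw [assoc₁, assoc₁]
  rw [whiskerLeft_comp]
  refine heq_comp ?_ ?_ ?_ ((γ.whiskerLeft_phiAt _ _ _).trans (γ.phiAt_congr e₁ e₂)) ?_
  · rw [comp_tens, ← assoc₁, ← assoc₁ _ (p₂ ≫ F), e₁, e₂]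
  · rw [← assoc₁, comp_tens, e₁, e₂]
  · rw [← assoc₁, ← assoc₁]; rfl
  · refine (whisker_assoc_heq _ _ _).symm.trans ?_
    exact whiskerRight_heq rfl (lift_tens_comp _ _ _ _) (assoc₁ _ _ _).symm (φ.phiAt_heq _ _).symm

theorem comp_phi₀At_heq {F : C ⟶ D} {G : D ⟶ E} (φ : LaxData R S F) (γ : LaxData S T G) (X : A) :
    (comp φ γ).phi₀At X ≍ γ.phi₀At X ≫ φ.phi₀At X ▷ G := by
  refine ((comp φ γ).phi₀At_heq _).trans ?_
  refine (whiskerLeft_heq rfl rfl (assoc₁ _ _ _).symm (comp_phi₀_heq _ _)).trans ?_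
  rw [whiskerLeft_comp]
  refine heq_comp rfl (assoc₁ _ _ _).symm ?_ (γ.phi₀At_heq _).symm ?_
  · rw [← assoc₁, ← assoc₁]; rfl
  · refine (whisker_assoc_heq _ _ _).symm.trans ?_
    exact whiskerRight_heq rfl rfl (assoc₁ _ _ _).symm (φ.phi₀At_heq _).symm

theorem hext {F F' : C ⟶ D} (h : F = F') {φ : LaxData R S F} {φ' : LaxData R S F'}
    (h₁ : φ.phi ≍ φ'.phi) (h₂ : φ.phi₀ ≍ φ'.phi₀) : φ ≍ φ' := by
  subst h
  exact heq_of_eq (LaxData.ext (eq_of_heq h₁) (eq_of_heq h₂))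

theorem id_comp_heq {F : C ⟶ D} (φ : LaxData R S F) : comp (id R) φ ≍ φ := by
  refine hext (id_comp₁ F) ?_ ?_
  · refine (comp_phi_heq _ _).trans ?_
    rw [id, eqToHom_whiskerRight]
    refine (strip_right _ _).trans (HEq.trans ?_ φ.phiAt_p₁_p₂)
    rw [comp_id₁, comp_id₁]
  · refine (comp_phi₀_heq _ _).trans ?_
    rw [id, eqToHom_whiskerRight]
    exact strip_right _ _

theorem comp_id_heq {F : C ⟶ D} (φ : LaxData R S F) : comp φ (id S) ≍ φ := by
  refine hext (comp_id₁ F) ?_ ?_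
  · refine (comp_phi_heq _ _).trans ?_
    rw [← Category.id_comp φ.phi]
    refine heq_comp ?_ ?_ (comp_id₁ _) ((id_phiAt_heq _ _ _).trans (id_heq rfl)) ?_
    · rw [comp_id₁, comp_id₁]
    · rw [comp_id₁]
    · rw [Category.id_comp]; exact whiskerRight_id_heq _
  · refine (comp_phi₀_heq _ _).trans ?_
    rw [id]
    exact (strip_left (comp_id₁ _).symm _).trans (whiskerRight_id_heq _)

theorem comp_assoc_heq {F : C ⟶ D} {G : D ⟶ E} {H : E ⟶ K} (φ : LaxData R S F)
    (γ : LaxData S T G) (δ : LaxData T V H) :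
    comp (comp φ γ) δ ≍ comp φ (comp γ δ) := by
  refine hext (assoc₁ F G H) ?_ ?_
  · refine (comp_phi_heq _ _).trans (HEq.trans ?_ (comp_phi_heq _ _).symm)
    have h : (comp φ γ).phi ▷ H ≍ (γ.phiAt (p₁ ≫ F) (p₂ ≫ F) ≫ φ.phi ▷ G) ▷ H :=
      whiskerRight_heq rfl (by rw [assoc₁, assoc₁]) (assoc₁ _ _ _).symm (comp_phi_heq _ _)
    rw [comp_whiskerRight] at h
    have h' := comp_phiAt_heq γ δ (p₁ ≫ F) (p₂ ≫ F)
    refine HEq.trans ?_ (heq_comp (f := δ.phiAt ((p₁ ≫ F) ≫ G) ((p₂ ≫ F) ≫ G) ≫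
      γ.phiAt (p₁ ≫ F) (p₂ ≫ F) ▷ H) (g := φ.phi ▷ G ▷ H) ?_ ?_ ?_ h'.symm
      (whiskerRight_comp_heq _ _ _).symm)
    · rw [assoc₂]
      refine heq_comp ?_ ?_ ?_ (δ.phiAt_congr (assoc₁ _ _ _).symm (assoc₁ _ _ _).symm) h
      · simp only [assoc₁]
      · simp only [assoc₁]
      · simp only [assoc₁]
    · simp only [assoc₁]
    · simp only [assoc₁]
    · simp only [assoc₁]
  · refine (comp_phi₀_heq _ _).trans (HEq.trans ?_ (comp_phi₀_heq _ _).symm)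
    have h : (comp φ γ).phi₀ ▷ H ≍ (γ.phi₀ ≫ φ.phi₀ ▷ G) ▷ H :=
      whiskerRight_heq rfl rfl (assoc₁ _ _ _).symm (comp_phi₀_heq _ _)
    rw [comp_whiskerRight] at h
    refine HEq.trans ?_ (heq_comp (f := δ.phi₀ ≫ γ.phi₀ ▷ H) (g := φ.phi₀ ▷ G ▷ H) rfl ?_ ?_
      (comp_phi₀_heq γ δ).symm (whiskerRight_comp_heq _ _ _).symm)
    · rw [assoc₂]
      exact heq_comp rfl rfl (by simp only [assoc₁]) HEq.rfl h
    · simp only [assoc₁]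
    · simp only [assoc₁]

end LaxData

namespace LaxStructure

variable {A : Type u} [Bicategory.{w, v} A] [Bicategory.Strict A] [FiniteProducts A]
  {C D E : A} {R : MonoidalData C} {S : MonoidalData D} {T : MonoidalData E}

theorem chase_assoc {𝒞 : Type*} [Category 𝒞] {x₁ x₂ x₃ x₄ x₅ x₆ y₁ y₂ y₃ y₄ z₁ z₂ : 𝒞}
    {a : x₁ ⟶ x₂} {b : x₂ ⟶ x₃} {c : x₃ ⟶ x₄} {d : x₄ ⟶ x₅} {e : x₅ ⟶ x₆} {b' : x₁ ⟶ y₁}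
    {c' : y₁ ⟶ y₂} {d' : y₂ ⟶ y₃} {e' : y₃ ⟶ y₄} {f' : y₄ ⟶ x₆} {g : x₃ ⟶ z₁} {h : z₁ ⟶ x₅}
    {g' : y₁ ⟶ z₂} {h' : z₂ ⟶ y₃} {k : z₂ ⟶ z₁}
    (n₁ : c ≫ d = g ≫ h) (n₂ : c' ≫ d' = g' ≫ h') (a₁ : a ≫ b ≫ g = b' ≫ g' ≫ k)
    (a₂ : k ≫ h ≫ e = h' ≫ e' ≫ f') :
    a ≫ (b ≫ c) ≫ d ≫ e = (b' ≫ c') ≫ (d' ≫ e') ≫ f' := by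
  simp only [Category.assoc]
  rw [reassoc_of% n₁, reassoc_of% n₂, ← a₂, reassoc_of% a₁]

theorem chase_unit {𝒞 : Type*} [Category 𝒞] {x₁ x₂ x₃ x₄ x₅ x₆ z₁ : 𝒞}
    {b : x₁ ⟶ x₂} {c : x₂ ⟶ x₃} {d : x₃ ⟶ x₄} {e : x₄ ⟶ x₅} {f : x₅ ⟶ x₆} {g : x₂ ⟶ z₁}
    {h : z₁ ⟶ x₄} {k : z₁ ⟶ x₆} {r : x₁ ⟶ x₆}
    (n₁ : c ≫ d = g ≫ h) (a₁ : b ≫ g ≫ k = r) (a₂ : h ≫ e ≫ f = k) :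
    (b ≫ c) ≫ (d ≫ e) ≫ f = r := by
  simp only [Category.assoc]
  rw [reassoc_of% n₁, a₂, a₁]

theorem toLaxData_injective {F : C ⟶ D} {φ φ' : LaxStructure R S F}
    (h : φ.toLaxData = φ'.toLaxData) : φ = φ' := by
  cases φ; cases φ'; cases h; rfl

/-- The identity 1-cell is lax monoidal. -/
noncomputable def id (S : MonoidalData C) : LaxStructure S S (𝟙 C) where
  toLaxData := LaxData.id S
  assoc := by
    have h := S.assocAt p₁ (p₂ ≫ p₁) (p₂ ≫ p₂)
    apply eq_of_heq
    refine HEq.trans (b := S.assocAt p₁ (p₂ ≫ p₁) (p₂ ≫ p₂) ≫ 𝟙 _ ≫ 𝟙 _) ?_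
      (HEq.trans (b := 𝟙 _ ≫ 𝟙 _ ≫ S.assocAt p₁ (p₂ ≫ p₁) (p₂ ≫ p₂)) (by simp) ?_)
    · refine heq_comp ?_ ?_ ?_ ?_ (heq_comp ?_ ?_ ?_ ?_ ?_)
      any_goals simp only [comp_id₁]
      · rw [comp_id₁, comp_id₁, comp_id₁]
      · rw [← tensHom_id]
        exact tensHom_heq _ (by simp only [comp_id₁]) (comp_id₁ _) (comp_id₁ _) (comp_id₁ _)
          (LaxData.id_phiAt_heq _ _ _) (id_heq (comp_id₁ _))
      · exact LaxData.id_phiAt_heq _ _ _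
    · refine heq_comp ?_ ?_ ?_ ?_ (heq_comp ?_ ?_ ?_ ?_ ?_)
      any_goals simp only [comp_id₁]
      · rw [← tensHom_id]
        exact tensHom_heq _ (comp_id₁ _).symm (comp_id₁ _).symm (by simp only [comp_id₁])
          (comp_id₁ _).symm
          (id_heq (comp_id₁ _).symm) (LaxData.id_phiAt_heq _ _ _).symm
      · exact (LaxData.id_phiAt_heq _ _ _).symm
      · exact (whiskerRight_id_heq _).symm
  left := by
    apply eq_of_heq
    refine HEq.trans (b := 𝟙 _ ≫ 𝟙 _ ≫ S.leftAt (𝟙 C)) ?_ (by rw [Category.id_comp, Category.id_comp, comp_id₁])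
    refine heq_comp ?_ ?_ ?_ ?_ (heq_comp ?_ ?_ ?_ ?_ ?_)
    any_goals simp only [comp_id₁]
    · rw [← tensHom_id]
      exact tensHom_heq _ rfl (comp_id₁ _) (comp_id₁ _) (comp_id₁ _)
        (LaxData.id_phi₀At_heq _ _) (id_heq (comp_id₁ _))
    · exact LaxData.id_phiAt_heq _ _ _
    · exact whiskerRight_id_heq _
  right := by
    apply eq_of_heq
    refine HEq.trans (b := 𝟙 _ ≫ 𝟙 _ ≫ S.rightAt (𝟙 C)) ?_ (by rw [Category.id_comp, Category.id_comp, comp_id₁])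
    refine heq_comp ?_ ?_ ?_ ?_ (heq_comp ?_ ?_ ?_ ?_ ?_)
    any_goals simp only [comp_id₁]
    · rw [← tensHom_id]
      exact tensHom_heq _ (comp_id₁ _) (comp_id₁ _) rfl (comp_id₁ _) (id_heq (comp_id₁ _))
        (LaxData.id_phi₀At_heq _ _)
    · exact LaxData.id_phiAt_heq _ _ _
    · exact whiskerRight_id_heq _

/-- A composite of lax monoidal 1-cells is lax monoidal. -/
noncomputable def comp {F : C ⟶ D} {G : D ⟶ E} (φ : LaxStructure R S F) (γ : LaxStructure S T G) :
    LaxStructure R T (F ≫ G) where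
  toLaxData := LaxData.comp φ.toLaxData γ.toLaxData
  assoc := by
    have key : ∀ {X : A} (H K L : X ⟶ C),
        T.assocAt ((H ≫ F) ≫ G) ((K ≫ F) ≫ G) ((L ≫ F) ≫ G) ≫
          tensHom T.tensor (γ.phiAt (H ≫ F) (K ≫ F) ≫ φ.phiAt H K ▷ G) (𝟙 ((L ≫ F) ≫ G)) ≫
            γ.phiAt (tens R.tensor H K ≫ F) (L ≫ F) ≫ φ.phiAt (tens R.tensor H K) L ▷ G =
        tensHom T.tensor (𝟙 ((H ≫ F) ≫ G)) (γ.phiAt (K ≫ F) (L ≫ F) ≫ φ.phiAt K L ▷ G) ≫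
          (γ.phiAt (H ≫ F) (tens R.tensor K L ≫ F) ≫ φ.phiAt H (tens R.tensor K L) ▷ G) ≫
            R.assocAt H K L ▷ F ▷ G := by
      intro X H K L
      have n₁ := γ.phiAt_naturality (φ.phiAt H K) (𝟙 (L ≫ F))
      have n₂ := γ.phiAt_naturality (𝟙 (H ≫ F)) (φ.phiAt K L)
      rw [id_whiskerRight] at n₁ n₂
      have a₁ := γ.assocAt_all (H ≫ F) (K ≫ F) (L ≫ F)
      have a₂ := congrArg (· ▷ G) (φ.assocAt_all H K L)
      simp only [comp_whiskerRight] at a₂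
      rw [tensHom_comp_id, tensHom_id_comp]
      exact chase_assoc n₁ n₂ a₁ a₂
    apply eq_of_heq
    refine HEq.trans ?_ ((heq_of_eq (key p₁ (p₂ ≫ p₁) (p₂ ≫ p₂))).trans ?_)
    · refine heq_comp ?_ ?_ ?_ ?_ (heq_comp ?_ ?_ ?_ ?_ ?_)
      any_goals simp only [assoc₁]
      · exact T.assocAt_congr (assoc₁ _ _ _).symm (assoc₁ _ _ _).symm (assoc₁ _ _ _).symm
      · refine tensHom_heq _ (by simp only [assoc₁]) (assoc₁ _ _ _).symm (by simp only [assoc₁])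
          (by simp only [assoc₁]) (LaxData.comp_phiAt_heq _ _ _ _)
          (id_heq (by simp only [assoc₁]))
      · refine (LaxData.comp_phiAt_heq _ _ _ _).trans ?_
        exact heq_comp rfl rfl rfl HEq.rfl HEq.rfl
    · refine heq_comp ?_ ?_ ?_ ?_ (heq_comp ?_ ?_ ?_ ?_ ?_)
      any_goals simp only [assoc₁]
      · refine tensHom_heq _ (by simp only [assoc₁]) (by simp only [assoc₁])
          (by simp only [assoc₁]) (by simp only [assoc₁]) (id_heq (by simp only [assoc₁]))
          (LaxData.comp_phiAt_heq _ _ _ _).symm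
      · exact (LaxData.comp_phiAt_heq _ _ _ _).symm
      · exact (whiskerRight_comp_heq _ _ _).symm
  left := by
    have key : ∀ {X : A} (H : X ⟶ C),
        tensHom T.tensor (γ.phi₀At X ≫ φ.phi₀At X ▷ G) (𝟙 ((H ≫ F) ≫ G)) ≫
          (γ.phiAt (constAt X R.unit ≫ F) (H ≫ F) ≫ φ.phiAt (constAt X R.unit) H ▷ G) ≫
            R.leftAt H ▷ F ▷ G = T.leftAt ((H ≫ F) ≫ G) := by
      intro X H
      have n₁ := γ.phiAt_naturality (φ.phi₀At X) (𝟙 (H ≫ F))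
      rw [id_whiskerRight] at n₁
      have a₁ := γ.leftAt_all (H ≫ F)
      have a₂ := congrArg (· ▷ G) (φ.leftAt_all H)
      simp only [comp_whiskerRight] at a₂
      rw [tensHom_comp_id]
      exact chase_unit n₁ a₁ a₂
    apply eq_of_heq
    refine HEq.trans ?_ ((heq_of_eq (key (𝟙 C))).trans ?_)
    · refine heq_comp ?_ ?_ ?_ ?_ (heq_comp ?_ ?_ ?_ ?_ ?_)
      any_goals simp only [assoc₁]
      · exact tensHom_heq _ rfl (by simp only [assoc₁]) (by simp only [assoc₁])
          (by simp only [assoc₁]) (LaxData.comp_phi₀At_heq _ _ _) (id_heq (by simp only [assoc₁]))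
      · exact LaxData.comp_phiAt_heq _ _ _ _
      · exact whiskerRight_comp_heq _ _ _
    · rw [assoc₁]
  right := by
    have key : ∀ {X : A} (H : X ⟶ C),
        tensHom T.tensor (𝟙 ((H ≫ F) ≫ G)) (γ.phi₀At X ≫ φ.phi₀At X ▷ G) ≫
          (γ.phiAt (H ≫ F) (constAt X R.unit ≫ F) ≫ φ.phiAt H (constAt X R.unit) ▷ G) ≫
            R.rightAt H ▷ F ▷ G = T.rightAt ((H ≫ F) ≫ G) := by
      intro X H
      have n₁ := γ.phiAt_naturality (𝟙 (H ≫ F)) (φ.phi₀At X)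
      rw [id_whiskerRight] at n₁
      have a₁ := γ.rightAt_all (H ≫ F)
      have a₂ := congrArg (· ▷ G) (φ.rightAt_all H)
      simp only [comp_whiskerRight] at a₂
      rw [tensHom_id_comp]
      exact chase_unit n₁ a₁ a₂
    apply eq_of_heq
    refine HEq.trans ?_ ((heq_of_eq (key (𝟙 C))).trans ?_)
    · refine heq_comp ?_ ?_ ?_ ?_ (heq_comp ?_ ?_ ?_ ?_ ?_)
      any_goals simp only [assoc₁]
      · exact tensHom_heq _ (by simp only [assoc₁]) (by simp only [assoc₁]) rfl
          (by simp only [assoc₁]) (id_heq (by simp only [assoc₁])) (LaxData.comp_phi₀At_heq _ _ _)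
      · exact LaxData.comp_phiAt_heq _ _ _ _
      · exact whiskerRight_comp_heq _ _ _
    · rw [assoc₁]

end LaxStructure

section MonoidalCells

variable {A : Type u} [Bicategory.{w, v} A] [Bicategory.Strict A] [FiniteProducts A]
  {C D E : A} {R : MonoidalData C} {S : MonoidalData D} {T : MonoidalData E}

theorem IsMonoidalCell.of_eq {F G : C ⟶ D} (h : F = G) {φ : LaxData R S F} {ψ : LaxData R S G}
    (h' : φ ≍ ψ) : IsMonoidalCell φ ψ (eqToHom h) := by
  subst h
  cases h'
  constructor
  · simp only [eqToHom_refl, whiskerLeft_id, tensHom_id]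
    rw [Category.comp_id, Category.id_comp]
  · simp only [eqToHom_refl, whiskerLeft_id]
    rw [Category.comp_id]

theorem IsMonoidalCell.id {F : C ⟶ D} (φ : LaxData R S F) : IsMonoidalCell φ φ (𝟙 F) :=
  IsMonoidalCell.of_eq rfl HEq.rfl

theorem IsMonoidalCell.comp {F G H : C ⟶ D} {φ : LaxData R S F} {ψ : LaxData R S G}
    {χ : LaxData R S H} {σ : F ⟶ G} {τ : G ⟶ H} (hσ : IsMonoidalCell φ ψ σ)
    (hτ : IsMonoidalCell ψ χ τ) : IsMonoidalCell φ χ (σ ≫ τ) := by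
  constructor
  · rw [whiskerLeft_comp, whiskerLeft_comp, tensHom_comp, assoc₂, hτ.tensor, ← assoc₂, hσ.tensor,
      assoc₂, whiskerLeft_comp]
  · rw [whiskerLeft_comp, ← assoc₂, hσ.unit, hτ.unit]

theorem IsMonoidalCell.whiskerLeft {F : C ⟶ D} (φ : LaxData R S F) {G H : D ⟶ E}
    {γ : LaxData S T G} {δ : LaxData S T H} {τ : G ⟶ H} (hτ : IsMonoidalCell γ δ τ) :
    IsMonoidalCell (φ.comp γ) (φ.comp δ) (F ◁ τ) := by
  constructor
  · have key : tensHom T.tensor ((p₁ ≫ F) ◁ τ) ((p₂ ≫ F) ◁ τ) ≫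
        δ.phiAt (p₁ ≫ F) (p₂ ≫ F) ≫ φ.phi ▷ H =
        (γ.phiAt (p₁ ≫ F) (p₂ ≫ F) ≫ φ.phi ▷ G) ≫ (R.tensor ≫ F) ◁ τ := by
      rw [← assoc₂, hτ.tensorAt, assoc₂, assoc₂, whisker_exchange]
    apply eq_of_heq
    refine HEq.trans ?_ ((heq_of_eq key).trans ?_)
    · refine heq_comp ?_ ?_ (assoc₁ _ _ _).symm ?_ (LaxData.comp_phi_heq _ _)
      · rw [assoc₁, assoc₁]
      · rw [assoc₁, assoc₁]
      · exact tensHom_heq _ (assoc₁ _ _ _).symm (assoc₁ _ _ _).symm (assoc₁ _ _ _).symm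
          (assoc₁ _ _ _).symm (whiskerLeft_comp_heq _ _ _).symm (whiskerLeft_comp_heq _ _ _).symm
    · refine heq_comp ?_ (assoc₁ _ _ _) (assoc₁ _ _ _) (LaxData.comp_phi_heq _ _).symm
        (whiskerLeft_comp_heq _ _ _)
      rw [assoc₁, assoc₁]
  · have key : (γ.phi₀ ≫ φ.phi₀ ▷ G) ≫ (R.unit ≫ F) ◁ τ = δ.phi₀ ≫ φ.phi₀ ▷ H := by
      rw [assoc₂, ← whisker_exchange, ← assoc₂, hτ.unit]
    apply eq_of_heq
    refine HEq.trans ?_ ((heq_of_eq key).trans (LaxData.comp_phi₀_heq _ _).symm)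
    exact heq_comp rfl (assoc₁ _ _ _).symm (assoc₁ _ _ _).symm (LaxData.comp_phi₀_heq _ _)
      (whiskerLeft_comp_heq _ _ _).symm

theorem IsMonoidalCell.whiskerRight {F G : C ⟶ D} {φ : LaxData R S F} {ψ : LaxData R S G}
    {τ : F ⟶ G} (hτ : IsMonoidalCell φ ψ τ) {H : D ⟶ E} (γ : LaxData S T H) :
    IsMonoidalCell (φ.comp γ) (ψ.comp γ) (τ ▷ H) := by
  constructor
  · have key : tensHom T.tensor ((p₁ ◁ τ) ▷ H) ((p₂ ◁ τ) ▷ H) ≫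
        γ.phiAt (p₁ ≫ G) (p₂ ≫ G) ≫ ψ.phi ▷ H =
        (γ.phiAt (p₁ ≫ F) (p₂ ≫ F) ≫ φ.phi ▷ H) ≫ (R.tensor ◁ τ) ▷ H := by
      rw [← assoc₂, γ.phiAt_naturality, assoc₂, assoc₂, ← comp_whiskerRight, ← comp_whiskerRight,
        hτ.tensor]
    apply eq_of_heq
    refine HEq.trans ?_ ((heq_of_eq key).trans ?_)
    · refine heq_comp ?_ ?_ (assoc₁ _ _ _).symm ?_ (LaxData.comp_phi_heq _ _)
      · rw [assoc₁, assoc₁]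
      · rw [assoc₁, assoc₁]
      · exact tensHom_heq _ (assoc₁ _ _ _).symm (assoc₁ _ _ _).symm (assoc₁ _ _ _).symm
          (assoc₁ _ _ _).symm (whisker_assoc_heq _ _ _).symm (whisker_assoc_heq _ _ _).symm
    · refine heq_comp ?_ (assoc₁ _ _ _) (assoc₁ _ _ _) (LaxData.comp_phi_heq _ _).symm
        (whisker_assoc_heq _ _ _)
      rw [assoc₁, assoc₁]
  · have key : (γ.phi₀ ≫ φ.phi₀ ▷ H) ≫ (R.unit ◁ τ) ▷ H = γ.phi₀ ≫ ψ.phi₀ ▷ H := by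
      rw [assoc₂, ← comp_whiskerRight, hτ.unit]
    apply eq_of_heq
    refine HEq.trans ?_ ((heq_of_eq key).trans (LaxData.comp_phi₀_heq _ _).symm)
    exact heq_comp rfl (assoc₁ _ _ _).symm (assoc₁ _ _ _).symm (LaxData.comp_phi₀_heq _ _)
      (whisker_assoc_heq _ _ _).symm

end MonoidalCells

/-- A monoidal object in `A`: a 0-cell of `Mon_l(A)`. -/
structure MonoidalObject (A : Type u) [Bicategory.{w, v} A] [Bicategory.Strict A]
    [FiniteProducts A] where
  carrier : A
  str : MonoidalStructure carrier

section MonL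

variable {A : Type u} [Bicategory.{w, v} A] [Bicategory.Strict A] [FiniteProducts A]

/-- A lax monoidal 1-cell: a 1-cell of `Mon_l(A)`. -/
structure LaxMonoidalCell (M N : MonoidalObject A) where
  cell : M.carrier ⟶ N.carrier
  lax : LaxStructure M.str.toMonoidalData N.str.toMonoidalData cell

/-- A monoidal 2-cell between lax monoidal 1-cells: a 2-cell of `Mon_l(A)`. -/
@[ext]
structure MonoidalTransformation {M N : MonoidalObject A} (F G : LaxMonoidalCell M N) where
  cell : F.cell ⟶ G.cell
  isMonoidal : IsMonoidalCell F.lax.toLaxData G.lax.toLaxData cell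

namespace LaxMonoidalCell

variable {M N P Q : MonoidalObject A}

/-- A lax monoidal 1-cell is strong if its coherence 2-cells are invertible. -/
def IsStrong (F : LaxMonoidalCell M N) : Prop := IsIso F.lax.phi ∧ IsIso F.lax.phi₀

theorem hext {F G : LaxMonoidalCell M N} (h : F.cell = G.cell)
    (h' : F.lax.toLaxData ≍ G.lax.toLaxData) : F = G := by
  obtain ⟨F, φ⟩ := F
  obtain ⟨G, γ⟩ := G
  dsimp only at h h'
  subst h
  rw [LaxStructure.toLaxData_injective (eq_of_heq h')]

/-- The identity lax monoidal 1-cell. -/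
noncomputable def id (M : MonoidalObject A) : LaxMonoidalCell M M :=
  ⟨𝟙 M.carrier, LaxStructure.id _⟩

/-- The composite of lax monoidal 1-cells. -/
noncomputable def comp (F : LaxMonoidalCell M N) (G : LaxMonoidalCell N P) :
    LaxMonoidalCell M P := ⟨F.cell ≫ G.cell, F.lax.comp G.lax⟩

theorem id_comp (F : LaxMonoidalCell M N) : comp (id M) F = F :=
  hext (id_comp₁ _) (LaxData.id_comp_heq _)

theorem comp_id (F : LaxMonoidalCell M N) : comp F (id N) = F :=
  hext (comp_id₁ _) (LaxData.comp_id_heq _)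

theorem assoc (F : LaxMonoidalCell M N) (G : LaxMonoidalCell N P) (H : LaxMonoidalCell P Q) :
    comp (comp F G) H = comp F (comp G H) :=
  hext (assoc₁ _ _ _) (LaxData.comp_assoc_heq _ _ _)

instance (M N : MonoidalObject A) : Category (LaxMonoidalCell M N) where
  Hom F G := MonoidalTransformation F G
  id F := ⟨𝟙 F.cell, IsMonoidalCell.id _⟩
  comp σ τ := ⟨σ.cell ≫ τ.cell, σ.isMonoidal.comp τ.isMonoidal⟩
  id_comp _ := MonoidalTransformation.ext (Category.id_comp _)
  comp_id _ := MonoidalTransformation.ext (Category.comp_id _)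
  assoc _ _ _ := MonoidalTransformation.ext (Category.assoc _ _ _)

theorem hom_ext {F G : LaxMonoidalCell M N} {σ τ : F ⟶ G}
    (h : MonoidalTransformation.cell σ = MonoidalTransformation.cell τ) : σ = τ :=
  MonoidalTransformation.ext h

theorem eqToHom_cell {F G : LaxMonoidalCell M N} (h : F = G) :
    MonoidalTransformation.cell (eqToHom h) = eqToHom (congrArg LaxMonoidalCell.cell h) := by
  subst h; rfl

end LaxMonoidalCell

theorem eqToIso_cell_hom {M N : MonoidalObject A} {F G : LaxMonoidalCell M N} (h : F = G) :
    MonoidalTransformation.cell (eqToIso h).hom = eqToHom (congrArg LaxMonoidalCell.cell h) :=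
  LaxMonoidalCell.eqToHom_cell h

theorem eqToIso_cell_inv {M N : MonoidalObject A} {F G : LaxMonoidalCell M N} (h : F = G) :
    MonoidalTransformation.cell (eqToIso h).inv = eqToHom (congrArg LaxMonoidalCell.cell h).symm :=
  LaxMonoidalCell.eqToHom_cell h.symm

/-- Whiskering of a monoidal 2-cell by a lax monoidal 1-cell on the left. -/
noncomputable def LaxMonoidalCell.whiskerL {M N P : MonoidalObject A} (F : LaxMonoidalCell M N)
    {G H : LaxMonoidalCell N P} (τ : G ⟶ H) : F.comp G ⟶ F.comp H :=
  MonoidalTransformation.mk (F.cell ◁ MonoidalTransformation.cell τ)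
    ((MonoidalTransformation.isMonoidal τ).whiskerLeft _)

/-- Whiskering of a monoidal 2-cell by a lax monoidal 1-cell on the right. -/
noncomputable def LaxMonoidalCell.whiskerR {M N P : MonoidalObject A} {F G : LaxMonoidalCell M N}
    (τ : F ⟶ G) (H : LaxMonoidalCell N P) : F.comp H ⟶ G.comp H :=
  MonoidalTransformation.mk (MonoidalTransformation.cell τ ▷ H.cell)
    ((MonoidalTransformation.isMonoidal τ).whiskerRight _)

/-- The 2-category `Mon_l(A)` of monoidal objects, lax monoidal 1-cells and monoidal 2-cells. -/
noncomputable instance MonL : Bicategory (MonoidalObject A) where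
  Hom M N := LaxMonoidalCell M N
  id M := LaxMonoidalCell.id M
  comp F G := LaxMonoidalCell.comp F G
  whiskerLeft F _ _ τ := LaxMonoidalCell.whiskerL F τ
  whiskerRight τ H := LaxMonoidalCell.whiskerR τ H
  associator F G H := eqToIso (LaxMonoidalCell.assoc F G H)
  leftUnitor F := eqToIso (LaxMonoidalCell.id_comp F)
  rightUnitor F := eqToIso (LaxMonoidalCell.comp_id F)
  whiskerLeft_id _ _ := LaxMonoidalCell.hom_ext (whiskerLeft_id _ _)
  whiskerLeft_comp _ _ _ _ _ _ := LaxMonoidalCell.hom_ext (whiskerLeft_comp _ _ _)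
  id_whiskerLeft {_ _ F G} τ := by
    refine LaxMonoidalCell.hom_ext ?_
    have h := id_whiskerLeft (MonoidalTransformation.cell τ)
    rw [Strict.leftUnitor_eqToIso, Strict.leftUnitor_eqToIso, eqToIso.hom, eqToIso.inv] at h
    exact h.trans (congrArg₂ (· ≫ ·) (eqToIso_cell_hom (LaxMonoidalCell.id_comp F)).symm
      (congrArg₂ (· ≫ ·) rfl (eqToIso_cell_inv (LaxMonoidalCell.id_comp G)).symm))
  comp_whiskerLeft F G H K τ := by
    refine LaxMonoidalCell.hom_ext ?_
    have h := comp_whiskerLeft F.cell G.cell (MonoidalTransformation.cell τ)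
    rw [Strict.associator_eqToIso, Strict.associator_eqToIso, eqToIso.hom, eqToIso.inv] at h
    exact h.trans (congrArg₂ (· ≫ ·) (eqToIso_cell_hom (LaxMonoidalCell.assoc F G H)).symm
      (congrArg₂ (· ≫ ·) rfl (eqToIso_cell_inv (LaxMonoidalCell.assoc F G K)).symm))
  id_whiskerRight _ _ := LaxMonoidalCell.hom_ext (id_whiskerRight _ _)
  comp_whiskerRight _ _ _ := LaxMonoidalCell.hom_ext (comp_whiskerRight _ _ _)
  whiskerRight_id {_ _ F G} τ := by
    refine LaxMonoidalCell.hom_ext ?_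
    have h := whiskerRight_id (MonoidalTransformation.cell τ)
    rw [Strict.rightUnitor_eqToIso, Strict.rightUnitor_eqToIso, eqToIso.hom, eqToIso.inv] at h
    exact h.trans (congrArg₂ (· ≫ ·) (eqToIso_cell_hom (LaxMonoidalCell.comp_id F)).symm
      (congrArg₂ (· ≫ ·) rfl (eqToIso_cell_inv (LaxMonoidalCell.comp_id G)).symm))
  whiskerRight_comp {_ _ _ _ F K} τ G H := by
    refine LaxMonoidalCell.hom_ext ?_
    have h := whiskerRight_comp (MonoidalTransformation.cell τ) G.cell H.cell
    rw [Strict.associator_eqToIso, Strict.associator_eqToIso, eqToIso.hom, eqToIso.inv] at h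
    exact h.trans (congrArg₂ (· ≫ ·) (eqToIso_cell_inv (LaxMonoidalCell.assoc F G H)).symm
      (congrArg₂ (· ≫ ·) rfl (eqToIso_cell_hom (LaxMonoidalCell.assoc K G H)).symm))
  whisker_assoc F G K τ H := by
    refine LaxMonoidalCell.hom_ext ?_
    have h := whisker_assoc F.cell (MonoidalTransformation.cell τ) H.cell
    rw [Strict.associator_eqToIso, Strict.associator_eqToIso, eqToIso.hom, eqToIso.inv] at h
    exact h.trans (congrArg₂ (· ≫ ·) (eqToIso_cell_hom (LaxMonoidalCell.assoc F G H)).symm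
      (congrArg₂ (· ≫ ·) rfl (eqToIso_cell_inv (LaxMonoidalCell.assoc F K H)).symm))
  whisker_exchange σ τ := LaxMonoidalCell.hom_ext
    (whisker_exchange (MonoidalTransformation.cell σ) (MonoidalTransformation.cell τ))
  pentagon F G H K := by
    refine LaxMonoidalCell.hom_ext ?_
    have h := pentagon F.cell G.cell H.cell K.cell
    simp only [Strict.associator_eqToIso, eqToIso.hom] at h
    have l := congrArg₂ (· ≫ ·)
      (congrArg (· ▷ K.cell) (eqToIso_cell_hom (LaxMonoidalCell.assoc F G H)))
      (congrArg₂ (· ≫ ·) (eqToIso_cell_hom (LaxMonoidalCell.assoc F (G.comp H) K))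
        (congrArg (F.cell ◁ ·) (eqToIso_cell_hom (LaxMonoidalCell.assoc G H K))))
    have r := congrArg₂ (· ≫ ·) (eqToIso_cell_hom (LaxMonoidalCell.assoc (F.comp G) H K))
      (eqToIso_cell_hom (LaxMonoidalCell.assoc F G (H.comp K)))
    exact l.trans (h.trans r.symm)
  triangle F G := by
    refine LaxMonoidalCell.hom_ext ?_
    have h := triangle F.cell G.cell
    simp only [Strict.associator_eqToIso, Strict.leftUnitor_eqToIso, Strict.rightUnitor_eqToIso,
      eqToIso.hom] at h
    have l := congrArg₂ (· ≫ ·)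
      (eqToIso_cell_hom (LaxMonoidalCell.assoc F (LaxMonoidalCell.id _) G))
      (congrArg (F.cell ◁ ·) (eqToIso_cell_hom (LaxMonoidalCell.id_comp G)))
    have r := congrArg (· ▷ G.cell) (eqToIso_cell_hom (LaxMonoidalCell.comp_id F))
    exact l.trans (h.trans r.symm)

instance : Bicategory.Strict (MonoidalObject A) where
  id_comp {M N} (F : LaxMonoidalCell M N) := LaxMonoidalCell.id_comp F
  comp_id {M N} (F : LaxMonoidalCell M N) := LaxMonoidalCell.comp_id F
  assoc {M N P Q} (F : LaxMonoidalCell M N) (G : LaxMonoidalCell N P) (H : LaxMonoidalCell P Q) :=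
    LaxMonoidalCell.assoc F G H
  leftUnitor_eqToIso _ := rfl
  rightUnitor_eqToIso _ := rfl
  associator_eqToIso _ _ _ := rfl

end MonL

/-! ### Monads and Eilenberg-Moore objects in a bicategory -/

section Monads

universe w₁ v₁ u₁

variable {B : Type u₁} [Bicategory.{w₁, v₁} B]

/-- A monad on a 0-cell of a bicategory. -/
structure MonadOn (c : B) where
  t : c ⟶ c
  η : 𝟙 c ⟶ t
  μ : t ≫ t ⟶ t
  left_unit : (λ_ t).inv ≫ η ▷ t ≫ μ = 𝟙 t
  right_unit : (ρ_ t).inv ≫ t ◁ η ≫ μ = 𝟙 t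
  assoc : μ ▷ t ≫ μ = (α_ t t t).hom ≫ t ◁ μ ≫ μ

/-- A 1-cell `u : X ⟶ c` subequalizing a monad `R` on `c`, that is, an `R`-algebra at stage `X`. -/
structure Subeq {c : B} (R : MonadOn c) (X : B) where
  u : X ⟶ c
  ν : u ≫ R.t ⟶ u
  unit : (ρ_ u).inv ≫ u ◁ R.η ≫ ν = 𝟙 u
  assoc : ν ▷ R.t ≫ ν = (α_ u R.t R.t).hom ≫ u ◁ R.μ ≫ ν

namespace Subeq

variable {c : B} {R : MonadOn c}

/-- A morphism of subequalizing 1-cells with the same domain. -/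
@[ext]
structure Hom {X : B} (x y : Subeq R X) where
  cell : x.u ⟶ y.u
  comm : cell ▷ R.t ≫ y.ν = x.ν ≫ cell

instance (X : B) : Category (Subeq R X) where
  Hom x y := Hom x y
  id x := ⟨𝟙 x.u, by rw [id_whiskerRight, Category.id_comp, Category.comp_id]⟩
  comp σ τ := ⟨σ.cell ≫ τ.cell, by
    rw [comp_whiskerRight, Category.assoc, τ.comm, ← Category.assoc, σ.comm, Category.assoc]⟩
  id_comp _ := Hom.ext (Category.id_comp _)
  comp_id _ := Hom.ext (Category.comp_id _)
  assoc _ _ _ := Hom.ext (Category.assoc _ _ _)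

/-- Composition of a subequalizing 1-cell with a 1-cell `Y ⟶ X`. -/
def precomp {X Y : B} (x : Subeq R X) (L : Y ⟶ X) : Subeq R Y where
  u := L ≫ x.u
  ν := (α_ L x.u R.t).hom ≫ L ◁ x.ν
  unit := by
    have h := congrArg (L ◁ ·) x.unit
    simp only [whiskerLeft_comp, whiskerLeft_id] at h
    rw [← h]
    simp
  assoc := by
    have h := congrArg (L ◁ ·) x.assoc
    simp only [whiskerLeft_comp] at h
    simp [h]

end Subeq

/-- The functor `A(X, E) ⟶ Subeq_R(X)` induced by a subequalizing 1-cell `s` with domain `E`. -/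
def emFunctor {c : B} {R : MonadOn c} {E : B} (s : Subeq R E) (X : B) :
    (X ⟶ E) ⥤ Subeq R X where
  obj L := s.precomp L
  map n := Subeq.Hom.mk (n ▷ s.u) (by simp [Subeq.precomp, whisker_exchange])
  map_id _ := Subeq.Hom.ext (id_whiskerRight _ _)
  map_comp _ _ := Subeq.Hom.ext (comp_whiskerRight _ _ _)

/-- The 0-cell `E` with the subequalizing 1-cell `s` is an Eilenberg-Moore object for `R`. -/
def IsEMObject {c : B} (R : MonadOn c) {E : B} (s : Subeq R E) : Prop :=
  ∀ X : B, IsCatIso (emFunctor s X)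

/-- The 1-cell of a monad subequalizes the monad by means of the multiplication. -/
def freeSubeq {c : B} (R : MonadOn c) : Subeq R c where
  u := R.t
  ν := R.μ
  unit := R.right_unit
  assoc := R.assoc

/-- The free 1-cell `F` of an Eilenberg-Moore object: the unique one with `U(F) = R` and
`β_F = μ`. -/
noncomputable def freeCell {c : B} {R : MonadOn c} {E : B} {s : Subeq R E} (hs : IsEMObject R s) :
    c ⟶ E :=
  ((hs c).1.surjective (freeSubeq R)).choose

theorem emFunctor_freeCell {c : B} {R : MonadOn c} {E : B} {s : Subeq R E}
    (hs : IsEMObject R s) : (emFunctor s c).obj (freeCell hs) = freeSubeq R :=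
  ((hs c).1.surjective (freeSubeq R)).choose_spec

theorem freeCell_comp {c : B} {R : MonadOn c} {E : B} {s : Subeq R E}
    (hs : IsEMObject R s) : freeCell hs ≫ s.u = R.t :=
  congrArg Subeq.u (emFunctor_freeCell hs)

end Monads

/-! ### Reflexive coequalizers -/

/-- A functor preserves the coequalizers of reflexive pairs. -/
def PreservesReflexiveCoequalizers {C : Type*} {D : Type*} [Category C] [Category D]
    (F : C ⥤ D) : Prop :=
  ∀ ⦃X Y : C⦄ (f g : X ⟶ Y), IsReflexivePair f g → PreservesColimit (parallelPair f g) F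

section RC

variable {A : Type u} [Bicategory.{w, v} A]

/-- A 0-cell `E` is rc: all the categories `A(X, E)` have reflexive coequalizers, and these are
preserved by precomposition with 1-cells. -/
def IsRC0 (E : A) : Prop :=
  (∀ X : A, HasReflexiveCoequalizers (X ⟶ E)) ∧
    ∀ ⦃X Y : A⦄ (G : Y ⟶ X), PreservesReflexiveCoequalizers (Bicategory.precomp E G)

/-- A 1-cell `F` is rc: postcomposition with `F` preserves reflexive coequalizers. -/
def IsRC1 {C D : A} (F : C ⟶ D) : Prop :=
  ∀ X : A, PreservesReflexiveCoequalizers (Bicategory.postcomp X F)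

end RC

/-! ### The Linton monoidal structure -/

section Linton

variable {A : Type u} [Bicategory.{w, v} A] [Bicategory.Strict A] [FiniteProducts A]

theorem cell_leftUnitor_inv {M N : MonoidalObject A} (F : M ⟶ N) :
    MonoidalTransformation.cell (λ_ F).inv = (λ_ (LaxMonoidalCell.cell F)).inv :=
  (eqToIso_cell_inv (LaxMonoidalCell.id_comp F)).trans
    (congrArg Iso.inv (Strict.leftUnitor_eqToIso (LaxMonoidalCell.cell F))).symm

theorem cell_rightUnitor_inv {M N : MonoidalObject A} (F : M ⟶ N) :
    MonoidalTransformation.cell (ρ_ F).inv = (ρ_ (LaxMonoidalCell.cell F)).inv :=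
  (eqToIso_cell_inv (LaxMonoidalCell.comp_id F)).trans
    (congrArg Iso.inv (Strict.rightUnitor_eqToIso (LaxMonoidalCell.cell F))).symm

theorem cell_associator_hom {M N P Q : MonoidalObject A} (F : M ⟶ N) (G : N ⟶ P) (H : P ⟶ Q) :
    MonoidalTransformation.cell (α_ F G H).hom =
      (α_ (LaxMonoidalCell.cell F) (LaxMonoidalCell.cell G) (LaxMonoidalCell.cell H)).hom :=
  (eqToIso_cell_hom (LaxMonoidalCell.assoc F G H)).trans
    (congrArg Iso.hom (Strict.associator_eqToIso (LaxMonoidalCell.cell F)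
      (LaxMonoidalCell.cell G) (LaxMonoidalCell.cell H))).symm

/-- The monad in `A` underlying a lax monoidal monad, that is, a monad in `Mon_l(A)`. -/
noncomputable def MonadOn.underlying {M : MonoidalObject A} (R : MonadOn M) :
    MonadOn M.carrier where
  t := LaxMonoidalCell.cell R.t
  η := MonoidalTransformation.cell R.η
  μ := MonoidalTransformation.cell R.μ
  left_unit := (congrArg₂ (· ≫ ·) (cell_leftUnitor_inv R.t).symm rfl).trans
    (congrArg MonoidalTransformation.cell R.left_unit)
  right_unit := (congrArg₂ (· ≫ ·) (cell_rightUnitor_inv R.t).symm rfl).trans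
    (congrArg MonoidalTransformation.cell R.right_unit)
  assoc := (congrArg MonoidalTransformation.cell R.assoc).trans
    (congrArg₂ (· ≫ ·) (cell_associator_hom R.t R.t R.t) rfl)

variable {M : MonoidalObject A} (R : MonadOn M)

/-- The coherence 2-cells of a lax monoidal monad. -/
noncomputable abbrev laxOf : LaxData M.str.toMonoidalData M.str.toMonoidalData R.underlying.t :=
  (LaxMonoidalCell.lax R.t).toLaxData

variable {R}

/-- A 1-cell subequalizing the underlying monad, together with a lax monoidal structure for which
its 2-cell is monoidal, subequalizes the monad in `Mon_l(A)`. -/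
noncomputable def Subeq.monoidal {E : A} (s : Subeq R.underlying E) {S : MonoidalStructure E}
    (υ : LaxStructure S.toMonoidalData M.str.toMonoidalData s.u)
    (h : IsMonoidalCell (υ.toLaxData.comp (laxOf R)) υ.toLaxData s.ν) :
    Subeq R (MonoidalObject.mk E S) where
  u := LaxMonoidalCell.mk s.u υ
  ν := MonoidalTransformation.mk s.ν h
  unit := LaxMonoidalCell.hom_ext
    ((congrArg₂ (· ≫ ·) (cell_rightUnitor_inv (M := ⟨E, S⟩) (N := M) ⟨s.u, υ⟩) rfl).trans s.unit)
  assoc := LaxMonoidalCell.hom_ext (s.assoc.trans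
    (congrArg₂ (· ≫ ·) (cell_associator_hom (M := ⟨E, S⟩) (N := M) ⟨s.u, υ⟩ R.t R.t) rfl).symm)

/-- `R(R(A) ⊗ R(B)) ⟶ R(R(A ⊗ B)) ⟶ R(A ⊗ B)` at stage `X`: the first member of the Linton
pair. -/
noncomputable def lintonFst {X : A} (x y : Subeq R.underlying X) :
    tens M.str.tensor (x.u ≫ R.underlying.t) (y.u ≫ R.underlying.t) ≫ R.underlying.t ⟶
      tens M.str.tensor x.u y.u ≫ R.underlying.t :=
  (laxOf R).phiAt x.u y.u ▷ R.underlying.t ≫ (α_ _ R.underlying.t R.underlying.t).hom ≫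
    tens M.str.tensor x.u y.u ◁ R.underlying.μ

/-- `R(a ⊗ b) : R(R(A) ⊗ R(B)) ⟶ R(A ⊗ B)` at stage `X`: the second member of the Linton pair. -/
noncomputable def lintonSnd {X : A} (x y : Subeq R.underlying X) :
    tens M.str.tensor (x.u ≫ R.underlying.t) (y.u ≫ R.underlying.t) ≫ R.underlying.t ⟶
      tens M.str.tensor x.u y.u ≫ R.underlying.t :=
  tensHom M.str.tensor x.ν y.ν ▷ R.underlying.t

variable {E : A} (s : Subeq R.underlying E)

theorem lift_tens_comp_comp {X : A} (G H : X ⟶ E) :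
    lift G H ≫ tens M.str.tensor (p₁ ≫ s.u) (p₂ ≫ s.u) ≫ R.underlying.t =
      tens M.str.tensor (G ≫ s.u) (H ≫ s.u) ≫ R.underlying.t := by
  rw [← assoc₁, lift_tens_comp]

/-- A monoidal structure on `E` with a 2-cell `R(A ⊗ B) ⟶ U(A ⊗ B)` for the projections `A`, `B`
from `E × E`; on the right `⊗` is the tensor of `E`. -/
structure LintonData where
  str : MonoidalStructure E
  q : tens M.str.tensor (p₁ ≫ s.u) (p₂ ≫ s.u) ≫ R.underlying.t ⟶ str.tensor ≫ s.u

namespace LintonData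

variable {s} (L : LintonData s)

/-- The 2-cell `R(G ⊗ H) ⟶ U(G ⊗ H)` at stage `X`. -/
noncomputable def qAt {X : A} (G H : X ⟶ E) :
    tens M.str.tensor (G ≫ s.u) (H ≫ s.u) ≫ R.underlying.t ⟶ tens L.str.tensor G H ≫ s.u :=
  eqToHom (lift_tens_comp_comp s G H).symm ≫ lift G H ◁ L.q ≫
    (α_ (lift G H) L.str.tensor s.u).inv

/-- The 2-cell `U(A) ⊗ U(B) ⟶ R(U(A) ⊗ U(B)) ⟶ U(A ⊗ B)`. -/
noncomputable def uPhi :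
    tens M.str.tensor (p₁ ≫ s.u) (p₂ ≫ s.u) ⟶ L.str.tensor ≫ s.u :=
  (ρ_ _).inv ≫ tens M.str.tensor (p₁ ≫ s.u) (p₂ ≫ s.u) ◁ R.underlying.η ≫ L.q

/-- The unit of `E` lies over `R(I)`. -/
theorem unit_comp (hs : IsEMObject R.underlying s)
    (h : L.str.unit = M.str.unit ≫ freeCell hs) :
    L.str.unit ≫ s.u = M.str.unit ≫ R.underlying.t := by
  rw [h, assoc₁, freeCell_comp]

/-- The 2-cell `η_I : I ⟶ R(I) = U(I)`; on the right `I` is the unit of `E`. -/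
noncomputable def uPhi₀ (h : L.str.unit ≫ s.u = M.str.unit ≫ R.underlying.t) :
    M.str.unit ⟶ L.str.unit ≫ s.u :=
  (ρ_ _).inv ≫ M.str.unit ◁ R.underlying.η ≫ eqToHom h.symm

/-- The coherence 2-cells of the Eilenberg-Moore 1-cell `U`. -/
noncomputable def uLax (h : L.str.unit ≫ s.u = M.str.unit ≫ R.underlying.t) :
    LaxData L.str.toMonoidalData M.str.toMonoidalData s.u where
  phi := L.uPhi
  phi₀ := L.uPhi₀ h

theorem constAt_comp (h : L.str.unit ≫ s.u = M.str.unit ≫ R.underlying.t) (X : A) :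
    constAt X L.str.unit ≫ s.u = constAt X M.str.unit ≫ R.underlying.t := by
  rw [constAt, constAt, assoc₁, assoc₁, h]

/-- The left unit is determined by
`R(R(I) ⊗ A) ⟶ R(R(I) ⊗ R(A)) ⟶ R(R(I ⊗ A)) ⟶ R(R(A)) ⟶ R(A) ⟶ A`. -/
def LeftEq (h : L.str.unit ≫ s.u = M.str.unit ≫ R.underlying.t) : Prop :=
  L.qAt (constAt E L.str.unit) (𝟙 E) ≫ L.str.leftAt (𝟙 E) ▷ s.u =
    eqToHom (by rw [L.constAt_comp h]) ≫
      tensHom M.str.tensor (𝟙 (constAt E M.str.unit ≫ R.underlying.t))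
        ((ρ_ _).inv ≫ (𝟙 E ≫ s.u) ◁ R.underlying.η) ▷ R.underlying.t ≫
      (laxOf R).phiAt (constAt E M.str.unit) (𝟙 E ≫ s.u) ▷ R.underlying.t ≫
      M.str.leftAt (𝟙 E ≫ s.u) ▷ R.underlying.t ▷ R.underlying.t ≫
      (α_ _ R.underlying.t R.underlying.t).hom ≫ (𝟙 E ≫ s.u) ◁ R.underlying.μ ≫
      (s.precomp (𝟙 E)).ν

/-- The right unit is determined by
`R(A ⊗ R(I)) ⟶ R(R(A) ⊗ R(I)) ⟶ R(R(A ⊗ I)) ⟶ R(R(A)) ⟶ R(A) ⟶ A`. -/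
def RightEq (h : L.str.unit ≫ s.u = M.str.unit ≫ R.underlying.t) : Prop :=
  L.qAt (𝟙 E) (constAt E L.str.unit) ≫ L.str.rightAt (𝟙 E) ▷ s.u =
    eqToHom (by rw [L.constAt_comp h]) ≫
      tensHom M.str.tensor ((ρ_ _).inv ≫ (𝟙 E ≫ s.u) ◁ R.underlying.η)
        (𝟙 (constAt E M.str.unit ≫ R.underlying.t)) ▷ R.underlying.t ≫
      (laxOf R).phiAt (𝟙 E ≫ s.u) (constAt E M.str.unit) ▷ R.underlying.t ≫
      M.str.rightAt (𝟙 E ≫ s.u) ▷ R.underlying.t ▷ R.underlying.t ≫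
      (α_ _ R.underlying.t R.underlying.t).hom ≫ (𝟙 E ≫ s.u) ◁ R.underlying.μ ≫
      (s.precomp (𝟙 E)).ν

/-- The associativity is determined by the associativity of `C`, through
`R(A ⊗ (B ⊗ C)) ⟶ R(A ⊗ U(B ⊗ C)) ⟶ U(A ⊗ (B ⊗ C))` and
`R((A ⊗ B) ⊗ C) ⟶ R(U(A ⊗ B) ⊗ C) ⟶ U((A ⊗ B) ⊗ C)`, at stage `X`. -/
def AssocEqAt (h : L.str.unit ≫ s.u = M.str.unit ≫ R.underlying.t) {X : A}
    (F G H : X ⟶ E) : Prop :=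
  tensHom M.str.tensor (𝟙 (F ≫ s.u)) ((L.uLax h).phiAt G H) ▷ R.underlying.t ≫
      L.qAt F (tens L.str.tensor G H) ≫ L.str.assocAt F G H ▷ s.u =
    M.str.assocAt (F ≫ s.u) (G ≫ s.u) (H ≫ s.u) ▷ R.underlying.t ≫
      tensHom M.str.tensor ((L.uLax h).phiAt F G) (𝟙 (H ≫ s.u)) ▷ R.underlying.t ≫
      L.qAt (tens L.str.tensor F G) H

end LintonData

/-- The Linton monoidal structure on an Eilenberg-Moore object `E` of the underlying monad of a lax
monoidal monad `R`: the 2-cell `q` is a coequalizer of the Linton pair and a morphism of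
`R`-algebras from the free algebra, the unit is the free algebra on `I`, and the coherence 2-cells
are the ones induced by those of `C`. -/
structure LintonStructure (hs : IsEMObject R.underlying s) extends LintonData s where
  condition : lintonFst (s.precomp p₁) (s.precomp p₂) ≫ q =
    lintonSnd (s.precomp p₁) (s.precomp p₂) ≫ q
  isColimit : Nonempty (IsColimit (Cofork.ofπ q condition))
  algebra : q ▷ R.underlying.t ≫ (s.precomp str.tensor).ν =
    (α_ _ R.underlying.t R.underlying.t).hom ≫
      tens M.str.tensor (p₁ ≫ s.u) (p₂ ≫ s.u) ◁ R.underlying.μ ≫ q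
  unit : str.unit = M.str.unit ≫ freeCell hs
  left : toLintonData.LeftEq (toLintonData.unit_comp hs unit)
  right : toLintonData.RightEq (toLintonData.unit_comp hs unit)
  assoc : toLintonData.AssocEqAt (toLintonData.unit_comp hs unit) (X := pr E (pr E E))
    p₁ (p₂ ≫ p₁) (p₂ ≫ p₂)

end Linton

end MonLax

open MonLax

/-! A 1-cell into `C` is an object of `C` at a stage `X`, so most of the argument takes place in the
ordinary category `V = A(X, C)`, with its tensor functor, its monad `T` and the comparison `φ : TA ⊗
TB ⟶ T(A ⊗ B)` (`TensorMonad`, `stage`). The rc hypotheses on `⊗` and `R` make `T`, `a ⊗ -` and `- ⊗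
a` preserve reflexive coequalizers (`stage_rc`). That on `C` carries a coequalizer at the universal
stage to every other stage (`IsLintonAt.uAt`).

A map `P ⊗ Q ⟶ K` into an algebra is bilinear exactly when its extension to `T(P ⊗ Q)` coequalizes
the Linton pair. As `T` preserves the coequalizer, the latter is an algebra representing bilinear
maps (`exists_alg`, `IsLinton.desc`), just as the tensor product of modules does. Trilinear maps `F
⊗ (G ⊗ H) ⟶ K` descend through two successive tensor products (`Trilin.desc`), and linear maps `P ⊗
Z ⟶ K` extend to `P ⊗ TZ` (`Lin.bilin`). Hence the associativity and unit cells of `C` induce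
isomorphisms of algebras, which the Eilenberg-Moore property turns into invertible 2-cells between
1-cells into `E`.

Equations are checked on generators. A map `w : Z ⟶ W` generates the algebra `W` if its extension
`TZ ⟶ W` remains epi under every functor preserving reflexive coequalizers (`Gen`). This notion
passes to Linton tensor products (`IsLinton.gen_left`), so the pentagon and triangle of `E` reduce
to those of `C`. The equations that specify a Linton structure are equivalent to the lax monoidal
axioms for `U`: their sides are extensions to free algebras of the sides of those axioms, or the
explicit bilinear extensions of `λ` and `ρ` (`assocEqAt_iff`, `leftEq_iff`, `rightEq_iff`).

If the action on `U(K)` is monoidal, then the coherence cells of `U(K)` are bilinear, so they factor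
uniquely through those of `U`; this lifts lax structures and monoidal 2-cells to `K`, and `E` is an
Eilenberg-Moore object in `Mon_l(A)` (`IsLintonLax.isEMObject`). The adjunction is then the general
one for Eilenberg-Moore objects, taken in `Mon_l(A)`. The left adjoint is strong because `F(A) ⊗
F(B)` and `F(A ⊗ B)` are both free on `A ⊗ B` (`IsLinton.isFree`). -/

namespace MonLax

/-! ### Algebras of a monad on a category with a tensor -/

/-! ### Coequalizers as a predicate on three morphisms, and their preservation. -/

section Coequalizers

variable {V : Type*} [Category V] {W : Type*} [Category W]

/-- `q` is a coequalizer of `f` and `g`. -/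
def IsCoeq {X Y Z : V} (f g : X ⟶ Y) (q : Y ⟶ Z) : Prop :=
  ∃ h : f ≫ q = g ≫ q, Nonempty (IsColimit (Cofork.ofπ q h))

theorem IsCoeq.desc {X Y Z K : V} {f g : X ⟶ Y} {q : Y ⟶ Z} (h : IsCoeq f g q) (k : Y ⟶ K)
    (hk : f ≫ k = g ≫ k) : ∃ d : Z ⟶ K, q ≫ d = k := by
  obtain ⟨_, ⟨hq⟩⟩ := h
  exact ⟨hq.desc (Cofork.ofπ k hk), Cofork.IsColimit.π_desc hq⟩

theorem IsCoeq.epi {X Y Z : V} {f g : X ⟶ Y} {q : Y ⟶ Z} (h : IsCoeq f g q) : Epi q := by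
  obtain ⟨_, ⟨hq⟩⟩ := h
  exact ⟨fun _ _ e => Cofork.IsColimit.hom_ext hq e⟩

theorem IsCoeq.map {X Y Z : V} {f g : X ⟶ Y} {q : Y ⟶ Z} (h : IsCoeq f g q)
    (hr : IsReflexivePair f g) {F : V ⥤ W} (hF : PreservesReflexiveCoequalizers F) :
    IsCoeq (F.map f) (F.map g) (F.map q) := by
  obtain ⟨e, ⟨hq⟩⟩ := h
  have := hF f g hr
  exact ⟨by rw [← F.map_comp, ← F.map_comp, e], ⟨isColimitCoforkMapOfIsColimit F e hq⟩⟩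

theorem isReflexivePair_map {X Y : V} {f g : X ⟶ Y} (hr : IsReflexivePair f g) (F : V ⥤ W) :
    IsReflexivePair (F.map f) (F.map g) := by
  obtain ⟨s, h₁, h₂⟩ := hr
  exact ⟨F.map s, by rw [← F.map_comp, h₁, F.map_id], by rw [← F.map_comp, h₂, F.map_id]⟩

theorem PreservesReflexiveCoequalizers.comp {U : Type*} [Category U] {F : V ⥤ W} {G : W ⥤ U}
    (hF : PreservesReflexiveCoequalizers F) (hG : PreservesReflexiveCoequalizers G) :
    PreservesReflexiveCoequalizers (F ⋙ G) := by
  intro X Y f g h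
  have := hF f g h
  have := hG _ _ (isReflexivePair_map h F)
  -- The image of the parallel pair is only isomorphic, as a diagram, to the parallel pair of the
  -- images.
  have : PreservesColimit (parallelPair f g ⋙ F) G :=
    have : PreservesColimit (parallelPair ((parallelPair f g ⋙ F).map WalkingParallelPairHom.left)
      ((parallelPair f g ⋙ F).map WalkingParallelPairHom.right)) G := this
    preservesColimit_of_iso_diagram G (diagramIsoParallelPair (parallelPair f g ⋙ F)).symm
  exact comp_preservesColimit F G

end Coequalizers

/-- A monad on a category. -/
structure Mnd (V : Type*) [Category V] extends V ⥤ V where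
  η : ∀ a : V, a ⟶ obj a
  μ : ∀ a : V, obj (obj a) ⟶ obj a
  η_nat : ∀ {a b : V} (f : a ⟶ b), f ≫ η b = η a ≫ map f
  μ_nat : ∀ {a b : V} (f : a ⟶ b), map (map f) ≫ μ b = μ a ≫ map f
  left_unit : ∀ a, η (obj a) ≫ μ a = 𝟙 (obj a)
  right_unit : ∀ a, map (η a) ≫ μ a = 𝟙 (obj a)
  assoc : ∀ a, map (μ a) ≫ μ a = μ (obj a) ≫ μ a

namespace Mnd

variable {V : Type*} [Category V] (T : Mnd V)

/-- An algebra of a monad. -/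
structure Alg where
  A : V
  a : T.obj A ⟶ A
  unit : T.η A ≫ a = 𝟙 A
  assoc : T.μ A ≫ a = T.map a ≫ a

variable {T} in
/-- A morphism of algebras. -/
@[ext]
structure Alg.Hom (P Q : T.Alg) where
  f : P.A ⟶ Q.A
  h : T.map f ≫ Q.a = P.a ≫ f

instance : Category T.Alg where
  Hom P Q := Alg.Hom P Q
  id P := ⟨𝟙 P.A, by rw [T.map_id, Category.id_comp, Category.comp_id]⟩
  comp f g := ⟨f.f ≫ g.f, by rw [T.map_comp, Category.assoc, g.h, reassoc_of% f.h]⟩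
  id_comp _ := Alg.Hom.ext (Category.id_comp _)
  comp_id _ := Alg.Hom.ext (Category.comp_id _)
  assoc _ _ _ := Alg.Hom.ext (Category.assoc _ _ _)

/-- The free algebra. -/
abbrev free (Z : V) : T.Alg := ⟨T.obj Z, T.μ Z, T.left_unit Z, (T.assoc Z).symm⟩

end Mnd

/-- A functor of two variables together with a monad that is lax compatible with it. -/
structure TensorMonad (V : Type*) [Category V] where
  tens : V → V → V
  hom : ∀ {a a' b b' : V}, (a ⟶ a') → (b ⟶ b') → (tens a b ⟶ tens a' b')
  hom_id : ∀ a b : V, hom (𝟙 a) (𝟙 b) = 𝟙 (tens a b)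
  hom_comp : ∀ {a a' a'' b b' b'' : V} (f : a ⟶ a') (f' : a' ⟶ a'') (g : b ⟶ b') (g' : b' ⟶ b''),
    hom (f ≫ f') (g ≫ g') = hom f g ≫ hom f' g'
  T : Mnd V
  φ : ∀ a b : V, tens (T.obj a) (T.obj b) ⟶ T.obj (tens a b)
  φ_nat : ∀ {a a' b b' : V} (f : a ⟶ a') (g : b ⟶ b'),
    hom (T.map f) (T.map g) ≫ φ a' b' = φ a b ≫ T.map (hom f g)
  η_φ : ∀ a b : V, hom (T.η a) (T.η b) ≫ φ a b = T.η (tens a b)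
  μ_φ : ∀ a b : V, hom (T.μ a) (T.μ b) ≫ φ a b =
    φ (T.obj a) (T.obj b) ≫ T.map (φ a b) ≫ T.μ (tens a b)

/-! ### Multilinear maps and Linton tensor products of algebras in one category. -/

namespace TensorMonad

variable {V : Type*} [Category V] (D : TensorMonad V)

/-- The two variables exchanged. -/
def swap : TensorMonad V where
  tens a b := D.tens b a
  hom f g := D.hom g f
  hom_id a b := D.hom_id b a
  hom_comp f f' g g' := D.hom_comp g g' f f'
  T := D.T
  φ a b := D.φ b a
  φ_nat f g := D.φ_nat g f
  η_φ a b := D.η_φ b a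
  μ_φ a b := D.μ_φ b a

/-- The functor `a ⊗ -`. -/
def tensLeft (a : V) : V ⥤ V where
  obj b := D.tens a b
  map f := D.hom (𝟙 a) f
  map_id b := D.hom_id a b
  map_comp f g := by rw [← D.hom_comp, Category.comp_id]

/-- The tensor preserves reflexive coequalizers in each variable, and so does the monad. -/
structure Rc : Prop where
  left : ∀ a, PreservesReflexiveCoequalizers (D.tensLeft a)
  right : ∀ a, PreservesReflexiveCoequalizers (D.swap.tensLeft a)
  monad : PreservesReflexiveCoequalizers D.T.toFunctor

variable {D}

theorem Rc.swap (h : D.Rc) : D.swap.Rc := ⟨h.right, h.left, h.monad⟩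

variable (D)

theorem hom_comp_hom {a a' a'' b b' b'' : V} (f : a ⟶ a') (f' : a' ⟶ a'') (g : b ⟶ b')
    (g' : b' ⟶ b'') : D.hom f g ≫ D.hom f' g' = D.hom (f ≫ f') (g ≫ g') :=
  (D.hom_comp f f' g g').symm

theorem hom_comp_hom_assoc {a a' a'' b b' b'' c : V} (f : a ⟶ a') (f' : a' ⟶ a'') (g : b ⟶ b')
    (g' : b' ⟶ b'') (k : D.tens a'' b'' ⟶ c) :
    D.hom f g ≫ D.hom f' g' ≫ k = D.hom (f ≫ f') (g ≫ g') ≫ k := by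
  rw [← Category.assoc, hom_comp_hom]

/-- The first member of the Linton pair. -/
def lfst (P Q : D.T.Alg) :
    D.T.obj (D.tens (D.T.obj P.A) (D.T.obj Q.A)) ⟶ D.T.obj (D.tens P.A Q.A) :=
  D.T.map (D.φ P.A Q.A) ≫ D.T.μ _

/-- The second member of the Linton pair. -/
def lsnd (P Q : D.T.Alg) :
    D.T.obj (D.tens (D.T.obj P.A) (D.T.obj Q.A)) ⟶ D.T.obj (D.tens P.A Q.A) :=
  D.T.map (D.hom P.a Q.a)

/-- The common section is `T(η ⊗ η)`: it splits the first map because `η` is compatible with `φ`,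
and the second by the unit laws of the two algebras. -/
theorem isReflexivePair (P Q : D.T.Alg) : IsReflexivePair (D.lfst P Q) (D.lsnd P Q) := by
  refine ⟨D.T.map (D.hom (D.T.η _) (D.T.η _)), ?_, ?_⟩
  · rw [lfst, ← Category.assoc, ← D.T.map_comp, D.η_φ, D.T.right_unit]
  · rw [lsnd, ← D.T.map_comp, D.hom_comp_hom, P.unit, Q.unit, D.hom_id, D.T.map_id]

/-- Morphisms `P ⊗ Q ⟶ K` that are compatible with the actions of the monad. -/
def Bilin (P Q K : D.T.Alg) (f : D.tens P.A Q.A ⟶ K.A) : Prop :=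
  D.φ P.A Q.A ≫ D.T.map f ≫ K.a = D.hom P.a Q.a ≫ f

/-- The morphism of algebras from a free algebra, as a morphism in the base. -/
abbrev extend {T : Mnd V} {Z : V} (W : T.Alg) (w : Z ⟶ W.A) : T.obj Z ⟶ W.A :=
  T.map w ≫ W.a

theorem η_extend {T : Mnd V} {Z : V} (W : T.Alg) (w : Z ⟶ W.A) :
    T.η Z ≫ extend W w = w := by
  rw [extend, ← reassoc_of% T.η_nat, W.unit, Category.comp_id]

theorem extend_comp {T : Mnd V} {Z : V} {W K : T.Alg} (w : Z ⟶ W.A) (g : W ⟶ K) :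
    extend W w ≫ g.f = extend K (w ≫ g.f) := by
  rw [extend, extend, Category.assoc, ← g.h, T.map_comp, Category.assoc]

theorem map_extend {T : Mnd V} {Z : V} (W : T.Alg) (w : Z ⟶ W.A) :
    T.map (extend W w) ≫ W.a = T.μ Z ≫ extend W w := by
  rw [extend, T.map_comp, Category.assoc, ← W.assoc, ← reassoc_of% T.μ_nat]

/-- `u : P ⊗ Q ⟶ W` exhibits the algebra `W` as the Linton tensor product of `P` and `Q`. -/
def IsLinton (P Q W : D.T.Alg) (u : D.tens P.A Q.A ⟶ W.A) : Prop :=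
  D.Bilin P Q W u ∧ IsCoeq (D.lfst P Q) (D.lsnd P Q) (extend W u)

variable {D} {P Q W K F G H W' : D.T.Alg}

/-- Both composites are the morphisms of algebras out of the free algebra on `TP ⊗ TQ` that extend
the two sides of `Bilin`. -/
theorem Bilin.coequalizes {f : D.tens P.A Q.A ⟶ K.A} (h : D.Bilin P Q K f) :
    D.lfst P Q ≫ extend K f = D.lsnd P Q ≫ extend K f := by
  rw [lfst, lsnd, extend, Category.assoc, ← reassoc_of% D.T.μ_nat, K.assoc, ← D.T.map_comp_assoc,
    ← D.T.map_comp_assoc, ← D.T.map_comp_assoc, Category.assoc, h]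

/-- Converse of `Bilin.coequalizes`, obtained by restricting along `η`. -/
theorem IsCoeq.bilin {u : D.tens P.A Q.A ⟶ W.A}
    (h : D.lfst P Q ≫ extend W u = D.lsnd P Q ≫ extend W u) : D.Bilin P Q W u := by
  have h' := congrArg (D.T.η _ ≫ ·) h
  simp only [lfst, lsnd, Category.assoc] at h'
  rw [← reassoc_of% D.T.η_nat, ← reassoc_of% D.T.η_nat, η_extend] at h'
  rw [Bilin, ← h', reassoc_of% D.T.left_unit]

theorem Bilin.comp {f : D.tens P.A Q.A ⟶ W.A} (h : D.Bilin P Q W f) (g : W ⟶ K) :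
    D.Bilin P Q K (f ≫ g.f) := by
  rw [Bilin, D.T.map_comp, Category.assoc, g.h, reassoc_of% h]

theorem Bilin.precomp {f : D.tens P.A Q.A ⟶ K.A} (h : D.Bilin P Q K f) {P' Q' : D.T.Alg}
    (g : P' ⟶ P) (k : Q' ⟶ Q) : D.Bilin P' Q' K (D.hom g.f k.f ≫ f) := by
  rw [Bilin, D.T.map_comp, Category.assoc, ← reassoc_of% D.φ_nat, h, D.hom_comp_hom_assoc,
    D.hom_comp_hom_assoc, g.h, k.h]

/-- Since `extend W w` and its composite with `g` are morphisms of algebras, the two sides agree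
after `T(extend W w)`, which can be cancelled. -/
theorem hom_of_epi {Z : V} {w : Z ⟶ W.A} (he : Epi (D.T.map (extend W w))) {g : W.A ⟶ K.A}
    {f : Z ⟶ K.A} (h : extend W w ≫ g = extend K f) : D.T.map g ≫ K.a = W.a ≫ g := by
  rw [← cancel_epi (D.T.map (extend W w)), ← D.T.map_comp_assoc, h, map_extend,
    ← Category.assoc (D.T.map _) W.a, map_extend, Category.assoc, h]

/-- The coequalizer lives in the base category, so it only provides a map there; this map respects
the actions because `T` keeps the coequalizer epi. -/
theorem IsLinton.desc (hD : D.Rc) {u : D.tens P.A Q.A ⟶ W.A} (hu : D.IsLinton P Q W u)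
    {f : D.tens P.A Q.A ⟶ K.A} (hf : D.Bilin P Q K f) : ∃ g : W ⟶ K, u ≫ g.f = f := by
  obtain ⟨g, hg⟩ := hu.2.desc _ hf.coequalizes
  refine ⟨⟨g, hom_of_epi (hu.2.map (D.isReflexivePair P Q) hD.monad).epi hg⟩, ?_⟩
  refine (congrArg (· ≫ g) (η_extend W u).symm).trans ?_
  rw [Category.assoc, hg, η_extend]

/-- `w : Z ⟶ W` generates the algebra `W`, in a sense that is stable under all the functors that
preserve reflexive coequalizers. -/
def Gen {T : Mnd V} {Z : V} (W : T.Alg) (w : Z ⟶ W.A) : Prop :=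
  ∀ Θ : V ⥤ V, PreservesReflexiveCoequalizers Θ → Epi (Θ.map (extend W w))

theorem Gen.epi {T : Mnd V} {Z : V} {W : T.Alg} {w : Z ⟶ W.A} (h : Gen W w) :
    Epi (extend W w) := by
  refine h (𝟭 V) fun _ _ _ _ _ => inferInstance

/-- The principle behind the coherence equations below: a morphism of algebras is determined on
generators. -/
theorem Gen.hom_ext {T : Mnd V} {Z : V} {W K : T.Alg} {w : Z ⟶ W.A} (h : Gen W w)
    {g g' : W ⟶ K} (e : w ≫ g.f = w ≫ g'.f) : g = g' := by
  have := h.epi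
  refine Mnd.Alg.Hom.ext ?_
  rw [← cancel_epi (extend W w), extend_comp, extend_comp, e]

/-- The extension of the identity is the structure map, which `η` splits, and split epis survive
every functor. -/
theorem Gen.id {T : Mnd V} (W : T.Alg) : Gen W (𝟙 W.A) := by
  intro Θ _
  rw [extend, T.map_id, Category.id_comp]
  have : IsSplitEpi W.a := ⟨⟨⟨T.η _, W.unit⟩⟩⟩
  infer_instance

/-- Bilinearity and the naturality of `φ` move the extensions out of the two variables and past the
tensor. -/
theorem Bilin.hom_extend {f : D.tens P.A Q.A ⟶ K.A} (hf : D.Bilin P Q K f) {Y Z : V}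
    (w : Y ⟶ P.A) (w' : Z ⟶ Q.A) :
    D.hom (extend P w) (extend Q w') ≫ f = D.φ Y Z ≫ extend K (D.hom w w' ≫ f) := by
  rw [extend, extend, D.hom_comp, Category.assoc, ← hf, reassoc_of% D.φ_nat, extend, D.T.map_comp,
    Category.assoc]

/-- The map `T(P ⊗ TZ) ⟶ T(P ⊗ Q) ⟶ W` is a composite of two maps that `Θ` keeps epi, and it factors
through the extension of the proposed generators, so this extension is kept epi as well. The
quantifier over functors in `Gen` is what makes the induction possible: the hypothesis on `w` is
used for `P ⊗ -` followed by `T` and `Θ`. -/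
theorem IsLinton.gen_left (hD : D.Rc) {u : D.tens P.A Q.A ⟶ W.A} (hu : D.IsLinton P Q W u) {Z : V}
    {w : Z ⟶ Q.A} (hw : Gen Q w) : Gen W (D.hom (𝟙 P.A) w ≫ u) := by
  intro Θ hΘ
  have h₁ : Epi (Θ.map (D.T.map (D.hom (𝟙 P.A) (extend Q w)))) :=
    hw (D.tensLeft P.A ⋙ D.T.toFunctor ⋙ Θ) ((hD.left _).comp (hD.monad.comp hΘ))
  have h₂ : Epi (Θ.map (extend W u)) := (hu.2.map (D.isReflexivePair P Q) hΘ).epi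
  have key : D.T.map (D.hom (𝟙 P.A) (extend Q w)) ≫ extend W u =
      (D.T.map (D.hom (D.T.η _) (𝟙 _) ≫ D.φ P.A Z) ≫ D.T.μ _) ≫
        extend W (D.hom (𝟙 P.A) w ≫ u) := by
    -- Writing the identity of `P` as `η` followed by the action puts both variables in the form
    -- required by `Bilin.hom_extend`.
    have h : D.hom (𝟙 P.A) (extend Q w) ≫ u =
        (D.hom (D.T.η _) (𝟙 _) ≫ D.φ P.A Z) ≫ extend W (D.hom (𝟙 P.A) w ≫ u) := by
      rw [Category.assoc, ← hu.1.hom_extend, D.hom_comp_hom_assoc, η_extend, Category.id_comp]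
    rw [extend, ← D.T.map_comp_assoc, h, D.T.map_comp, Category.assoc, map_extend, Category.assoc]
  have h₃ : Epi (Θ.map (D.T.map (D.hom (𝟙 P.A) (extend Q w)) ≫ extend W u)) := by
    rw [Θ.map_comp]; exact epi_comp _ _
  rw [key, Θ.map_comp] at h₃
  exact epi_of_epi (Θ.map (D.T.map (D.hom (D.T.η _) (𝟙 _) ≫ D.φ P.A Z) ≫ D.T.μ _)) _

/-- True by unfolding: exchanging the variables of the tensor exchanges the factors of the Linton
pair. Statements about one variable thus yield their mirror images by passing to `D.swap`. -/
theorem IsLinton.swap {u : D.tens P.A Q.A ⟶ W.A} (hu : D.IsLinton P Q W u) :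
    D.swap.IsLinton Q P W u := hu

theorem IsLinton.gen_right (hD : D.Rc) {u : D.tens P.A Q.A ⟶ W.A} (hu : D.IsLinton P Q W u) {Z : V}
    {w : Z ⟶ P.A} (hw : Gen P w) : Gen W (D.hom w (𝟙 Q.A) ≫ u) :=
  IsLinton.gen_left (D := D.swap) hD.swap hu.swap hw

theorem IsLinton.gen (hD : D.Rc) {u : D.tens P.A Q.A ⟶ W.A} (hu : D.IsLinton P Q W u) :
    Gen W u := by
  have := hu.gen_left hD (Gen.id Q)
  rwa [D.hom_id, Category.id_comp] at this

/-- `w : Z ⟶ W` exhibits `W` as the free algebra on `Z`. -/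
def IsFree {T : Mnd V} {Z : V} (W : T.Alg) (w : Z ⟶ W.A) : Prop := IsIso (extend W w)

theorem isFree_free (T : Mnd V) (Z : V) : IsFree (T.free Z) (T.η Z) := by
  have : extend (T.free Z) (T.η Z) = 𝟙 _ := T.right_unit Z
  change IsIso (extend _ _)
  rw [this]
  infer_instance

theorem IsFree.gen {T : Mnd V} {Z : V} {W : T.Alg} {w : Z ⟶ W.A} (h : IsFree W w) :
    Gen W w := by
  intro Θ _
  have : IsIso (extend W w) := h
  infer_instance

/-- Morphisms from a free algebra. -/
theorem IsFree.desc {T : Mnd V} {Z : V} {W K : T.Alg} {w : Z ⟶ W.A} (h : IsFree W w)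
    (f : Z ⟶ K.A) : ∃ g : W ⟶ K, w ≫ g.f = f := by
  have : IsIso (extend W w) := h
  have hg : extend W w ≫ inv (extend W w) ≫ extend K f = extend K f := by
    rw [IsIso.hom_inv_id_assoc]
  -- The inverse identifies `W` with the free algebra on `Z`, and `extend K f` is the required
  -- morphism there.
  refine ⟨⟨inv (extend W w) ≫ extend K f, ?_⟩, ?_⟩
  · rw [← cancel_epi (T.map (extend W w)), ← T.map_comp_assoc, hg, map_extend,
      ← Category.assoc (T.map _) W.a, map_extend, Category.assoc, hg]
  · change w ≫ inv (extend W w) ≫ extend K f = f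
    refine (congrArg (· ≫ _) (η_extend W w).symm).trans ?_
    rw [Category.assoc, hg, η_extend]

theorem IsFree.comp_extend {T : Mnd V} {Z : V} {W : T.Alg} {w : Z ⟶ W.A} (h : IsFree W w)
    {k : W ⟶ T.free Z} (hk : w ≫ k.f = T.η Z) : k.f ≫ extend W w = 𝟙 W.A := by
  let e : T.free Z ⟶ W := ⟨extend W w, map_extend _ _⟩
  refine congrArg Mnd.Alg.Hom.f (h.gen.hom_ext (g := k ≫ e) (g' := 𝟙 W) ?_)
  change w ≫ k.f ≫ extend W w = w ≫ 𝟙 _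
  rw [reassoc_of% hk, η_extend, Category.comp_id]

/-- Uniqueness of free algebras: the inverse is the morphism that sends the generators `w'` back to
`w`. -/
theorem IsFree.isIso {T : Mnd V} {Z : V} {W W' : T.Alg} {w : Z ⟶ W.A} (h : IsFree W w)
    {w' : Z ⟶ W'.A} (h' : IsFree W' w') {g : W ⟶ W'} (hg : w ≫ g.f = w') : IsIso g := by
  obtain ⟨k, hk⟩ := h'.desc w
  refine ⟨k, h.gen.hom_ext ?_, h'.gen.hom_ext ?_⟩
  · change w ≫ g.f ≫ k.f = w ≫ 𝟙 _
    rw [reassoc_of% hg, hk, Category.comp_id]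
  · change w' ≫ k.f ≫ g.f = w' ≫ 𝟙 _
    rw [reassoc_of% hk, hg, Category.comp_id]

/-- Compatibility of `P ⊗ Z ⟶ K` with the actions on `P` and `K`. -/
def Lin (P : D.T.Alg) (Z : V) (K : D.T.Alg) (f : D.tens P.A Z ⟶ K.A) : Prop :=
  D.hom (𝟙 (D.T.obj P.A)) (D.T.η Z) ≫ D.φ P.A Z ≫ extend K f = D.hom P.a (𝟙 Z) ≫ f

/-- On `TP ⊗ TZ`, the map `φ` followed by the extension of `f` depends on the first variable only
through the action: replacing it by its image under `a` followed by `η` changes nothing. This is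
what makes the formula in `Lin.bilin` linear in `P`. -/
theorem Lin.extend_eq {Z : V} {f : D.tens P.A Z ⟶ K.A} (hf : D.Lin P Z K f) :
    D.hom (P.a ≫ D.T.η _) (𝟙 _) ≫ D.φ P.A Z ≫ extend K f = D.φ P.A Z ≫ extend K f := by
  calc _ = D.hom (D.T.η _) (𝟙 _) ≫ D.φ _ _ ≫ D.T.map (D.hom P.a (𝟙 Z) ≫ f) ≫ K.a := by
        rw [D.T.map_comp, Category.assoc, ← reassoc_of% D.φ_nat, D.T.map_id, D.hom_comp_hom_assoc,
          Category.id_comp, D.T.η_nat]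
    -- Linearity of `f` is used under `T`, which produces a second `φ`.
    _ = D.hom (D.T.η _) (𝟙 _) ≫ D.hom (𝟙 _) (D.T.map (D.T.η Z)) ≫ D.φ _ _ ≫
          D.T.map (D.φ P.A Z) ≫ D.T.μ _ ≫ extend K f := by
        rw [← hf, ← D.T.map_id (D.T.obj P.A), reassoc_of% D.φ_nat, ← map_extend]
        simp only [D.T.map_comp, Category.assoc]
    -- Compatibility of `μ` with `φ` merges the two occurrences of `φ`, and each variable then meets
    -- a unit law of the monad.
    _ = _ := by
        rw [← reassoc_of% D.μ_φ, D.hom_comp_hom_assoc, D.hom_comp_hom_assoc, Category.comp_id,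
          Category.id_comp, D.T.left_unit, D.T.right_unit, D.hom_id, Category.id_comp]

/-- A map linear in `P` extends along `η` to a bilinear map on `P ⊗ TZ`. The explicit formula is
kept because the equations specifying `λ` and `ρ` of a Linton structure have this shape. -/
theorem Lin.bilin {Z : V} {f : D.tens P.A Z ⟶ K.A} (hf : D.Lin P Z K f) :
    ∃ g : D.tens P.A (D.T.obj Z) ⟶ K.A, D.Bilin P (D.T.free Z) K g ∧
      D.hom (𝟙 P.A) (D.T.η Z) ≫ g = f ∧
      g = D.hom (D.T.η P.A) (𝟙 _) ≫ D.φ P.A Z ≫ extend K f := by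
  refine ⟨_, ?_, ?_, rfl⟩
  · change D.φ P.A (D.T.obj Z) ≫ _ = D.hom P.a (D.T.μ Z) ≫ _
    rw [D.hom_comp_hom_assoc, Category.comp_id, D.T.map_comp, D.T.map_comp, Category.assoc,
      Category.assoc, ← reassoc_of% D.φ_nat, map_extend, ← reassoc_of% D.μ_φ, D.hom_comp_hom_assoc,
      D.T.right_unit, D.T.map_id, Category.id_comp]
    -- Linearity in the second variable has been absorbed by `μ`; what remains is linearity in `P`.
    conv_lhs => rw [← hf.extend_eq]
    rw [D.hom_comp_hom_assoc, Category.id_comp, Category.comp_id]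
  · rw [D.hom_comp_hom_assoc, Category.id_comp, Category.comp_id, reassoc_of% D.η_φ, η_extend]

theorem Lin.ext {Z : V} {w : Z ⟶ W.A} (hw : IsFree W w) {f : D.tens P.A Z ⟶ K.A}
    (hf : D.Lin P Z K f) :
    ∃ g : D.tens P.A W.A ⟶ K.A, D.Bilin P W K g ∧ D.hom (𝟙 P.A) w ≫ g = f := by
  obtain ⟨g, hg, hg', -⟩ := hf.bilin
  obtain ⟨k, hk⟩ := hw.desc (K := D.T.free Z) (D.T.η Z)
  refine ⟨_, hg.precomp (𝟙 P) k, ?_⟩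
  rw [D.hom_comp_hom_assoc, hk, ← hg']
  change D.hom (𝟙 P.A ≫ 𝟙 P.A) _ ≫ _ = _
  rw [Category.comp_id]

/-- A bilinear map on `P ⊗ TZ` is recovered from its restriction along `η`: apply `Bilin.hom_extend`
to the identity of `P` and to `η`, whose extensions are the action of `P` and the identity of `TZ`.
-/
theorem Bilin.ext_free {Z : V} {g g' : D.tens P.A (D.T.obj Z) ⟶ K.A}
    (hg : D.Bilin P (D.T.free Z) K g) (hg' : D.Bilin P (D.T.free Z) K g')
    (h : D.hom (𝟙 P.A) (D.T.η Z) ≫ g = D.hom (𝟙 P.A) (D.T.η Z) ≫ g') : g = g' := by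
  have key : ∀ {k : D.tens P.A (D.T.obj Z) ⟶ K.A}, D.Bilin P (D.T.free Z) K k →
      k = D.hom (D.T.η _) (𝟙 _) ≫ D.φ _ _ ≫
        extend K (D.hom (𝟙 P.A) (D.T.η Z) ≫ k) := by
    intro k hk
    have := hk.hom_extend (𝟙 P.A) (D.T.η Z)
    rw [← this]
    have h₁ : extend (D.T.free Z) (D.T.η Z) = 𝟙 _ := D.T.right_unit Z
    erw [h₁]
    rw [D.hom_comp_hom_assoc, η_extend]
    erw [Category.comp_id, D.hom_id, Category.id_comp]
  rw [key hg, key hg', h]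

/-- Compatibility of `F ⊗ (G ⊗ H) ⟶ K` with the actions. -/
def Trilin (F G H K : D.T.Alg) (f : D.tens F.A (D.tens G.A H.A) ⟶ K.A) : Prop :=
  D.hom (𝟙 _) (D.φ G.A H.A) ≫ D.φ F.A (D.tens G.A H.A) ≫ extend K f =
    D.hom F.a (D.hom G.a H.a) ≫ f

theorem Trilin.eq {f : D.tens F.A (D.tens G.A H.A) ⟶ K.A} (hf : D.Trilin F G H K f) :
    D.hom (𝟙 _) (D.φ G.A H.A) ≫ D.φ F.A (D.tens G.A H.A) ≫ extend K f =
      D.hom F.a (D.hom G.a H.a) ≫ f := hf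

/-- Linearity in the first variable alone results from inserting `η` in the other two. -/
theorem Trilin.lin {f : D.tens F.A (D.tens G.A H.A) ⟶ K.A} (hf : D.Trilin F G H K f) :
    D.Lin F (D.tens G.A H.A) K f := by
  have h := congrArg (D.hom (𝟙 (D.T.obj F.A)) (D.hom (D.T.η G.A) (D.T.η H.A)) ≫ ·) hf
  rwa [D.hom_comp_hom_assoc, D.hom_comp_hom_assoc, D.η_φ, D.hom_comp_hom, G.unit, H.unit, D.hom_id,
    Category.id_comp, Category.id_comp] at h

/-- Extend `f` to a map on `F ⊗ T(G ⊗ H)` that is bilinear. It coequalizes `F ⊗ -` applied to the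
Linton pair of `G` and `H`, and `F ⊗ -` preserves that coequalizer, so it descends to `F ⊗ W`. -/
theorem Trilin.desc (hD : D.Rc) {u : D.tens G.A H.A ⟶ W.A} (hu : D.IsLinton G H W u)
    {f : D.tens F.A (D.tens G.A H.A) ⟶ K.A} (hf : D.Trilin F G H K f) :
    ∃ g : D.tens F.A W.A ⟶ K.A, D.Bilin F W K g ∧ D.hom (𝟙 F.A) u ≫ g = f := by
  obtain ⟨g', hb, hη, hg'⟩ := hf.lin.bilin
  -- The members of the Linton pair are morphisms of free algebras, so composing with them preserves
  -- bilinearity and their images under `F ⊗ -` can be compared on generators.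
  let l₁ : D.T.free (D.tens (D.T.obj G.A) (D.T.obj H.A)) ⟶
      D.T.free (D.tens G.A H.A) := ⟨D.lfst G H, by
        change D.T.map (D.T.map _ ≫ _) ≫ D.T.μ _ = D.T.μ _ ≫ D.T.map _ ≫ D.T.μ _
        rw [D.T.map_comp, Category.assoc, D.T.assoc, reassoc_of% D.T.μ_nat]⟩
  let l₂ : D.T.free (D.tens (D.T.obj G.A) (D.T.obj H.A)) ⟶
      D.T.free (D.tens G.A H.A) := ⟨D.lsnd G H, D.T.μ_nat _⟩
  have hc : D.hom (𝟙 F.A) (D.lfst G H) ≫ g' = D.hom (𝟙 F.A) (D.lsnd G H) ≫ g' := by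
    have e : D.hom (D.T.η F.A) (D.φ G.A H.A) = D.hom (D.T.η F.A) (𝟙 _) ≫ D.hom (𝟙 _) (D.φ _ _) := by
      rw [D.hom_comp_hom, Category.comp_id, Category.id_comp]
    -- On generators the two composites are `1 ⊗ φ` and the tensor of the actions of `G` and `H`;
    -- trilinearity of `f` compares them.
    refine Bilin.ext_free (hb.precomp (𝟙 F) l₁) (hb.precomp (𝟙 F) l₂) ?_
    rw [D.hom_comp_hom_assoc, D.hom_comp_hom_assoc, lfst, lsnd, ← reassoc_of% D.T.η_nat,
      D.T.left_unit, ← D.T.η_nat, D.hom_comp (𝟙 _) (𝟙 _) (D.hom _ _), Category.assoc, hη,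
      hg', D.hom_comp_hom_assoc, Category.comp_id, Category.comp_id, Category.id_comp,
      Category.comp_id, e,
      Category.assoc, Trilin.eq hf, D.hom_comp_hom_assoc, F.unit, Category.id_comp]
  obtain ⟨g, hg⟩ : ∃ g : D.tens F.A W.A ⟶ K.A, D.hom (𝟙 F.A) (extend W u) ≫ g = g' :=
    (hu.2.map (D.isReflexivePair G H) (hD.left F.A)).desc g' hc
  refine ⟨g, ?_, ?_⟩
  -- Bilinearity of `g'` passes to `g` because `TF ⊗ T(extend W u)` is epi.
  · have he : Epi (D.hom (𝟙 (D.T.obj F.A)) (D.T.map (extend W u))) :=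
      (hu.gen hD) (D.T.toFunctor ⋙ D.tensLeft _) (hD.monad.comp (hD.left _))
    have hb' : D.φ F.A _ ≫ D.T.map g' ≫ K.a = D.hom F.a (D.T.μ _) ≫ g' := hb
    have e := D.φ_nat (𝟙 F.A) (extend W u)
    rw [D.T.map_id] at e
    rw [Bilin, ← cancel_epi (D.hom (𝟙 (D.T.obj F.A)) (D.T.map (extend W u))),
      reassoc_of% e, ← D.T.map_comp_assoc, hg, hb', D.hom_comp_hom_assoc,
      map_extend, Category.id_comp, ← hg, D.hom_comp_hom_assoc, Category.comp_id]
  · have e := D.hom_comp (𝟙 F.A) (𝟙 F.A) (D.T.η _) (extend W u)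
    rw [η_extend, Category.comp_id] at e
    rw [e, Category.assoc, hg, hη]

/-! ### Associativity and unit isomorphisms between Linton tensor products. -/

variable {E₁ E₂ E₃ E₄ : D.T.Alg}

theorem Trilin.descTensor (hD : D.Rc) {u : D.tens G.A H.A ⟶ W.A} (hu : D.IsLinton G H W u)
    {u' : D.tens F.A W.A ⟶ W'.A} (hu' : D.IsLinton F W W' u')
    {f : D.tens F.A (D.tens G.A H.A) ⟶ K.A} (hf : D.Trilin F G H K f) :
    ∃ g : W' ⟶ K, D.hom (𝟙 F.A) u ≫ u' ≫ g.f = f := by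
  obtain ⟨g, hb, hg⟩ := hf.desc hD hu
  obtain ⟨k, hk⟩ := hu'.desc hD hb
  exact ⟨k, by rw [hk, hg]⟩

/-- A morphism `F ⊗ (G ⊗ H) ⟶ (F ⊗ G) ⊗ H` compatible with the actions of the monad induces a
morphism between the Linton tensor products. -/
theorem exists_assoc (hD : D.Rc) {u₁ : D.tens G.A H.A ⟶ E₁.A} (h₁ : D.IsLinton G H E₁ u₁)
    {u₂ : D.tens F.A E₁.A ⟶ E₂.A} (h₂ : D.IsLinton F E₁ E₂ u₂)
    {u₃ : D.tens F.A G.A ⟶ E₃.A} (h₃ : D.IsLinton F G E₃ u₃)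
    {u₄ : D.tens E₃.A H.A ⟶ E₄.A} (h₄ : D.IsLinton E₃ H E₄ u₄)
    (α : D.tens F.A (D.tens G.A H.A) ⟶ D.tens (D.tens F.A G.A) H.A)
    (α' : D.tens (D.T.obj F.A) (D.tens (D.T.obj G.A) (D.T.obj H.A)) ⟶
      D.tens (D.tens (D.T.obj F.A) (D.T.obj G.A)) (D.T.obj H.A))
    (hα : D.hom F.a (D.hom G.a H.a) ≫ α = α' ≫ D.hom (D.hom F.a G.a) H.a)
    (hα' : D.hom (𝟙 _) (D.φ G.A H.A) ≫ D.φ F.A (D.tens G.A H.A) ≫ D.T.map α =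
      α' ≫ D.hom (D.φ F.A G.A) (𝟙 _) ≫ D.φ (D.tens F.A G.A) H.A) :
    ∃ g : E₂ ⟶ E₄, D.hom (𝟙 F.A) u₁ ≫ u₂ ≫ g.f = α ≫ D.hom u₃ (𝟙 H.A) ≫ u₄ := by
  -- It suffices that `α` followed by the two universal bilinear maps is trilinear; here `α'` plays
  -- the role of `α` at `TF`, `TG`, `TH`.
  refine Trilin.descTensor hD h₁ h₂ ?_
  have e₄ : D.φ E₃.A H.A ≫ D.T.map u₄ ≫ E₄.a = D.hom E₃.a H.a ≫ u₄ := h₄.1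
  have e₃ : D.φ F.A G.A ≫ D.T.map u₃ ≫ E₃.a = D.hom F.a G.a ≫ u₃ := h₃.1
  rw [Trilin, reassoc_of% hα, extend]
  simp only [D.T.map_comp, Category.assoc]
  rw [reassoc_of% hα', ← reassoc_of% D.φ_nat, e₄, D.hom_comp_hom_assoc, D.hom_comp_hom_assoc,
    D.hom_comp_hom_assoc, Category.id_comp, D.T.map_id, Category.id_comp, Category.assoc, e₃,
    Category.comp_id]

/-- Exchanging the variables turns `(F ⊗ G) ⊗ H` into a tensor bracketed to the right, so the
candidate inverse comes from `exists_assoc` for `D.swap` and `α⁻¹`. The two composites are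
identities because they are so on the generators from `F ⊗ (G ⊗ H)` and `(F ⊗ G) ⊗ H`. -/
theorem exists_assoc_iso (hD : D.Rc) {u₁ : D.tens G.A H.A ⟶ E₁.A} (h₁ : D.IsLinton G H E₁ u₁)
    {u₂ : D.tens F.A E₁.A ⟶ E₂.A} (h₂ : D.IsLinton F E₁ E₂ u₂)
    {u₃ : D.tens F.A G.A ⟶ E₃.A} (h₃ : D.IsLinton F G E₃ u₃)
    {u₄ : D.tens E₃.A H.A ⟶ E₄.A} (h₄ : D.IsLinton E₃ H E₄ u₄)
    (α : D.tens F.A (D.tens G.A H.A) ≅ D.tens (D.tens F.A G.A) H.A)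
    (α' : D.tens (D.T.obj F.A) (D.tens (D.T.obj G.A) (D.T.obj H.A)) ≅
      D.tens (D.tens (D.T.obj F.A) (D.T.obj G.A)) (D.T.obj H.A))
    (hα : D.hom F.a (D.hom G.a H.a) ≫ α.hom = α'.hom ≫ D.hom (D.hom F.a G.a) H.a)
    (hα' : D.hom (𝟙 _) (D.φ G.A H.A) ≫ D.φ F.A (D.tens G.A H.A) ≫ D.T.map α.hom =
      α'.hom ≫ D.hom (D.φ F.A G.A) (𝟙 _) ≫ D.φ (D.tens F.A G.A) H.A) :
    ∃ g : E₂ ≅ E₄, D.hom (𝟙 F.A) u₁ ≫ u₂ ≫ g.hom.f = α.hom ≫ D.hom u₃ (𝟙 H.A) ≫ u₄ := by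
  obtain ⟨g, hg⟩ := exists_assoc hD h₁ h₂ h₃ h₄ α.hom α'.hom hα hα'
  obtain ⟨k, hk⟩ := exists_assoc (D := D.swap) hD.swap h₃.swap h₄.swap h₁.swap h₂.swap α.inv α'.inv
    (show D.hom (D.hom F.a G.a) H.a ≫ α.inv = α'.inv ≫ D.hom F.a (D.hom G.a H.a) by
      rw [Iso.comp_inv_eq, Category.assoc, hα, Iso.inv_hom_id_assoc])
    (show D.hom (D.φ F.A G.A) (𝟙 _) ≫ D.φ (D.tens F.A G.A) H.A ≫ D.T.map α.inv =
      α'.inv ≫ D.hom (𝟙 _) (D.φ G.A H.A) ≫ D.φ F.A (D.tens G.A H.A) by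
      rw [← cancel_epi α'.hom, ← reassoc_of% hα', ← D.T.map_comp, α.hom_inv_id, D.T.map_id,
        Category.comp_id, Iso.hom_inv_id_assoc])
  replace hk : D.hom u₃ (𝟙 H.A) ≫ u₄ ≫ k.f = α.inv ≫ D.hom (𝟙 F.A) u₁ ≫ u₂ := hk
  refine ⟨⟨g, k, ?_, ?_⟩, hg⟩
  · refine (h₂.gen_left hD (h₁.gen hD)).hom_ext ?_
    change _ ≫ g.f ≫ k.f = _ ≫ 𝟙 _
    rw [Category.comp_id, Category.assoc, reassoc_of% hg, hk, Iso.hom_inv_id_assoc]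
  · refine (h₄.gen_right hD (h₃.gen hD)).hom_ext ?_
    change _ ≫ k.f ≫ g.f = _ ≫ 𝟙 _
    rw [Category.comp_id, Category.assoc, reassoc_of% hk, hg, Iso.inv_hom_id_assoc]

/-- A linear map from the unit is compatible with the actions. -/
theorem lin_unit {I : V} {r : D.tens F.A I ⟶ F.A} {r' : D.tens (D.T.obj F.A) I ⟶ D.T.obj F.A}
    (hr : D.hom F.a (𝟙 I) ≫ r = r' ≫ F.a)
    (hr' : D.hom (𝟙 _) (D.T.η I) ≫ D.φ F.A I ≫ D.T.map r = r') : D.Lin F I F r := by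
  rw [Lin, hr, ← hr', Category.assoc, Category.assoc]

/-- An isomorphism `F ⊗ I ⟶ F` compatible with the action of the monad induces an isomorphism
`F ⊗ W ⟶ F`, where `W` is the free algebra on `I`. -/
theorem exists_unit_iso (hD : D.Rc) {I : V} {i : I ⟶ W.A} (hi : IsFree W i)
    {u : D.tens F.A W.A ⟶ W'.A} (hu : D.IsLinton F W W' u) (r : D.tens F.A I ≅ F.A)
    (r' : D.tens (D.T.obj F.A) I ≅ D.T.obj F.A) (hr : D.hom F.a (𝟙 I) ≫ r.hom = r'.hom ≫ F.a)
    (hr' : D.hom (𝟙 _) (D.T.η I) ≫ D.φ F.A I ≫ D.T.map r.hom = r'.hom) :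
    ∃ g : W' ≅ F, D.hom (𝟙 F.A) i ≫ u ≫ g.hom.f = r.hom := by
  have hl : D.Lin F I F r.hom := lin_unit hr hr'
  obtain ⟨f, hb, hf⟩ := hl.ext hi
  obtain ⟨g, hg⟩ := hu.desc hD hb
  have hg' : D.hom (𝟙 F.A) i ≫ u ≫ g.f = r.hom := by rw [hg, hf]
  -- No universal property of `F` supplies a morphism out of it, so the inverse is written down in
  -- the base category and its compatibility with the actions is checked after the invertible `r'`.
  have hk : D.T.map (r.inv ≫ D.hom (𝟙 F.A) i ≫ u) ≫ W'.a =
      F.a ≫ r.inv ≫ D.hom (𝟙 F.A) i ≫ u := by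
    have e : D.φ F.A W.A ≫ D.T.map u ≫ W'.a = D.hom F.a W.a ≫ u := hu.1
    rw [← cancel_epi r'.hom, ← reassoc_of% hr, Iso.hom_inv_id_assoc, D.hom_comp_hom_assoc,
      Category.comp_id, Category.id_comp, ← hr', D.T.map_comp, Category.assoc, Category.assoc,
      Category.assoc, ← D.T.map_comp_assoc, Iso.hom_inv_id, D.T.map_id, Category.id_comp,
      D.T.map_comp, Category.assoc, ← reassoc_of% D.φ_nat, e, D.hom_comp_hom_assoc,
      D.hom_comp_hom_assoc, D.T.map_id, Category.comp_id, Category.id_comp, Category.assoc,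
      ← reassoc_of% D.T.η_nat, W.unit, Category.comp_id]
  refine ⟨⟨g, ⟨_, hk⟩, ?_, ?_⟩, hg'⟩
  · refine (hu.gen_left hD hi.gen).hom_ext ?_
    change _ ≫ g.f ≫ _ = _ ≫ 𝟙 _
    rw [Category.comp_id, Category.assoc, reassoc_of% hg', Iso.hom_inv_id_assoc]
  · refine Mnd.Alg.Hom.ext ?_
    change (r.inv ≫ D.hom (𝟙 F.A) i ≫ u) ≫ g.f = 𝟙 _
    rw [Category.assoc, Category.assoc, hg', Iso.inv_hom_id]

/-- The Linton tensor product of free algebras is the free algebra on the tensor product. -/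
theorem IsLinton.isFree (hD : D.Rc) {Y Z : V} {u : D.tens F.A G.A ⟶ W.A} (hu : D.IsLinton F G W u)
    {y : Y ⟶ F.A} (hy : IsFree F y) {z : Z ⟶ G.A} (hz : IsFree G z) :
    IsFree W (D.hom y z ≫ u) := by
  obtain ⟨k, hk⟩ := hy.desc (K := D.T.free Y) (D.T.η Y)
  obtain ⟨l, hl⟩ := hz.desc (K := D.T.free Z) (D.T.η Z)
  -- Compatibility of `μ` with `φ` says that `φ` itself is bilinear on free algebras; the map it
  -- induces is inverse to the extension.
  have hb : D.Bilin (D.T.free Y) (D.T.free Z) (D.T.free (D.tens Y Z)) (D.φ Y Z) := (D.μ_φ Y Z).symm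
  obtain ⟨m, hm⟩ := hu.desc hD (hb.precomp k l)
  have hk' := hy.comp_extend hk
  have hl' := hz.comp_extend hl
  refine ⟨m.f, ?_, ?_⟩
  · rw [extend_comp, Category.assoc, hm, D.hom_comp_hom_assoc, hk, hl, D.η_φ]
    exact D.T.right_unit _
  · let e : D.T.free (D.tens Y Z) ⟶ W := ⟨extend W (D.hom y z ≫ u), map_extend _ _⟩
    refine congrArg Mnd.Alg.Hom.f ((hu.gen hD).hom_ext (g := m ≫ e) (g' := 𝟙 W) ?_)
    change u ≫ m.f ≫ e.f = u ≫ 𝟙 _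
    rw [reassoc_of% hm, Category.comp_id]
    change _ ≫ _ ≫ extend W _ = _
    rw [← hu.1.hom_extend, D.hom_comp_hom_assoc, hk', hl', D.hom_id, Category.id_comp]

theorem extend_injective {T : Mnd V} {Z : V} {K : T.Alg} {f g : Z ⟶ K.A}
    (h : extend K f = extend K g) : f = g := by
  rw [← η_extend K f, h, η_extend]

theorem Alg.eqToHom_f {T : Mnd V} {P Q : T.Alg} (h : P = Q) :
    (eqToHom h).f = eqToHom (congrArg Mnd.Alg.A h) := by
  subst h; rfl

theorem Bilin.hom_ext {Z : V} {w : Z ⟶ W.A} (hw : IsFree W w) {g g' : D.tens P.A W.A ⟶ K.A}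
    (hg : D.Bilin P W K g) (hg' : D.Bilin P W K g')
    (h : D.hom (𝟙 P.A) w ≫ g = D.hom (𝟙 P.A) w ≫ g') : g = g' := by
  obtain ⟨k, hk⟩ := hw.desc (K := D.T.free Z) (D.T.η Z)
  let e : D.T.free Z ⟶ W := ⟨extend W w, map_extend _ _⟩
  have key : ∀ {f : D.tens P.A W.A ⟶ K.A}, D.hom (𝟙 P.A) (D.T.η Z) ≫ D.hom (𝟙 P.A) e.f ≫ f =
      D.hom (𝟙 P.A) w ≫ f := by
    intro f
    rw [D.hom_comp_hom_assoc, Category.comp_id]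
    change D.hom _ (D.T.η Z ≫ extend W w) ≫ f = _
    rw [η_extend]
  have := Bilin.ext_free (hg.precomp (𝟙 P) e) (hg'.precomp (𝟙 P) e) (by
    change _ ≫ D.hom (𝟙 P.A) e.f ≫ g = _ ≫ D.hom (𝟙 P.A) e.f ≫ g'
    rw [key, key, h])
  have h' := congrArg (D.hom (𝟙 P.A) k.f ≫ ·) this
  change D.hom (𝟙 P.A) k.f ≫ D.hom (𝟙 P.A) (extend W w) ≫ g =
    D.hom (𝟙 P.A) k.f ≫ D.hom (𝟙 P.A) (extend W w) ≫ g' at h'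
  rwa [D.hom_comp_hom_assoc, D.hom_comp_hom_assoc, hw.comp_extend hk, Category.comp_id, D.hom_id,
    Category.id_comp, Category.id_comp] at h'

/-- The characterization of the bilinear extension of a linear map. -/
theorem Lin.eq_iff {Z : V} {w : Z ⟶ W.A} (hw : IsFree W w) {f : D.tens P.A Z ⟶ K.A}
    (hf : D.Lin P Z K f) {k : W ⟶ D.T.free Z} (hk : w ≫ k.f = D.T.η Z)
    {g : D.tens P.A W.A ⟶ K.A} (hg : D.Bilin P W K g) :
    g = D.hom (D.T.η P.A) k.f ≫ D.φ P.A Z ≫ extend K f ↔ D.hom (𝟙 P.A) w ≫ g = f := by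
  obtain ⟨g', hb, hη, hg'⟩ := hf.bilin
  have hr : D.hom (D.T.η P.A) k.f ≫ D.φ P.A Z ≫ extend K f = D.hom (𝟙 P.A) k.f ≫ g' := by
    rw [hg', D.hom_comp_hom_assoc, Category.id_comp, Category.comp_id]
  have hw' : D.hom (𝟙 P.A) w ≫ D.hom (𝟙 P.A) k.f ≫ g' = f := by
    rw [D.hom_comp_hom_assoc, hk, Category.comp_id, hη]
  rw [hr]
  constructor
  · rintro rfl
    exact hw'
  · intro h
    exact Bilin.hom_ext hw hg (hb.precomp (𝟙 P) k) (h.trans hw'.symm)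

/-- A coequalizer of the Linton pair is an algebra. -/
theorem exists_alg (hD : D.Rc) {Z : V} {q : D.T.obj (D.tens P.A Q.A) ⟶ Z}
    (hq : IsCoeq (D.lfst P Q) (D.lsnd P Q) q) :
    ∃ a : D.T.obj Z ⟶ Z, D.T.η Z ≫ a = 𝟙 Z ∧ D.T.μ Z ≫ a = D.T.map a ≫ a ∧
      D.T.map q ≫ a = D.T.μ _ ≫ q := by
  -- `T` and `T²` preserve the coequalizer: the first makes `μ` descend to an action on `Z`, and the
  -- associativity law is verified after the epi `T²q`.
  have h' := hq.map (D.isReflexivePair P Q) hD.monad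
  have h'' := h'.map (isReflexivePair_map (D.isReflexivePair P Q) _) hD.monad
  obtain ⟨a, ha⟩ := h'.desc (D.T.μ _ ≫ q) (by
    rw [lfst, lsnd, D.T.map_comp, Category.assoc, reassoc_of% D.T.assoc, reassoc_of% D.T.μ_nat,
      reassoc_of% D.T.μ_nat]
    obtain ⟨e, -⟩ := hq
    rw [lfst, lsnd, Category.assoc] at e
    rw [e])
  have := hq.epi
  have := h''.epi
  refine ⟨a, ?_, ?_, ha⟩
  · rw [← cancel_epi q, reassoc_of% D.T.η_nat, ha, reassoc_of% D.T.left_unit, Category.comp_id]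
  · rw [← cancel_epi (D.T.map (D.T.map q)), reassoc_of% D.T.μ_nat, ha, ← D.T.map_comp_assoc, ha,
      D.T.map_comp, Category.assoc, ha, reassoc_of% D.T.assoc]

end TensorMonad

/-! ### Coequalizers in products -/

theorem isCoeq_mk {V : Type*} [Category V] {X Y Z : V} {f g : X ⟶ Y} {q : Y ⟶ Z}
    (h : f ≫ q = g ≫ q)
    (d : ∀ {K : V} (k : Y ⟶ K), f ≫ k = g ≫ k → ∃ l : Z ⟶ K, q ≫ l = k)
    (he : Epi q) : IsCoeq f g q := by
  refine ⟨h, ⟨Cofork.IsColimit.mk _ (fun c => (d c.π c.condition).choose)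
    (fun c => (d c.π c.condition).choose_spec) fun c m hm => ?_⟩⟩
  rw [← cancel_epi q]
  exact Eq.trans hm (d c.π c.condition).choose_spec.symm

theorem preservesReflexiveCoequalizers_of_isCoeq {V W : Type*} [Category V] [Category W]
    {F : V ⥤ W} (h : ∀ {X Y Z : V} {f g : X ⟶ Y} {q : Y ⟶ Z}, IsReflexivePair f g →
      IsCoeq f g q → IsCoeq (F.map f) (F.map g) (F.map q)) : PreservesReflexiveCoequalizers F := by
  intro X Y f g hr
  refine ⟨fun {c} hc => ?_⟩
  obtain ⟨e, ⟨hq⟩⟩ := h (q := Cofork.π c) hr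
    ⟨Cofork.condition c, ⟨IsColimit.ofIsoColimit hc (Cofork.isoCoforkOfπ c)⟩⟩
  exact ⟨IsColimit.ofIsoColimit ((isColimitMapCoconeCoforkEquiv F (Cofork.condition c)).symm hq)
    ((Cocone.functoriality _ F).mapIso (Cofork.isoCoforkOfπ c).symm)⟩

/-! ### Structural 2-cells disappear up to heterogeneous equality. -/

section Strict

variable {A : Type u} [Bicategory.{w, v} A] [Bicategory.Strict A]

theorem assoc_hom_comp_heq {X Y Z W : A} (f : X ⟶ Y) (g : Y ⟶ Z) (h : Z ⟶ W) {k : X ⟶ W}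
    (σ : f ≫ g ≫ h ⟶ k) : (α_ f g h).hom ≫ σ ≍ σ := by
  rw [Strict.associator_eqToIso, eqToIso.hom]; exact strip_left _ _

theorem assoc_inv_comp_heq {X Y Z W : A} (f : X ⟶ Y) (g : Y ⟶ Z) (h : Z ⟶ W) {k : X ⟶ W}
    (σ : (f ≫ g) ≫ h ⟶ k) : (α_ f g h).inv ≫ σ ≍ σ := by
  rw [Strict.associator_eqToIso, eqToIso.inv]; exact strip_left _ _

theorem rightUnitor_inv_comp_heq {X Y : A} (f : X ⟶ Y) {k : X ⟶ Y} (σ : f ≫ 𝟙 Y ⟶ k) :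
    (ρ_ f).inv ≫ σ ≍ σ := by
  rw [Strict.rightUnitor_eqToIso, eqToIso.inv]; exact strip_left _ _

end Strict

section Products

variable {A : Type u} [Bicategory.{w, v} A] [Bicategory.Strict A] [FiniteProducts A]

/-- Every 1-cell into a product is a `lift`, so a 2-cell out of a `lift` is a pair of 2-cells; the
target is allowed to be a `lift` only up to an equation, so that `h` may be arbitrary. -/
theorem exists_lift₂ {X C D : A} {f : X ⟶ C} {g : X ⟶ D} {h : X ⟶ pr C D} (k : lift f g ⟶ h) :
    ∃ (f' : X ⟶ C) (g' : X ⟶ D) (e : lift f' g' = h) (σ : f ⟶ f') (τ : g ⟶ g'),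
      lift₂ σ τ ≫ eqToHom e = k := by
  obtain ⟨f', g', rfl⟩ : ∃ f' g', h = lift f' g' :=
    ⟨h ≫ p₁, h ≫ p₂, prod_ext (lift_p₁ _ _).symm (lift_p₂ _ _).symm⟩
  refine ⟨f', g', rfl, eqToHom (lift_p₁ _ _).symm ≫ k ▷ p₁ ≫ eqToHom (lift_p₁ _ _),
    eqToHom (lift_p₂ _ _).symm ≫ k ▷ p₂ ≫ eqToHom (lift_p₂ _ _), ?_⟩
  refine prod_ext₂ ?_ ?_
  · simp [lift₂_p₁]
  · simp [lift₂_p₂]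

theorem lift₂_injective {X C D : A} {f f' : X ⟶ C} {g g' : X ⟶ D} {σ σ' : f ⟶ f'} {τ τ' : g ⟶ g'}
    (h : lift₂ σ τ = lift₂ σ' τ') : σ = σ' ∧ τ = τ' := by
  constructor
  · exact eq_of_heq ((lift₂_p₁_heq σ τ).symm.trans ((heq_of_eq (by rw [h])).trans
      (lift₂_p₁_heq σ' τ')))
  · exact eq_of_heq ((lift₂_p₂_heq σ τ).symm.trans ((heq_of_eq (by rw [h])).trans
      (lift₂_p₂_heq σ' τ')))

/-- Hom-categories into a product are products of categories, where coequalizers are formed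
componentwise. -/
theorem IsCoeq.lift₂ {X C D : A} {a b c : X ⟶ C} {a' b' c' : X ⟶ D} {f g : a ⟶ b} {q : b ⟶ c}
    {f' g' : a' ⟶ b'} {q' : b' ⟶ c'} (h : IsCoeq f g q) (h' : IsCoeq f' g' q') :
    IsCoeq (lift₂ f f') (lift₂ g g') (lift₂ q q') := by
  have he := h.epi
  have he' := h'.epi
  obtain ⟨e, -⟩ := id h
  obtain ⟨e', -⟩ := id h'
  refine isCoeq_mk ?_ ?_ ⟨?_⟩
  · rw [← lift₂_comp, ← lift₂_comp, e, e']
  · intro K k hk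
    obtain ⟨m, m', rfl, σ, τ, rfl⟩ := exists_lift₂ k
    simp only [eqToHom_refl, Category.comp_id] at hk ⊢
    rw [← lift₂_comp, ← lift₂_comp] at hk
    obtain ⟨h₁, h₂⟩ := lift₂_injective hk
    obtain ⟨l, rfl⟩ := h.desc σ h₁
    obtain ⟨l', rfl⟩ := h'.desc τ h₂
    exact ⟨MonLax.lift₂ l l', (lift₂_comp _ _ _ _).symm⟩
  · intro K k k' hk
    obtain ⟨m, m', rfl, σ, τ, rfl⟩ := exists_lift₂ k
    obtain ⟨n, n', en, σ', τ', rfl⟩ := exists_lift₂ k'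
    obtain rfl : n = m := by rw [← lift_p₁ n n', en, lift_p₁]
    obtain rfl : n' = m' := by rw [← lift_p₂ n n', en, lift_p₂]
    simp only [eqToHom_refl, Category.comp_id] at hk ⊢
    rw [← lift₂_comp, ← lift₂_comp] at hk
    obtain ⟨h₁, h₂⟩ := lift₂_injective hk
    rw [(cancel_epi _).1 h₁, (cancel_epi _).1 h₂]

/-- Paired with a coequalizer by `IsCoeq.lift₂`, this keeps one variable of the tensor fixed. -/
theorem isCoeq_id {V : Type*} [Category V] (X : V) : IsCoeq (𝟙 X) (𝟙 X) (𝟙 X) :=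
  isCoeq_mk rfl (fun k _ => ⟨k, Category.id_comp k⟩) inferInstance

theorem IsCoeq.congr {V : Type*} [Category V] {X Y Z X' Y' Z' : V} {f g : X ⟶ Y} {q : Y ⟶ Z}
    {f' g' : X' ⟶ Y'} {q' : Y' ⟶ Z'} (h : IsCoeq f g q) (hX : X = X') (hY : Y = Y') (hZ : Z = Z')
    (hf : f ≍ f') (hg : g ≍ g') (hq : q ≍ q') : IsCoeq f' g' q' := by
  subst hX hY hZ; cases hf; cases hg; cases hq; exact h

theorem isReflexivePair_lift₂_id {X C D : A} {a b : X ⟶ C} {f g : a ⟶ b} (h : IsReflexivePair f g)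
    (c : X ⟶ D) : IsReflexivePair (lift₂ f (𝟙 c)) (lift₂ g (𝟙 c)) := by
  obtain ⟨s, h₁, h₂⟩ := h
  refine ⟨lift₂ s (𝟙 c), ?_, ?_⟩
  · rw [← lift₂_comp, h₁, Category.comp_id, lift₂_id]
  · rw [← lift₂_comp, h₂, Category.comp_id, lift₂_id]

theorem isReflexivePair_id_lift₂ {X C D : A} {a b : X ⟶ C} {f g : a ⟶ b} (h : IsReflexivePair f g)
    (c : X ⟶ D) : IsReflexivePair (lift₂ (𝟙 c) f) (lift₂ (𝟙 c) g) := by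
  obtain ⟨s, h₁, h₂⟩ := h
  refine ⟨lift₂ (𝟙 c) s, ?_, ?_⟩
  · rw [← lift₂_comp, h₁, Category.comp_id, lift₂_id]
  · rw [← lift₂_comp, h₂, Category.comp_id, lift₂_id]

/-! ### The structure of a monoidal object at all stages -/

theorem lift₂_q₂_heq {X B C D : A} {a a' : X ⟶ B} {b b' : X ⟶ C} {c c' : X ⟶ D} (σ : a ⟶ a')
    (τ : b ⟶ b') (υ : c ⟶ c') : lift₂ σ (lift₂ τ υ) ▷ (p₂ ≫ p₁) ≍ τ :=
  (whiskerRight_comp_heq _ _ _).trans ((whiskerRight_heq rfl (lift_p₂ _ _) (lift_p₂ _ _)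
    (lift₂_p₂_heq _ _)).trans (lift₂_p₁_heq _ _))

theorem lift₂_q₃_heq {X B C D : A} {a a' : X ⟶ B} {b b' : X ⟶ C} {c c' : X ⟶ D} (σ : a ⟶ a')
    (τ : b ⟶ b') (υ : c ⟶ c') : lift₂ σ (lift₂ τ υ) ▷ (p₂ ≫ p₂) ≍ υ :=
  (whiskerRight_comp_heq _ _ _).trans ((whiskerRight_heq rfl (lift_p₂ _ _) (lift_p₂ _ _)
    (lift₂_p₂_heq _ _)).trans (lift₂_p₂_heq _ _))

namespace MonoidalData

variable {C : A} (S : MonoidalData C)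

/-- The interchange law for the triple of 2-cells, seen as one 2-cell into `C × (C × C)`, and the
associativity cell. The unit cells are treated in the same way. -/
theorem assocAt_naturality {X : A} {F F' G G' H H' : X ⟶ C} (σ : F ⟶ F') (τ : G ⟶ G')
    (υ : H ⟶ H') :
    tensHom S.tensor σ (tensHom S.tensor τ υ) ≫ S.assocAt F' G' H' =
      S.assocAt F G H ≫ tensHom S.tensor (tensHom S.tensor σ τ) υ := by
  apply eq_of_heq
  refine HEq.trans ?_ ((heq_of_eq (whisker_exchange (lift₂ σ (lift₂ τ υ)) S.assoc.hom).symm).trans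
    ?_)
  · refine heq_comp (lift3_tens_right _ _ _ _).symm (lift3_tens_right _ _ _ _).symm
      (lift3_tens_left _ _ _ _).symm ?_ (S.assocAt_heq _ _ _)
    refine HEq.symm ((whiskerRight_tens _ _ _ _).trans ?_)
    refine tensHom_heq _ (lift_p₁ _ _) (lift_p₁ _ _) ?_ ?_ (lift₂_p₁_heq _ _) ?_
    · rw [comp_tens, lift3_q₂, lift3_q₃]
    · rw [comp_tens, lift3_q₂, lift3_q₃]
    refine (whiskerRight_tens _ _ _ _).trans ?_
    exact tensHom_heq _ (lift3_q₂ _ _ _) (lift3_q₂ _ _ _) (lift3_q₃ _ _ _) (lift3_q₃ _ _ _)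
      (lift₂_q₂_heq _ _ _) (lift₂_q₃_heq _ _ _)
  · refine heq_comp (lift3_tens_right _ _ _ _) (lift3_tens_left _ _ _ _)
      (lift3_tens_left _ _ _ _) (S.assocAt_heq _ _ _).symm ?_
    refine (whiskerRight_tens _ _ _ _).trans ?_
    refine tensHom_heq _ ?_ ?_ (lift3_q₃ _ _ _) (lift3_q₃ _ _ _) ?_ (lift₂_q₃_heq _ _ _)
    · rw [comp_tens, lift_p₁, lift3_q₂]
    · rw [comp_tens, lift_p₁, lift3_q₂]
    refine (whiskerRight_tens _ _ _ _).trans ?_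
    exact tensHom_heq _ (lift_p₁ _ _) (lift_p₁ _ _) (lift3_q₂ _ _ _) (lift3_q₂ _ _ _)
      (lift₂_p₁_heq _ _) (lift₂_q₂_heq _ _ _)

/-- A constant 1-cell factors through the terminal 0-cell, where all parallel 2-cells agree. -/
theorem whiskerRight_constAt {X Y : A} {F G : Y ⟶ X} (σ : F ⟶ G) (I : pt A ⟶ C) :
    σ ▷ constAt X I ≍ 𝟙 (constAt Y I) := by
  refine (whiskerRight_comp_heq _ _ _).trans ?_
  have : σ ▷ bang X = eqToHom (bang_uniq _ _) := bang_uniq₂ _ _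
  rw [this, eqToHom_whiskerRight]
  exact eqToHom_heq_id _ (comp_constAt F I ▸ assoc₁ _ _ _)

theorem leftAt_naturality {X : A} {F F' : X ⟶ C} (σ : F ⟶ F') :
    tensHom S.tensor (𝟙 (constAt X S.unit)) σ ≫ S.leftAt F' = S.leftAt F ≫ σ := by
  apply eq_of_heq
  refine HEq.trans ?_ ((heq_of_eq (whisker_exchange σ S.left.hom).symm).trans ?_)
  · refine heq_comp (comp_tens_const_left _ _ _).symm (comp_tens_const_left _ _ _).symm
      (comp_id₁ _).symm ?_ (strip _ _ _)
    refine HEq.symm ((whiskerRight_tens _ _ _ _).trans ?_)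
    exact tensHom_heq _ (comp_constAt _ _) (comp_constAt _ _) (comp_id₁ _) (comp_id₁ _)
      (whiskerRight_constAt _ _) (whiskerRight_id_heq _)
  · exact heq_comp (comp_tens_const_left _ _ _) (comp_id₁ _) (comp_id₁ _) (strip _ _ _).symm
      (whiskerRight_id_heq _)

theorem rightAt_naturality {X : A} {F F' : X ⟶ C} (σ : F ⟶ F') :
    tensHom S.tensor σ (𝟙 (constAt X S.unit)) ≫ S.rightAt F' = S.rightAt F ≫ σ := by
  apply eq_of_heq
  refine HEq.trans ?_ ((heq_of_eq (whisker_exchange σ S.right.hom).symm).trans ?_)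
  · refine heq_comp (comp_tens_const_right _ _ _).symm (comp_tens_const_right _ _ _).symm
      (comp_id₁ _).symm ?_ (strip _ _ _)
    refine HEq.symm ((whiskerRight_tens _ _ _ _).trans ?_)
    exact tensHom_heq _ (comp_id₁ _) (comp_id₁ _) (comp_constAt _ _) (comp_constAt _ _)
      (whiskerRight_id_heq _) (whiskerRight_constAt _ _)
  · exact heq_comp (comp_tens_const_right _ _ _) (comp_id₁ _) (comp_id₁ _) (strip _ _ _).symm
      (whiskerRight_id_heq _)

/-- The invertible 2-cell `α_{F, G, H}` at stage `X`. -/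
noncomputable def assocIsoAt {X : A} (F G H : X ⟶ C) :
    tens S.tensor F (tens S.tensor G H) ≅ tens S.tensor (tens S.tensor F G) H :=
  eqToIso (lift3_tens_right _ F G H).symm ≪≫ whiskerLeftIso (lift3 F G H) S.assoc ≪≫
    eqToIso (lift3_tens_left _ F G H)

/-- The invertible 2-cell `λ_F` at stage `X`. -/
noncomputable def leftIsoAt {X : A} (F : X ⟶ C) : tens S.tensor (constAt X S.unit) F ≅ F :=
  eqToIso (comp_tens_const_left _ _ F).symm ≪≫ whiskerLeftIso F S.left ≪≫ eqToIso (comp_id₁ F)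

/-- The invertible 2-cell `ρ_F` at stage `X`. -/
noncomputable def rightIsoAt {X : A} (F : X ⟶ C) : tens S.tensor F (constAt X S.unit) ≅ F :=
  eqToIso (comp_tens_const_right _ _ F).symm ≪≫ whiskerLeftIso F S.right ≪≫ eqToIso (comp_id₁ F)

theorem whiskerLeft_tensHom_id {Y X : A} (L : Y ⟶ X) {F G G' : X ⟶ C} (τ : G ⟶ G') :
    L ◁ tensHom S.tensor (𝟙 F) τ ≍ tensHom S.tensor (𝟙 (L ≫ F)) (L ◁ τ) := by
  have := whiskerLeft_tensHom L S.tensor (𝟙 F) τ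
  rwa [whiskerLeft_id] at this

theorem whiskerLeft_tensHom_id' {Y X : A} (L : Y ⟶ X) {F G G' : X ⟶ C} (τ : G ⟶ G') :
    L ◁ tensHom S.tensor τ (𝟙 F) ≍ tensHom S.tensor (L ◁ τ) (𝟙 (L ≫ F)) := by
  have := whiskerLeft_tensHom L S.tensor τ (𝟙 F)
  rwa [whiskerLeft_id] at this

theorem PentagonAt.whiskerLeft {X Y : A} {F G H K : X ⟶ C} (h : S.PentagonAt F G H K) (L : Y ⟶ X) :
    S.PentagonAt (L ≫ F) (L ≫ G) (L ≫ H) (L ≫ K) := by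
  have h := congrArg (L ◁ ·) h
  simp only [whiskerLeft_comp] at h
  apply eq_of_heq
  refine HEq.trans ?_ ((heq_of_eq h).trans ?_)
  · refine heq_comp ?_ ?_ ?_ ?_ (heq_comp ?_ ?_ ?_ ?_ ?_)
    any_goals simp only [comp_tens]
    · refine HEq.symm ((S.whiskerLeft_tensHom_id _ _).trans ?_)
      exact tensHom_heq _ rfl rfl (by simp only [comp_tens]) (by simp only [comp_tens]) HEq.rfl
        (S.whiskerLeft_assocAt _ _ _ _)
    · refine HEq.symm ((S.whiskerLeft_assocAt _ _ _ _).trans ?_)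
      rw [comp_tens]
    · refine HEq.symm ((S.whiskerLeft_tensHom_id' _ _).trans ?_)
      exact tensHom_heq _ (by simp only [comp_tens]) (by simp only [comp_tens]) rfl rfl
        (S.whiskerLeft_assocAt _ _ _ _) HEq.rfl
  · refine heq_comp ?_ ?_ ?_ ?_ ?_
    any_goals simp only [comp_tens]
    · refine (S.whiskerLeft_assocAt _ _ _ _).trans ?_
      rw [comp_tens]
    · refine (S.whiskerLeft_assocAt _ _ _ _).trans ?_
      rw [comp_tens]

theorem TriangleAt.whiskerLeft {X Y : A} {F G : X ⟶ C} (h : S.TriangleAt F G) (L : Y ⟶ X) :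
    S.TriangleAt (L ≫ F) (L ≫ G) := by
  have h := congrArg (L ◁ ·) h
  simp only [whiskerLeft_comp] at h
  apply eq_of_heq
  refine HEq.trans ?_ ((heq_of_eq h).trans ?_)
  · refine heq_comp ?_ ?_ ?_ ?_ ?_
    any_goals simp only [comp_tens, comp_constAt]
    · refine HEq.symm ((S.whiskerLeft_assocAt _ _ _ _).trans ?_)
      rw [comp_constAt]
    · refine HEq.symm ((S.whiskerLeft_tensHom_id' _ _).trans ?_)
      exact tensHom_heq _ (by simp only [comp_tens, comp_constAt]) rfl rfl rfl
        (S.whiskerLeft_rightAt _ _) HEq.rfl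
  · refine (S.whiskerLeft_tensHom_id _ _).trans ?_
    exact tensHom_heq _ rfl rfl (by simp only [comp_tens, comp_constAt]) rfl HEq.rfl
      (S.whiskerLeft_leftAt _ _)

end MonoidalData

/-- The axiom is imposed on the generic quadruple of projections, and any quadruple is a whiskering
of that one. -/
theorem MonoidalStructure.pentagonAt {C : A} (S : MonoidalStructure C) {X : A} (F G H K : X ⟶ C) :
    S.PentagonAt F G H K := by
  have h := S.pentagon.whiskerLeft _ (lift F (lift3 G H K))
  have e : ∀ {Z : A} (f : pr C (pr C C) ⟶ Z), lift F (lift3 G H K) ≫ p₂ ≫ f = lift3 G H K ≫ f :=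
    fun f => by rw [← assoc₁, lift_p₂]
  rwa [lift_p₁, e, e, e, lift_p₁, lift3_q₂, lift3_q₃] at h

theorem MonoidalStructure.triangleAt {C : A} (S : MonoidalStructure C) {X : A} (F G : X ⟶ C) :
    S.TriangleAt F G := by
  have h := S.triangle.whiskerLeft _ (lift F G)
  rwa [lift_p₁, lift_p₂] at h

end Products

/-! ### The algebras at a stage -/

section Stage

variable {A : Type u} [Bicategory.{w, v} A] [Bicategory.Strict A] [FiniteProducts A]
  {M : MonoidalObject A} (R : MonadOn M)

/-- The monad that a monad in a 2-category induces on the category of 1-cells at a stage. -/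
noncomputable def stageMnd {B : Type*} [Bicategory B] {c : B} (R : MonadOn c) (X : B) :
    Mnd (X ⟶ c) where
  toFunctor := Bicategory.postcomp X R.t
  η f := (ρ_ f).inv ≫ f ◁ R.η
  μ f := (α_ f R.t R.t).hom ≫ f ◁ R.μ
  η_nat {f g} σ := by
    change σ ≫ (ρ_ g).inv ≫ g ◁ R.η = ((ρ_ f).inv ≫ f ◁ R.η) ≫ σ ▷ R.t
    rw [Category.assoc, whisker_exchange]
    simp
  μ_nat {f g} σ := by
    change σ ▷ R.t ▷ R.t ≫ (α_ _ _ _).hom ≫ g ◁ R.μ = ((α_ _ _ _).hom ≫ f ◁ R.μ) ≫ σ ▷ R.t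
    rw [Category.assoc, whisker_exchange]
    simp
  left_unit f := by
    -- The sides are exchanged: composition of 1-cells is diagrammatic, so `η` at `R(f)` is the
    -- whiskering of `η` by `f ≫ t` on the left.
    have h := congrArg (f ◁ ·) R.right_unit
    simp only [whiskerLeft_comp, whiskerLeft_id] at h
    change ((ρ_ _).inv ≫ (f ≫ R.t) ◁ R.η) ≫ (α_ _ _ _).hom ≫ f ◁ R.μ = 𝟙 (f ≫ R.t)
    rw [← h]
    simp
  right_unit f := by
    have h := congrArg (f ◁ ·) R.left_unit
    simp only [whiskerLeft_comp, whiskerLeft_id] at h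
    change ((ρ_ _).inv ≫ f ◁ R.η) ▷ R.t ≫ (α_ _ _ _).hom ≫ f ◁ R.μ = 𝟙 (f ≫ R.t)
    rw [← h]
    simp
  assoc f := by
    have h := congrArg (f ◁ ·) R.assoc
    simp only [whiskerLeft_comp] at h
    change ((α_ _ _ _).hom ≫ f ◁ R.μ) ▷ R.t ≫ (α_ _ _ _).hom ≫ f ◁ R.μ =
      ((α_ _ _ _).hom ≫ (f ≫ R.t) ◁ R.μ) ≫ (α_ _ _ _).hom ≫ f ◁ R.μ
    simp [h]

/-- The category of 1-cells at a stage, with its tensor and the monad induced by a lax monoidal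
monad. -/
noncomputable def stage (X : A) : TensorMonad (X ⟶ M.carrier) where
  tens := tens M.str.tensor
  hom := tensHom M.str.tensor
  hom_id := tensHom_id _
  hom_comp := tensHom_comp _
  T := stageMnd R.underlying X
  φ := (laxOf R).phiAt
  φ_nat := (laxOf R).phiAt_naturality
  η_φ F G := by
    -- This is the monoidality of `η : 1 ⟶ R`; the coherence cells of the identity 1-cell are
    -- identities and drop out.
    have h := IsMonoidalCell.tensorAt (MonoidalTransformation.isMonoidal R.η) F G
    apply eq_of_heq
    refine HEq.trans ?_ ((heq_of_eq h).trans ?_)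
    · refine heq_comp ?_ rfl rfl ?_ HEq.rfl
      · exact congrArg₂ (tens _) (comp_id₁ F).symm (comp_id₁ G).symm
      · exact tensHom_heq _ (comp_id₁ _).symm rfl (comp_id₁ _).symm rfl
          (rightUnitor_inv_comp_heq _ _) (rightUnitor_inv_comp_heq _ _)
    · refine HEq.trans ?_ (rightUnitor_inv_comp_heq _ _).symm
      refine (heq_comp ?_ rfl rfl ((LaxData.id_phiAt_heq _ _ _).trans
        (id_heq (comp_id₁ _).symm)) HEq.rfl).trans (heq_of_eq (Category.id_comp _))
      exact (congrArg₂ (tens _) (comp_id₁ F) (comp_id₁ G)).trans (comp_id₁ _).symm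
  μ_φ F G := by
    -- This is the monoidality of `μ : RR ⟶ R`, with the coherence cell of `RR` expanded.
    have h := IsMonoidalCell.tensorAt (MonoidalTransformation.isMonoidal R.μ) F G
    apply eq_of_heq
    refine HEq.trans ?_ ((heq_of_eq h).trans ?_)
    · refine heq_comp ?_ rfl rfl ?_ HEq.rfl
      · exact congrArg₂ (tens _) (assoc₁ _ _ _) (assoc₁ _ _ _)
      · exact tensHom_heq _ (assoc₁ _ _ _) rfl (assoc₁ _ _ _) rfl
          (assoc_hom_comp_heq _ _ _ _) (assoc_hom_comp_heq _ _ _ _)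
    · refine HEq.trans ?_ (heq_of_eq (Category.assoc _ _ _))
      refine heq_comp ?_ (assoc₁ _ _ _).symm rfl (LaxData.comp_phiAt_heq _ _ _ _)
        (assoc_hom_comp_heq _ _ _ _).symm
      exact congrArg₂ (tens _) (assoc₁ _ _ _).symm (assoc₁ _ _ _).symm

variable {R}

/-- A subequalizing 1-cell as an algebra at its stage. -/
noncomputable def Subeq.alg {B : Type*} [Bicategory B] {c : B} {R : MonadOn c} {X : B}
    (x : Subeq R X) : (stageMnd R X).Alg where
  A := x.u
  a := x.ν
  unit := (Category.assoc _ _ _).trans x.unit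
  assoc := (Category.assoc _ _ _).trans x.assoc.symm

/-- The tensor as a 1-cell out of `C × C` preserves reflexive coequalizers of pairs; pairing a
reflexive coequalizer with an identity gives preservation in each variable. -/
theorem stage_rc (hT : IsRC1 M.str.tensor) (hR : IsRC1 R.underlying.t)
    (X : A) : (stage R X).Rc where
  left F := preservesReflexiveCoequalizers_of_isCoeq fun hr h =>
    ((isCoeq_id F).lift₂ h).map (isReflexivePair_id_lift₂ hr F) (hT X)
  right F := preservesReflexiveCoequalizers_of_isCoeq fun hr h =>
    (h.lift₂ (isCoeq_id F)).map (isReflexivePair_lift₂_id hr F) (hT X)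
  monad := hR X

end Stage

/-! ### 1-cells and 2-cells into an Eilenberg-Moore object -/

section EM

variable {B : Type*} [Bicategory B] {c : B} {R : MonadOn c}

theorem Subeq.hext {X : B} {x y : Subeq R X} (h : x.u = y.u) (h' : x.ν ≍ y.ν) : x = y := by
  obtain ⟨u, ν, _, _⟩ := x
  obtain ⟨u', ν', _, _⟩ := y
  dsimp only at h h'
  subst h
  cases h'
  rfl

theorem Subeq.precomp_precomp [Bicategory.Strict B] {X Y Z : B} (x : Subeq R X) (L : Y ⟶ X)
    (K : Z ⟶ Y) : (x.precomp L).precomp K = x.precomp (K ≫ L) := by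
  refine Subeq.hext (assoc₁ _ _ _).symm ?_
  refine (assoc_hom_comp_heq _ _ _ _).trans (HEq.trans ?_ (assoc_hom_comp_heq _ _ _ _).symm)
  refine HEq.trans ?_ (whiskerLeft_comp_heq _ _ _).symm
  exact whiskerLeft_heq rfl (assoc₁ _ _ _) rfl (assoc_hom_comp_heq _ _ _ _)

variable {E : B} {s : Subeq R E}

/-- The morphism of algebras induced by a 2-cell. -/
noncomputable def algHom {X : B} {K K' : X ⟶ E} (n : K ⟶ K') :
    (s.precomp K).alg ⟶ (s.precomp K').alg :=
  Mnd.Alg.Hom.mk (n ▷ s.u) (Subeq.Hom.comm ((emFunctor s X).map n))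

theorem IsEMObject.exists_obj (hs : IsEMObject R s) {X : B} (x : Subeq R X) :
    ∃ K, s.precomp K = x := (hs X).1.surjective x

theorem IsEMObject.obj_ext (hs : IsEMObject R s) {X : B} {K K' : X ⟶ E}
    (h : s.precomp K = s.precomp K') : K = K' := (hs X).1.injective h

theorem IsEMObject.exists_hom (hs : IsEMObject R s) {X : B} {K K' : X ⟶ E}
    (g : (s.precomp K).alg ⟶ (s.precomp K').alg) : ∃ n : K ⟶ K', n ▷ s.u = g.f := by
  obtain ⟨n, hn⟩ := (hs X).2.1.map_surjective
    (show (emFunctor s X).obj K ⟶ (emFunctor s X).obj K' from Subeq.Hom.mk g.f g.h)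
  exact ⟨n, congrArg Subeq.Hom.cell hn⟩

theorem IsEMObject.hom_ext (hs : IsEMObject R s) {X : B} {K K' : X ⟶ E} {n n' : K ⟶ K'}
    (h : n ▷ s.u = n' ▷ s.u) : n = n' :=
  (hs X).2.2.map_injective (Subeq.Hom.ext h)

theorem IsEMObject.exists_iso (hs : IsEMObject R s) {X : B} {K K' : X ⟶ E}
    (g : (s.precomp K).alg ≅ (s.precomp K').alg) : ∃ n : K ≅ K', n.hom ▷ s.u = g.hom.f := by
  obtain ⟨n, hn⟩ := hs.exists_hom g.hom
  obtain ⟨m, hm⟩ := hs.exists_hom g.inv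
  refine ⟨⟨n, m, hs.hom_ext ?_, hs.hom_ext ?_⟩, hn⟩
  · rw [comp_whiskerRight, hn, hm, id_whiskerRight]
    exact congrArg Mnd.Alg.Hom.f g.hom_inv_id
  · rw [comp_whiskerRight, hn, hm, id_whiskerRight]
    exact congrArg Mnd.Alg.Hom.f g.inv_hom_id

/-- An inverse on algebras is the image of a 2-cell, because 1-cells into `E` and algebras form
isomorphic categories. -/
theorem IsEMObject.isIso (hs : IsEMObject R s) {X : B} {K K' : X ⟶ E} {n : K ⟶ K'}
    (h : IsIso (algHom (s := s) n)) : IsIso n := by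
  obtain ⟨m, hm⟩ := hs.exists_iso (asIso (algHom (s := s) n))
  obtain rfl : m.hom = n := hs.hom_ext hm
  infer_instance

theorem precomp_freeCell [Bicategory.Strict B] (hs : IsEMObject R s) {X : B} (I : X ⟶ c) :
    s.precomp (I ≫ freeCell hs) = (freeSubeq R).precomp I := by
  rw [← Subeq.precomp_precomp]
  exact congrArg (fun x => Subeq.precomp x I) (emFunctor_freeCell hs)

/-- Faithfulness of `U` combined with `Gen.hom_ext`: parallel 2-cells into `E` are compared on
generators. -/
theorem IsGen.hom_ext (hs : IsEMObject R s) {X : B} {K K' : X ⟶ E} {Z : X ⟶ c} {w : Z ⟶ K ≫ s.u}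
    (h : TensorMonad.Gen (s.precomp K).alg w) {n n' : K ⟶ K'}
    (e : w ≫ n ▷ s.u = w ≫ n' ▷ s.u) : n = n' :=
  hs.hom_ext (congrArg Mnd.Alg.Hom.f (h.hom_ext (g := algHom n) (g' := algHom n') e))

end EM

/-! ### Linton tensor products at a stage -/

section Linton

variable {A : Type u} [Bicategory.{w, v} A] [Bicategory.Strict A] [FiniteProducts A]
  {M : MonoidalObject A} {R : MonadOn M}

/-- `u : P ⊗ Q ⟶ W` exhibits `W` as the Linton tensor product of algebras at stage `X`. -/
def IsLintonAt {X : A} (P Q W : Subeq R.underlying X) (u : tens M.str.tensor P.u Q.u ⟶ W.u) :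
    Prop :=
  (stage R X).IsLinton P.alg Q.alg W.alg u

/-- Bilinearity is already contained in the coequalizing condition, by `IsCoeq.bilin`. -/
theorem isLintonAt_iff {X : A} {P Q W : Subeq R.underlying X}
    {u : tens M.str.tensor P.u Q.u ⟶ W.u} :
    IsLintonAt P Q W u ↔
      IsCoeq (lintonFst P Q) (lintonSnd P Q) (u ▷ R.underlying.t ≫ W.ν) :=
  ⟨fun h => h.2, fun h => ⟨TensorMonad.IsCoeq.bilin h.1, h⟩⟩

theorem IsLintonAt.congr {X : A} {P Q W P' Q' W' : Subeq R.underlying X}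
    {u : tens M.str.tensor P.u Q.u ⟶ W.u} {u' : tens M.str.tensor P'.u Q'.u ⟶ W'.u}
    (h : IsLintonAt P Q W u) (hP : P = P') (hQ : Q = Q') (hW : W = W') (hu : u ≍ u') :
    IsLintonAt P' Q' W' u' := by
  subst hP hQ hW; cases hu; exact h

theorem isReflexivePair_linton {X : A} (P Q : Subeq R.underlying X) :
    IsReflexivePair (lintonFst P Q) (lintonSnd P Q) :=
  (stage R X).isReflexivePair P.alg Q.alg

theorem whiskerLeft_lintonFst {X Y : A} (L : Y ⟶ X) (P Q : Subeq R.underlying X) :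
    L ◁ lintonFst P Q ≍ lintonFst (P.precomp L) (Q.precomp L) := by
  have e : L ≫ tens M.str.tensor P.u Q.u = tens M.str.tensor (L ≫ P.u) (L ≫ Q.u) :=
    comp_tens _ _ _ _
  have e' : L ≫ tens M.str.tensor (P.u ≫ R.underlying.t) (Q.u ≫ R.underlying.t) =
      tens M.str.tensor ((L ≫ P.u) ≫ R.underlying.t) ((L ≫ Q.u) ≫ R.underlying.t) := by
    rw [comp_tens, assoc₁, assoc₁]
  rw [lintonFst, whiskerLeft_comp]
  refine heq_comp ?_ ?_ ?_ ?_ ?_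
  · rw [← assoc₁, e']; rfl
  · rw [← assoc₁, ← assoc₁, e]; rfl
  · rw [← assoc₁, e]; rfl
  · refine (whisker_assoc_heq _ _ _).symm.trans (whiskerRight_heq rfl e' ?_ ?_)
    · rw [← assoc₁, e]; rfl
    · exact ((laxOf R).whiskerLeft_phiAt _ _ _).trans HEq.rfl
  · refine HEq.trans ?_ (assoc_hom_comp_heq _ _ _ _).symm
    refine (whiskerLeft_heq rfl (assoc₁ _ _ _) rfl (assoc_hom_comp_heq _ _ _ _)).trans ?_
    refine (whiskerLeft_comp_heq _ _ _).symm.trans ?_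
    exact whiskerLeft_heq e rfl rfl HEq.rfl

theorem whiskerLeft_lintonSnd {X Y : A} (L : Y ⟶ X) (P Q : Subeq R.underlying X) :
    L ◁ lintonSnd P Q ≍ lintonSnd (P.precomp L) (Q.precomp L) := by
  refine (whisker_assoc_heq _ _ _).symm.trans (whiskerRight_heq rfl ?_ (comp_tens _ _ _ _) ?_)
  · rw [comp_tens, ← assoc₁, ← assoc₁]; rfl
  · refine (whiskerLeft_tensHom _ _ _ _).trans ?_
    exact tensHom_heq _ (assoc₁ _ _ _).symm rfl (assoc₁ _ _ _).symm rfl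
      (assoc_hom_comp_heq _ _ _ _).symm (assoc_hom_comp_heq _ _ _ _).symm

/-- Whiskering with `L` carries the Linton pair to the Linton pair of the whiskered algebras, and,
`C` being rc, preserves its coequalizer since the pair is reflexive. -/
theorem IsLintonAt.whiskerLeft (hC : IsRC0 M.carrier) {X Y : A} {P Q W : Subeq R.underlying X}
    {u : tens M.str.tensor P.u Q.u ⟶ W.u} (h : IsLintonAt P Q W u) (L : Y ⟶ X)
    {u' : tens M.str.tensor (L ≫ P.u) (L ≫ Q.u) ⟶ L ≫ W.u} (hu : u' ≍ L ◁ u) :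
    IsLintonAt (P.precomp L) (Q.precomp L) (W.precomp L) u' := by
  refine isLintonAt_iff.2 (((isLintonAt_iff.1 h).map (isReflexivePair_linton P Q)
    (hC.2 L)).congr ?_ ?_ rfl
    (whiskerLeft_lintonFst L P Q) (whiskerLeft_lintonSnd L P Q) ?_)
  · change L ≫ _ ≫ _ = _
    rw [← assoc₁, comp_tens, ← assoc₁, ← assoc₁]; rfl
  · change L ≫ _ ≫ _ = _
    rw [← assoc₁, comp_tens]; rfl
  · change L ◁ (_ ≫ _) ≍ _
    rw [whiskerLeft_comp]
    refine heq_comp ?_ (assoc₁ _ _ _).symm rfl ?_ (assoc_hom_comp_heq _ _ _ _).symm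
    · rw [← assoc₁, comp_tens]; rfl
    · exact (whisker_assoc_heq _ _ _).symm.trans
        (whiskerRight_heq rfl (comp_tens _ _ _ _) rfl hu.symm)

/-- The unit axiom for the monoidal 2-cell `η` leaves no choice: the unit coherence of `R` is `η_I`.
-/
theorem laxOf_phi₀_heq (R : MonadOn M) : (laxOf R).phi₀ ≍ M.str.unit ◁ R.underlying.η := by
  have h : (LaxData.id M.str.toMonoidalData).phi₀ ≫ M.str.unit ◁ R.underlying.η =
    (laxOf R).phi₀ := (MonoidalTransformation.isMonoidal R.η).unit
  rw [← h]
  exact strip_left (comp_id₁ _).symm _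

theorem laxOf_phi₀At (X : A) :
    (laxOf R).phi₀At X = (stage R X).T.η (constAt X M.str.unit) := by
  apply eq_of_heq
  refine ((laxOf R).phi₀At_heq X).trans ?_
  refine HEq.trans ?_ (rightUnitor_inv_comp_heq _ _).symm
  refine (whiskerLeft_heq rfl (comp_id₁ _).symm rfl (laxOf_phi₀_heq R)).trans ?_
  exact (whiskerLeft_comp_heq _ _ _).symm

variable {E : A} {s : Subeq R.underlying E}

/-- The whiskering at stage `X` of a 2-cell `A ⊗ B ⟶ U(A ⊗ B)`. -/
noncomputable abbrev uAt {t : pr E E ⟶ E} (υ : tens M.str.tensor (p₁ ≫ s.u) (p₂ ≫ s.u) ⟶ t ≫ s.u)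
    {X : A} (G H : X ⟶ E) : tens M.str.tensor (G ≫ s.u) (H ≫ s.u) ⟶ tens t G H ≫ s.u :=
  eqToHom (lift_tens_comp _ s.u G H).symm ≫ lift G H ◁ υ ≫ (α_ (lift G H) t s.u).inv

theorem uAt_heq {t : pr E E ⟶ E} (υ : tens M.str.tensor (p₁ ≫ s.u) (p₂ ≫ s.u) ⟶ t ≫ s.u)
    {X : A} (G H : X ⟶ E) : uAt υ G H ≍ lift G H ◁ υ := by
  rw [uAt, Strict.associator_eqToIso, eqToIso.inv]; exact strip _ _ _

/-- Any pair `G`, `H` is a whiskering of the two projections, so the universal Linton tensor product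
gives one at every stage. -/
theorem IsLintonAt.uAt (hC : IsRC0 M.carrier) {t : pr E E ⟶ E}
    {υ : tens M.str.tensor (p₁ ≫ s.u) (p₂ ≫ s.u) ⟶ t ≫ s.u}
    (h : IsLintonAt (s.precomp p₁) (s.precomp p₂) (s.precomp t) υ) {X : A} (G H : X ⟶ E) :
    IsLintonAt (s.precomp G) (s.precomp H) (s.precomp (tens t G H)) (uAt υ G H) := by
  have e : lift G H ≫ tens M.str.tensor (p₁ ≫ s.u) (p₂ ≫ s.u) =
      tens M.str.tensor (lift G H ≫ p₁ ≫ s.u) (lift G H ≫ p₂ ≫ s.u) := comp_tens _ _ _ _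
  refine (h.whiskerLeft hC (lift G H) (u' := eqToHom e.symm ≫ lift G H ◁ υ)
    (strip_left _ _)).congr ?_ ?_ ?_ ((strip_left _ _).trans (uAt_heq υ G H).symm)
  · rw [Subeq.precomp_precomp, lift_p₁]
  · rw [Subeq.precomp_precomp, lift_p₂]
  · rw [Subeq.precomp_precomp]; rfl

theorem isFree_unit (hs : IsEMObject R.underlying s) {X : A} (I : X ⟶ M.carrier) {K : X ⟶ E}
    (hK : K = I ≫ freeCell hs) {w : I ⟶ K ≫ s.u} (hw : w ≍ I ◁ R.underlying.η) :
    TensorMonad.IsFree (s.precomp K).alg w := by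
  subst hK
  -- The algebra is made a variable so that its equality with the free one can be substituted.
  have key : ∀ (x : Subeq R.underlying X) (w : I ⟶ x.u), x = (freeSubeq R.underlying).precomp I →
      w ≍ I ◁ R.underlying.η → TensorMonad.IsFree x.alg w := by
    rintro x w rfl hw
    obtain rfl : w = (stage R X).T.η I :=
      eq_of_heq (hw.trans (rightUnitor_inv_comp_heq _ _).symm)
    exact TensorMonad.isFree_free _ I
  exact key _ w (precomp_freeCell hs I) hw

/-- The two conditions of `exists_assoc_iso` are the naturality of `α` at the actions and the
associativity axiom for `φ`. -/
theorem exists_assoc (hC : IsRC0 M.carrier) (hT : IsRC1 M.str.tensor) (hR : IsRC1 R.underlying.t)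
    (hs : IsEMObject R.underlying s) {t : pr E E ⟶ E}
    {υ : tens M.str.tensor (p₁ ≫ s.u) (p₂ ≫ s.u) ⟶ t ≫ s.u}
    (h : IsLintonAt (s.precomp p₁) (s.precomp p₂) (s.precomp t) υ) {X : A} (F G H : X ⟶ E) :
    ∃ a : tens t F (tens t G H) ≅ tens t (tens t F G) H,
      tensHom M.str.tensor (𝟙 (F ≫ s.u)) (uAt υ G H) ≫ uAt υ F (tens t G H) ≫ a.hom ▷ s.u =
        M.str.assocAt (F ≫ s.u) (G ≫ s.u) (H ≫ s.u) ≫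
          tensHom M.str.tensor (uAt υ F G) (𝟙 (H ≫ s.u)) ≫ uAt υ (tens t F G) H := by
  obtain ⟨g, hg⟩ := TensorMonad.exists_assoc_iso (stage_rc hT hR X) (h.uAt hC G H)
    (h.uAt hC F (tens t G H)) (h.uAt hC F G) (h.uAt hC (tens t F G) H)
    (M.str.assocIsoAt _ _ _) (M.str.assocIsoAt _ _ _)
    (M.str.assocAt_naturality _ _ _) ((LaxMonoidalCell.lax R.t).assocAt_all _ _ _).symm
  obtain ⟨a, ha⟩ := hs.exists_iso g
  exact ⟨a, by rw [ha]; exact hg⟩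

/-- The conditions of `exists_unit_iso` are the naturality of `λ` and the left unit axiom of `R`,
whose unit coherence is `η_I`; the variables are exchanged because `I` stands on the left. -/
theorem exists_left (hC : IsRC0 M.carrier) (hT : IsRC1 M.str.tensor) (hR : IsRC1 R.underlying.t)
    (hs : IsEMObject R.underlying s) {t : pr E E ⟶ E}
    {υ : tens M.str.tensor (p₁ ≫ s.u) (p₂ ≫ s.u) ⟶ t ≫ s.u}
    (h : IsLintonAt (s.precomp p₁) (s.precomp p₂) (s.precomp t) υ) {X : A} {I : X ⟶ E}
    {i : constAt X M.str.unit ⟶ I ≫ s.u}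
    (hi : TensorMonad.IsFree (s.precomp I).alg i) (F : X ⟶ E) :
    ∃ l : tens t I F ≅ F,
      tensHom M.str.tensor i (𝟙 (F ≫ s.u)) ≫ uAt υ I F ≫ l.hom ▷ s.u =
        M.str.leftAt (F ≫ s.u) := by
  have e : (laxOf R).LeftAt (F ≫ s.u) := (LaxMonoidalCell.lax R.t).leftAt_all _
  rw [LaxData.LeftAt, laxOf_phi₀At] at e
  obtain ⟨g, hg⟩ := TensorMonad.exists_unit_iso (D := (stage R X).swap)
    (stage_rc hT hR X).swap hi (h.uAt hC I F).swap (M.str.leftIsoAt _)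
    (M.str.leftIsoAt _) (M.str.leftAt_naturality _) e
  obtain ⟨a, ha⟩ := hs.exists_iso g
  exact ⟨a, by rw [ha]; exact hg⟩

theorem exists_right (hC : IsRC0 M.carrier) (hT : IsRC1 M.str.tensor) (hR : IsRC1 R.underlying.t)
    (hs : IsEMObject R.underlying s) {t : pr E E ⟶ E}
    {υ : tens M.str.tensor (p₁ ≫ s.u) (p₂ ≫ s.u) ⟶ t ≫ s.u}
    (h : IsLintonAt (s.precomp p₁) (s.precomp p₂) (s.precomp t) υ) {X : A} {I : X ⟶ E}
    {i : constAt X M.str.unit ⟶ I ≫ s.u}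
    (hi : TensorMonad.IsFree (s.precomp I).alg i) (F : X ⟶ E) :
    ∃ r : tens t F I ≅ F,
      tensHom M.str.tensor (𝟙 (F ≫ s.u)) i ≫ uAt υ F I ≫ r.hom ▷ s.u =
        M.str.rightAt (F ≫ s.u) := by
  have e : (laxOf R).RightAt (F ≫ s.u) := (LaxMonoidalCell.lax R.t).rightAt_all _
  rw [LaxData.RightAt, laxOf_phi₀At] at e
  obtain ⟨g, hg⟩ := TensorMonad.exists_unit_iso (D := stage R X)
    (stage_rc hT hR X) hi (h.uAt hC F I) (M.str.rightIsoAt _)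
    (M.str.rightIsoAt _) (M.str.rightAt_naturality _) e
  obtain ⟨a, ha⟩ := hs.exists_iso g
  exact ⟨a, by rw [ha]; exact hg⟩

end Linton

/-! ### The Linton monoidal structure -/

section Structure

variable {A : Type u} [Bicategory.{w, v} A] [Bicategory.Strict A] [FiniteProducts A]

theorem tensHom_comp_assoc {X C : A} (t : pr C C ⟶ C) {F F' F'' G G' G'' K : X ⟶ C} (σ : F ⟶ F')
    (σ' : F' ⟶ F'') (τ : G ⟶ G') (τ' : G' ⟶ G'') (k : tens t F'' G'' ⟶ K) :
    tensHom t (σ ≫ σ') (τ ≫ τ') ≫ k = tensHom t σ τ ≫ tensHom t σ' τ' ≫ k := by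
  rw [tensHom_comp, Category.assoc]

variable {M : MonoidalObject A} {R : MonadOn M} {E : A} {s : Subeq R.underlying E}

/-- The coherence 2-cells of `U` exhibit the tensor of `E` as the Linton tensor product and the unit
of `E` as the free algebra on the unit. -/
structure IsLintonLax (hs : IsEMObject R.underlying s) {D : MonoidalData E}
    (υ : LaxData D M.str.toMonoidalData s.u) : Prop where
  linton : IsLintonAt (s.precomp p₁) (s.precomp p₂) (s.precomp D.tensor) υ.phi
  unit : D.unit = M.str.unit ≫ freeCell hs
  phi₀ : υ.phi₀ ≍ M.str.unit ◁ R.underlying.η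

namespace IsLintonLax

variable {hs : IsEMObject R.underlying s} {D : MonoidalData E}

theorem phiAt {υ : LaxData D M.str.toMonoidalData s.u} (h : IsLintonLax hs υ)
    (hC : IsRC0 M.carrier) {X : A} (G H : X ⟶ E) :
    IsLintonAt (s.precomp G) (s.precomp H) (s.precomp (tens D.tensor G H)) (υ.phiAt G H) :=
  h.linton.uAt hC G H

theorem constAt_unit {υ : LaxData D M.str.toMonoidalData s.u} (h : IsLintonLax hs υ) (X : A) :
    constAt X D.unit = constAt X M.str.unit ≫ freeCell hs := by
  rw [constAt, constAt, assoc₁, h.unit]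

theorem phi₀At_heq {υ : LaxData D M.str.toMonoidalData s.u} (h : IsLintonLax hs υ) (X : A) :
    υ.phi₀At X ≍ constAt X M.str.unit ◁ R.underlying.η := by
  refine (υ.phi₀At_heq X).trans (HEq.trans ?_ (whiskerLeft_comp_heq _ _ _).symm)
  refine whiskerLeft_heq rfl (comp_id₁ _).symm ?_ h.phi₀
  rw [h.unit, assoc₁, freeCell_comp]

theorem isFree {υ : LaxData D M.str.toMonoidalData s.u} (h : IsLintonLax hs υ) (X : A) :
    TensorMonad.IsFree (s.precomp (constAt X D.unit)).alg (υ.phi₀At X) :=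
  isFree_unit hs (constAt X M.str.unit) (h.constAt_unit X) (h.phi₀At_heq X)

variable {υ : LaxStructure D M.str.toMonoidalData s.u}

/-- Both sides are compared on the generators `F ⊗ (G ⊗ (H ⊗ K))`, the tensor being that of `C`.
There the lax associativity of `U` replaces each associativity cell of `E` by one of `C`, and the
pentagon of `C` finishes. -/
theorem pentagonAt (h : IsLintonLax hs υ.toLaxData) (hC : IsRC0 M.carrier)
    (hT : IsRC1 M.str.tensor) (hR : IsRC1 R.underlying.t) {X : A} (F G H K : X ⟶ E) :
    D.PentagonAt F G H K := by
  have hD : (stage R X).Rc := stage_rc hT hR X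
  have hg := (h.phiAt hC F _).gen_left hD ((h.phiAt hC G _).gen_left hD ((h.phiAt hC H K).gen hD))
  refine IsGen.hom_ext hs hg ?_
  change (tensHom M.str.tensor (𝟙 (F ≫ s.u)) (tensHom M.str.tensor (𝟙 (G ≫ s.u)) (υ.phiAt H K) ≫
      υ.phiAt G _) ≫ υ.phiAt F _) ≫ (_ ≫ _ ≫ _) ▷ s.u = (tensHom M.str.tensor (𝟙 (F ≫ s.u))
    (tensHom M.str.tensor (𝟙 (G ≫ s.u)) (υ.phiAt H K) ≫ υ.phiAt G _) ≫ υ.phiAt F _) ≫ (_ ≫ _) ▷ s.u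
  have a : ∀ P Q T : X ⟶ E, M.str.assocAt (P ≫ s.u) (Q ≫ s.u) (T ≫ s.u) ≫
      tensHom M.str.tensor (υ.phiAt P Q) (𝟙 (T ≫ s.u)) ≫ υ.phiAt (tens D.tensor P Q) T =
      tensHom M.str.tensor (𝟙 (P ≫ s.u)) (υ.phiAt Q T) ≫ υ.phiAt P (tens D.tensor Q T) ≫
        D.assocAt P Q T ▷ s.u := fun P Q T => υ.assocAt_all P Q T
  have n₁ := υ.phiAt_naturality (𝟙 F) (D.assocAt G H K)
  have n₂ := υ.phiAt_naturality (D.assocAt F G H) (𝟙 K)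
  rw [id_whiskerRight] at n₁ n₂
  have p := M.str.pentagonAt (F ≫ s.u) (G ≫ s.u) (H ≫ s.u) (K ≫ s.u)
  rw [MonoidalData.PentagonAt] at p
  simp only [comp_whiskerRight, assoc₂]
  -- The lax associativity for `F`, `G`, `H`, tensored with `K`.
  have e : tensHom M.str.tensor (tensHom M.str.tensor (𝟙 (F ≫ s.u)) (υ.phiAt G H)) (𝟙 (K ≫ s.u)) ≫
      tensHom M.str.tensor (υ.phiAt F (tens D.tensor G H)) (𝟙 (K ≫ s.u)) ≫
        tensHom M.str.tensor (D.assocAt F G H ▷ s.u) (𝟙 (K ≫ s.u)) =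
      tensHom M.str.tensor (M.str.assocAt (F ≫ s.u) (G ≫ s.u) (H ≫ s.u)) (𝟙 (K ≫ s.u)) ≫
        tensHom M.str.tensor (tensHom M.str.tensor (υ.phiAt F G) (𝟙 (H ≫ s.u))) (𝟙 (K ≫ s.u)) ≫
          tensHom M.str.tensor (υ.phiAt (tens D.tensor F G) H) (𝟙 (K ≫ s.u)) := by
    rw [← tensHom_comp_id, ← tensHom_comp_id, ← a, tensHom_comp_id, tensHom_comp_id]
  have m₁ := M.str.assocAt_naturality (𝟙 (F ≫ s.u)) (υ.phiAt G H) (𝟙 (K ≫ s.u))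
  have m₂ := M.str.assocAt_naturality (𝟙 (F ≫ s.u)) (𝟙 (G ≫ s.u)) (υ.phiAt H K)
  have m₃ := M.str.assocAt_naturality (υ.phiAt F G) (𝟙 (H ≫ s.u)) (𝟙 (K ≫ s.u))
  rw [tensHom_id] at m₂ m₃
  -- Interchange of the coherence cells for `F`, `G` and for `H`, `K`.
  have x : tensHom M.str.tensor (υ.phiAt F G) (𝟙 (tens M.str.tensor (H ≫ s.u) (K ≫ s.u))) ≫
      tensHom M.str.tensor (𝟙 (tens D.tensor F G ≫ s.u)) (υ.phiAt H K) =
      tensHom M.str.tensor (𝟙 (tens M.str.tensor (F ≫ s.u) (G ≫ s.u))) (υ.phiAt H K) ≫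
        tensHom M.str.tensor (υ.phiAt F G) (𝟙 (tens D.tensor H K ≫ s.u)) := by
    rw [← tensHom_comp, ← tensHom_comp, Category.id_comp, Category.id_comp, Category.comp_id,
      Category.comp_id]
  rw [← reassoc_of% n₁, ← tensHom_comp_assoc, Category.id_comp, assoc₂, ← a G H K,
    tensHom_id_comp, tensHom_id_comp, assoc₂, assoc₂, ← reassoc_of% a F, ← n₂,
    reassoc_of% m₁, reassoc_of% e, reassoc_of% p, tensHom_id_comp, assoc₂, ← reassoc_of% a F G,
    reassoc_of% m₂, ← reassoc_of% x, ← a, reassoc_of% m₃]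

/-- The generators are `F ⊗ (I ⊗ G)` with the unit `I` of `C`, which generates the unit of `E`; the
lax axioms of `U` then reduce the triangle to that of `C`. -/
theorem triangleAt (h : IsLintonLax hs υ.toLaxData) (hC : IsRC0 M.carrier)
    (hT : IsRC1 M.str.tensor) (hR : IsRC1 R.underlying.t) {X : A} (F G : X ⟶ E) :
    D.TriangleAt F G := by
  have hD : (stage R X).Rc := stage_rc hT hR X
  have hg := (h.phiAt hC F _).gen_left hD ((h.phiAt hC (constAt X D.unit) G).gen_right hD
    (h.isFree X).gen)
  refine IsGen.hom_ext hs hg ?_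
  change (tensHom M.str.tensor (𝟙 (F ≫ s.u)) (tensHom M.str.tensor (υ.phi₀At X) (𝟙 (G ≫ s.u)) ≫
      υ.phiAt _ G) ≫ υ.phiAt F _) ≫ (_ ≫ _) ▷ s.u = (tensHom M.str.tensor (𝟙 (F ≫ s.u))
    (tensHom M.str.tensor (υ.phi₀At X) (𝟙 (G ≫ s.u)) ≫ υ.phiAt _ G) ≫ υ.phiAt F _) ≫ _ ▷ s.u
  have a := υ.assocAt_all F (constAt X D.unit) G
  have l := υ.leftAt_all G
  have r := υ.rightAt_all F
  have n₁ := υ.phiAt_naturality (𝟙 F) (D.leftAt G)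
  have n₂ := υ.phiAt_naturality (D.rightAt F) (𝟙 G)
  have p := M.str.triangleAt (F ≫ s.u) (G ≫ s.u)
  rw [LaxData.AssocAt] at a
  rw [LaxData.LeftAt] at l
  rw [LaxData.RightAt] at r
  rw [MonoidalData.TriangleAt] at p
  rw [id_whiskerRight] at n₁ n₂
  simp only [comp_whiskerRight, assoc₂]
  rw [← n₁, ← tensHom_comp_assoc, Category.id_comp, assoc₂, l, ← p, tensHom_id_comp, assoc₂,
    ← reassoc_of% a, ← n₂, ← tensHom_comp_assoc, Category.id_comp,
    reassoc_of% M.str.assocAt_naturality (𝟙 (F ≫ s.u)) (υ.phi₀At X) (𝟙 (G ≫ s.u)),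
    ← tensHom_comp_assoc, Category.id_comp, r, assoc₂]

end IsLintonLax

end Structure

/-! ### Existence of the monoidal structure. -/

section Existence

variable {A : Type u} [Bicategory.{w, v} A] [Bicategory.Strict A] [FiniteProducts A]

namespace MonoidalData

variable {C : A} (S : MonoidalData C)

theorem assocAt_projections : S.assocAt p₁ (p₂ ≫ p₁) (p₂ ≫ p₂) = S.assoc.hom := by
  have h : lift3 p₁ (p₂ ≫ p₁) (p₂ ≫ p₂) = 𝟙 (pr C (pr C C)) := by
    rw [lift3, ← comp_lift, lift_p₁_p₂, comp_id₁, lift_p₁_p₂]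
  refine eq_of_heq ((S.assocAt_heq _ _ _).trans ?_)
  exact (whiskerLeft_heq h rfl rfl HEq.rfl).trans (id_whiskerLeft_heq _)

theorem leftAt_id : S.leftAt (𝟙 C) = S.left.hom :=
  eq_of_heq ((strip _ _ _).trans (id_whiskerLeft_heq _))

theorem rightAt_id : S.rightAt (𝟙 C) = S.right.hom :=
  eq_of_heq ((strip _ _ _).trans (id_whiskerLeft_heq _))

end MonoidalData

variable {M : MonoidalObject A} {R : MonadOn M} {E : A} {s : Subeq R.underlying E}

/-- A Linton tensor product on an Eilenberg-Moore object extends to a monoidal structure for which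
`U` is lax monoidal. -/
theorem exists_isLintonLax (hC : IsRC0 M.carrier) (hT : IsRC1 M.str.tensor)
    (hR : IsRC1 R.underlying.t) (hs : IsEMObject R.underlying s) {t : pr E E ⟶ E}
    {υ : tens M.str.tensor (p₁ ≫ s.u) (p₂ ≫ s.u) ⟶ t ≫ s.u}
    (h : IsLintonAt (s.precomp p₁) (s.precomp p₂) (s.precomp t) υ) :
    ∃ (S : MonoidalStructure E) (υ' : LaxStructure S.toMonoidalData M.str.toMonoidalData s.u),
      IsLintonLax hs υ'.toLaxData ∧ S.tensor = t ∧ υ'.phi ≍ υ := by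
  have e₀ : M.str.unit ≫ R.underlying.t = (M.str.unit ≫ freeCell hs) ≫ s.u := by
    rw [assoc₁, freeCell_comp]
  let i₀ : M.str.unit ⟶ (M.str.unit ≫ freeCell hs) ≫ s.u :=
    (ρ_ _).inv ≫ M.str.unit ◁ R.underlying.η ≫ eqToHom e₀
  have hi₀ : i₀ ≍ M.str.unit ◁ R.underlying.η :=
    (rightUnitor_inv_comp_heq _ _).trans (strip_right _ _)
  let i : constAt E M.str.unit ⟶ constAt E (M.str.unit ≫ freeCell hs) ≫ s.u :=
    bang E ◁ i₀ ≫ (α_ _ _ _).inv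
  have hi : TensorMonad.IsFree (s.precomp (constAt E (M.str.unit ≫ freeCell hs))).alg i := by
    refine isFree_unit hs (constAt E M.str.unit) (assoc₁ _ _ _).symm ?_
    refine HEq.trans ?_ (whiskerLeft_comp_heq _ _ _).symm
    refine HEq.trans ?_ (whiskerLeft_heq rfl (comp_id₁ _).symm e₀.symm hi₀)
    rw [show i = bang E ◁ i₀ ≫ (α_ _ _ _).inv from rfl, Strict.associator_eqToIso, eqToIso.inv]
    exact strip_right _ _
  obtain ⟨a, ha⟩ := exists_assoc hC hT hR hs h (X := pr E (pr E E)) p₁ (p₂ ≫ p₁) (p₂ ≫ p₂)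
  obtain ⟨l, hl⟩ := exists_left hC hT hR hs h hi (𝟙 E)
  obtain ⟨r, hr⟩ := exists_right hC hT hR hs h hi (𝟙 E)
  let D : MonoidalData E := ⟨t, M.str.unit ≫ freeCell hs, a, l, r⟩
  -- The induced cells are chosen so that the lax axioms for `U` hold. These axioms involve only the
  -- data `D`, so they are available before its pentagon and triangle, which are deduced from them.
  let υ' : LaxStructure D M.str.toMonoidalData s.u :=
    { phi := υ
      phi₀ := i₀
      assoc := by
        rw [LaxData.AssocAt, MonoidalData.assocAt_projections]
        exact ha.symm
      left := by
        rw [LaxData.LeftAt, MonoidalData.leftAt_id]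
        exact hl
      right := by
        rw [LaxData.RightAt, MonoidalData.rightAt_id]
        exact hr }
  have hL : IsLintonLax hs υ'.toLaxData := ⟨h, rfl, hi₀⟩
  exact ⟨⟨D, hL.pentagonAt hC hT hR _ _ _ _, hL.triangleAt hC hT hR _ _⟩, υ', hL, rfl, HEq.rfl⟩

end Existence

/-! ### Extensions from free algebras. -/

namespace TensorMonad

variable {V : Type*} [Category V] {T : Mnd V}

theorem extend_η_comp {Z : V} (W : T.Alg) {q : T.obj Z ⟶ W.A}
    (h : T.map q ≫ W.a = T.μ Z ≫ q) : extend W (T.η Z ≫ q) = q := by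
  rw [extend, T.map_comp, Category.assoc, h, reassoc_of% T.right_unit]

theorem extend_precomp {Y Z : V} (W : T.Alg) (f : Y ⟶ Z) (w : Z ⟶ W.A) :
    extend W (f ≫ w) = T.map f ≫ extend W w := by
  rw [extend, T.map_comp, Category.assoc]

theorem extend_extend {Z : V} (W : T.Alg) (w : Z ⟶ W.A) :
    extend W (extend W w) = T.map (T.map w) ≫ T.μ W.A ≫ W.a := by
  rw [extend, T.map_comp, Category.assoc, W.assoc]

end TensorMonad

/-! ### The equations of a Linton structure as those of a lax monoidal 1-cell -/

section Equations

variable {A : Type u} [Bicategory.{w, v} A] [Bicategory.Strict A] [FiniteProducts A]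
  {M : MonoidalObject A} {R : MonadOn M} {E : A} {s : Subeq R.underlying E}

theorem tensHom_eqToHom_left {X C : A} (t : pr C C ⟶ C) {F F' G G' : X ⟶ C} (h : F = F')
    (τ : G ⟶ G') :
    tensHom t (eqToHom h) τ = eqToHom (by rw [h]) ≫ tensHom t (𝟙 F') τ := by
  subst h; exact (Category.id_comp _).symm

theorem tensHom_eqToHom_right {X C : A} (t : pr C C ⟶ C) {F F' G G' : X ⟶ C} (h : F = F')
    (τ : G ⟶ G') :
    tensHom t τ (eqToHom h) = eqToHom (by rw [h]) ≫ tensHom t τ (𝟙 F') := by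
  subst h; exact (Category.id_comp _).symm

namespace LintonData

variable (L : LintonData s)

/-- The 2-cell `R(A ⊗ B) ⟶ U(A ⊗ B)` is a morphism of algebras. -/
def IsAlgebra : Prop :=
  L.q ▷ R.underlying.t ≫ (s.precomp L.str.tensor).ν =
    (α_ _ R.underlying.t R.underlying.t).hom ≫
      tens M.str.tensor (p₁ ≫ s.u) (p₂ ≫ s.u) ◁ R.underlying.μ ≫ L.q

variable {L}

/-- A morphism of algebras out of a free algebra is the extension of its restriction along `η`, so
`q` and the coherence cell of `U` determine each other. -/
theorem IsAlgebra.eq (h : L.IsAlgebra) :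
    L.uPhi ▷ R.underlying.t ≫ (s.precomp L.str.tensor).ν = L.q := by
  have e' : L.uPhi = (stageMnd R.underlying (pr E E)).η _ ≫ L.q := (Category.assoc _ _ _).symm
  rw [e']
  exact TensorMonad.extend_η_comp (s.precomp L.str.tensor).alg (h.trans (Category.assoc _ _ _).symm)

variable {hu : L.str.unit ≫ s.u = M.str.unit ≫ R.underlying.t}

theorem IsAlgebra.qAt_eq (h : L.IsAlgebra) {X : A} (G H : X ⟶ E) :
    L.qAt G H = (L.uLax hu).phiAt G H ▷ R.underlying.t ≫ (s.precomp (tens L.str.tensor G H)).ν := by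
  apply eq_of_heq
  have e : L.qAt G H ≍ lift G H ◁ L.q := by
    rw [qAt, Strict.associator_eqToIso, eqToIso.inv]; exact strip _ _ _
  refine e.trans ?_
  rw [← h.eq]
  refine (heq_of_eq (whiskerLeft_comp (lift G H) (L.uPhi ▷ R.underlying.t)
    (s.precomp L.str.tensor).ν)).trans ?_
  refine heq_comp ?_ ?_ (assoc₁ _ _ _).symm ?_ ?_
  · exact lift_tens_comp_comp s G H
  · rw [← assoc₁, ← assoc₁]; rfl
  · refine (whisker_assoc_heq _ _ _).symm.trans ?_
    exact whiskerRight_heq rfl (lift_tens_comp _ _ _ _) (assoc₁ _ _ _).symm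
      ((L.uLax hu).phiAt_heq _ _).symm
  · refine (whiskerLeft_heq rfl (assoc₁ _ _ _) rfl (assoc_hom_comp_heq _ _ _ _)).trans ?_
    exact (whiskerLeft_comp_heq _ _ _).symm.trans (assoc_hom_comp_heq _ _ _ _).symm

theorem IsAlgebra.qAt_comp (h : L.IsAlgebra) {X : A} (G H : X ⟶ E) {K : X ⟶ E}
    (n : tens L.str.tensor G H ⟶ K) : L.qAt G H ≫ n ▷ s.u =
      TensorMonad.extend (s.precomp K).alg ((L.uLax hu).phiAt G H ≫ n ▷ s.u) := by
  rw [h.qAt_eq (hu := hu)]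
  exact TensorMonad.extend_comp (W := (s.precomp (tens L.str.tensor G H)).alg)
    (K := (s.precomp K).alg) _ (algHom n)

/-- Each side of the equation is the extension to a free algebra of the corresponding side of the
lax axiom, and extension is injective. -/
theorem IsAlgebra.assocEqAt_iff (h : L.IsAlgebra) {X : A} (F G H : X ⟶ E) :
    L.AssocEqAt hu F G H ↔ (L.uLax hu).AssocAt F G H := by
  rw [AssocEqAt, h.qAt_comp (hu := hu), h.qAt_eq (hu := hu), LaxData.AssocAt, eq_comm]
  have e₁ := TensorMonad.extend_precomp
    (s.precomp (tens L.str.tensor (tens L.str.tensor F G) H)).alg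
    (tensHom M.str.tensor (𝟙 (F ≫ s.u)) ((L.uLax hu).phiAt G H))
    ((L.uLax hu).phiAt F (tens L.str.tensor G H) ≫ L.str.assocAt F G H ▷ s.u)
  have e₂ := TensorMonad.extend_precomp
    (s.precomp (tens L.str.tensor (tens L.str.tensor F G) H)).alg
    (M.str.assocAt (F ≫ s.u) (G ≫ s.u) (H ≫ s.u))
    (tensHom M.str.tensor ((L.uLax hu).phiAt F G) (𝟙 (H ≫ s.u)) ≫
      (L.uLax hu).phiAt (tens L.str.tensor F G) H)
  have e₃ := TensorMonad.extend_precomp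
    (s.precomp (tens L.str.tensor (tens L.str.tensor F G) H)).alg
    (tensHom M.str.tensor ((L.uLax hu).phiAt F G) (𝟙 (H ≫ s.u)))
    ((L.uLax hu).phiAt (tens L.str.tensor F G) H)
  rw [e₃] at e₂
  constructor
  · intro e
    exact TensorMonad.extend_injective (e₂.trans (e.trans e₁.symm))
  · intro e
    exact e₂.symm.trans ((congrArg (TensorMonad.extend _) e).trans e₁)

/-- The unit of `E` is equal, not merely isomorphic, to the free algebra on `I`; the underlying map
is recorded as an `eqToHom` to match the one in `LeftEq` and `RightEq`. -/
theorem _root_.MonLax.IsLintonLax.exists_unit_hom {hs : IsEMObject R.underlying s}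
    (hL : IsLintonLax hs (L.uLax hu)) {X : A} :
    ∃ k : (s.precomp (constAt X L.str.unit)).alg ⟶
        (stageMnd R.underlying X).free (constAt X M.str.unit),
      (L.uLax hu).phi₀At X ≫ k.f = (stageMnd R.underlying X).η (constAt X M.str.unit) ∧
        k.f = eqToHom (L.constAt_comp hu X) := by
  have hI : (s.precomp (constAt X L.str.unit)).alg =
      (stageMnd R.underlying X).free (constAt X M.str.unit) := by
    have := precomp_freeCell hs (constAt X M.str.unit)
    rw [← hL.constAt_unit] at this
    exact congrArg Subeq.alg this
  have hk : (eqToHom hI).f = eqToHom (L.constAt_comp hu X) := TensorMonad.Alg.eqToHom_f hI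
  refine ⟨eqToHom hI, (congrArg (_ ≫ ·) hk).trans ?_, hk⟩
  refine eq_of_heq ((strip_right _ _).trans ((hL.phi₀At_heq X).trans ?_))
  exact (rightUnitor_inv_comp_heq _ _).symm

/-- The prescribed composite is the extension of the bilinear map on `R(I) ⊗ A` given by the formula
of `Lin.bilin` for `λ`. By `Lin.eq_iff`, a bilinear map equals it exactly when its restriction along
`η_I` is `λ`, which is the unit axiom. -/
theorem IsAlgebra.leftEq_iff (h : L.IsAlgebra) (hC : IsRC0 M.carrier)
    {hs : IsEMObject R.underlying s} (hL : IsLintonLax hs (L.uLax hu)) :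
    L.LeftEq hu ↔ (L.uLax hu).LeftAt (𝟙 E) := by
  let D := stage R E
  let P := (s.precomp (𝟙 E)).alg
  obtain ⟨k, hk, hkf⟩ := hL.exists_unit_hom
  have e : (laxOf R).LeftAt (𝟙 E ≫ s.u) := (LaxMonoidalCell.lax R.t).leftAt_all _
  rw [LaxData.LeftAt, laxOf_phi₀At] at e
  have hlin : D.swap.Lin P (constAt E M.str.unit) P (M.str.leftAt (𝟙 E ≫ s.u)) :=
    TensorMonad.lin_unit (M.str.leftAt_naturality _) e
  have hb : D.Bilin (s.precomp (constAt E L.str.unit)).alg P P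
      ((L.uLax hu).phiAt (constAt E L.str.unit) (𝟙 E) ≫
      L.str.leftAt (𝟙 E) ▷ s.u) :=
    (hL.phiAt hC (constAt E L.str.unit) (𝟙 E)).1.comp (algHom (L.str.leftAt (𝟙 E)))
  have key := TensorMonad.Lin.eq_iff (D := D.swap) (hL.isFree E) hlin hk hb
  rw [LaxData.LeftAt]
  refine Iff.trans ?_ key
  rw [LeftEq, h.qAt_comp (hu := hu)]
  have he : tens M.str.tensor (constAt E L.str.unit ≫ s.u) (𝟙 E ≫ s.u) =
      tens M.str.tensor (constAt E M.str.unit ≫ R.underlying.t) (𝟙 E ≫ s.u) := by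
    rw [L.constAt_comp hu]
  -- Expanding the extension factor by factor turns that formula into the composite of `LeftEq`.
  have hr : TensorMonad.extend P (tensHom M.str.tensor k.f (D.T.η (𝟙 E ≫ s.u)) ≫
      (laxOf R).phiAt (constAt E M.str.unit) (𝟙 E ≫ s.u) ≫
        TensorMonad.extend P (M.str.leftAt (𝟙 E ≫ s.u))) =
      eqToHom (congrArg (· ≫ R.underlying.t) he) ≫
      tensHom M.str.tensor (𝟙 (constAt E M.str.unit ≫ R.underlying.t))
        ((ρ_ _).inv ≫ (𝟙 E ≫ s.u) ◁ R.underlying.η) ▷ R.underlying.t ≫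
      (laxOf R).phiAt (constAt E M.str.unit) (𝟙 E ≫ s.u) ▷ R.underlying.t ≫
      M.str.leftAt (𝟙 E ≫ s.u) ▷ R.underlying.t ▷ R.underlying.t ≫
      (α_ _ R.underlying.t R.underlying.t).hom ≫ (𝟙 E ≫ s.u) ◁ R.underlying.μ ≫
      (s.precomp (𝟙 E)).ν := by
    have x : tensHom M.str.tensor k.f (D.T.η (𝟙 E ≫ s.u)) =
        eqToHom he ≫
          tensHom M.str.tensor (𝟙 (constAt E M.str.unit ≫ R.underlying.t))
          ((ρ_ _).inv ≫ (𝟙 E ≫ s.u) ◁ R.underlying.η) :=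
      (congrArg (tensHom M.str.tensor · (D.T.η (𝟙 E ≫ s.u))) hkf).trans
        (tensHom_eqToHom_left _ _ _)
    refine (congrArg (TensorMonad.extend P)
      ((congrArg (· ≫ _) x).trans (Category.assoc _ _ _))).trans ?_
    refine (TensorMonad.extend_precomp P _ _).trans ?_
    refine congrArg₂ (· ≫ ·) (eqToHom_map D.T.toFunctor _) ?_
    refine (TensorMonad.extend_precomp P _ _).trans (congrArg (_ ≫ ·) ?_)
    refine (TensorMonad.extend_precomp P _ _).trans (congrArg (_ ≫ ·) ?_)
    exact (TensorMonad.extend_extend P _).trans (congrArg (_ ≫ ·) (Category.assoc _ _ _))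
  rw [← hr]
  exact ⟨fun e => TensorMonad.extend_injective e, fun e => congrArg (TensorMonad.extend P) e⟩

theorem IsAlgebra.rightEq_iff (h : L.IsAlgebra) (hC : IsRC0 M.carrier)
    {hs : IsEMObject R.underlying s} (hL : IsLintonLax hs (L.uLax hu)) :
    L.RightEq hu ↔ (L.uLax hu).RightAt (𝟙 E) := by
  let D := stage R E
  let P := (s.precomp (𝟙 E)).alg
  obtain ⟨k, hk, hkf⟩ := hL.exists_unit_hom
  have e : (laxOf R).RightAt (𝟙 E ≫ s.u) := (LaxMonoidalCell.lax R.t).rightAt_all _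
  rw [LaxData.RightAt, laxOf_phi₀At] at e
  have hlin : D.Lin P (constAt E M.str.unit) P (M.str.rightAt (𝟙 E ≫ s.u)) :=
    TensorMonad.lin_unit (M.str.rightAt_naturality _) e
  have hb : D.Bilin P (s.precomp (constAt E L.str.unit)).alg P
      ((L.uLax hu).phiAt (𝟙 E) (constAt E L.str.unit) ≫
      L.str.rightAt (𝟙 E) ▷ s.u) :=
    (hL.phiAt hC (𝟙 E) (constAt E L.str.unit)).1.comp (algHom (L.str.rightAt (𝟙 E)))
  have key := TensorMonad.Lin.eq_iff (D := D) (hL.isFree E) hlin hk hb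
  rw [LaxData.RightAt]
  refine Iff.trans ?_ key
  rw [RightEq, h.qAt_comp (hu := hu)]
  have he : tens M.str.tensor (𝟙 E ≫ s.u) (constAt E L.str.unit ≫ s.u) =
      tens M.str.tensor (𝟙 E ≫ s.u) (constAt E M.str.unit ≫ R.underlying.t) := by
    rw [L.constAt_comp hu]
  have hr : TensorMonad.extend P (tensHom M.str.tensor (D.T.η (𝟙 E ≫ s.u)) k.f ≫
      (laxOf R).phiAt (𝟙 E ≫ s.u) (constAt E M.str.unit) ≫
        TensorMonad.extend P (M.str.rightAt (𝟙 E ≫ s.u))) =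
      eqToHom (congrArg (· ≫ R.underlying.t) he) ≫
      tensHom M.str.tensor ((ρ_ _).inv ≫ (𝟙 E ≫ s.u) ◁ R.underlying.η)
        (𝟙 (constAt E M.str.unit ≫ R.underlying.t)) ▷ R.underlying.t ≫
      (laxOf R).phiAt (𝟙 E ≫ s.u) (constAt E M.str.unit) ▷ R.underlying.t ≫
      M.str.rightAt (𝟙 E ≫ s.u) ▷ R.underlying.t ▷ R.underlying.t ≫
      (α_ _ R.underlying.t R.underlying.t).hom ≫ (𝟙 E ≫ s.u) ◁ R.underlying.μ ≫
      (s.precomp (𝟙 E)).ν := by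
    have x : tensHom M.str.tensor (D.T.η (𝟙 E ≫ s.u)) k.f =
        eqToHom he ≫
          tensHom M.str.tensor ((ρ_ _).inv ≫ (𝟙 E ≫ s.u) ◁ R.underlying.η)
          (𝟙 (constAt E M.str.unit ≫ R.underlying.t)) :=
      (congrArg (tensHom M.str.tensor (D.T.η (𝟙 E ≫ s.u))) hkf).trans
        (tensHom_eqToHom_right _ _ _)
    refine (congrArg (TensorMonad.extend P)
      ((congrArg (· ≫ _) x).trans (Category.assoc _ _ _))).trans ?_
    refine (TensorMonad.extend_precomp P _ _).trans ?_
    refine congrArg₂ (· ≫ ·) (eqToHom_map D.T.toFunctor _) ?_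
    refine (TensorMonad.extend_precomp P _ _).trans (congrArg (_ ≫ ·) ?_)
    refine (TensorMonad.extend_precomp P _ _).trans (congrArg (_ ≫ ·) ?_)
    exact (TensorMonad.extend_extend P _).trans (congrArg (_ ≫ ·) (Category.assoc _ _ _))
  rw [← hr]
  exact ⟨fun e => TensorMonad.extend_injective e, fun e => congrArg (TensorMonad.extend P) e⟩

end LintonData

end Equations

/-! ### Linton structures -/

section LintonStructures

variable {A : Type u} [Bicategory.{w, v} A] [Bicategory.Strict A] [FiniteProducts A]
  {M : MonoidalObject A} {R : MonadOn M} {E : A} {s : Subeq R.underlying E}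
  {hs : IsEMObject R.underlying s}

theorem LintonData.uPhi₀_heq {L : LintonData s}
    (h : L.str.unit ≫ s.u = M.str.unit ≫ R.underlying.t) :
    L.uPhi₀ h ≍ M.str.unit ◁ R.underlying.η :=
  (rightUnitor_inv_comp_heq _ _).trans (strip_right _ _)

namespace LintonStructure

variable (L : LintonStructure s hs)

/-- The coherence 2-cells of `U`. -/
noncomputable abbrev laxData : LaxData L.str.toMonoidalData M.str.toMonoidalData s.u :=
  L.uLax (L.unit_comp hs L.unit)

theorem isLintonLax : IsLintonLax hs L.laxData where
  linton := by
    have h : L.IsAlgebra := L.algebra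
    have h' : IsCoeq (lintonFst (s.precomp p₁) (s.precomp p₂))
      (lintonSnd (s.precomp p₁) (s.precomp p₂)) L.q := ⟨L.condition, L.isColimit⟩
    exact isLintonAt_iff.2 ((congrArg (IsCoeq _ _) h.eq).mpr h')
  unit := L.unit
  phi₀ := LintonData.uPhi₀_heq (L.unit_comp hs L.unit)

/-- The lax monoidal structure of `U`. -/
noncomputable def lax (hC : IsRC0 M.carrier) :
    LaxStructure L.str.toMonoidalData M.str.toMonoidalData s.u where
  toLaxData := L.laxData
  assoc := (LintonData.IsAlgebra.assocEqAt_iff L.algebra _ _ _).1 L.assoc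
  left := (LintonData.IsAlgebra.leftEq_iff L.algebra hC L.isLintonLax).1 L.left
  right := (LintonData.IsAlgebra.rightEq_iff L.algebra hC L.isLintonLax).1 L.right

end LintonStructure

/-- A monoidal structure for which `U` is lax monoidal, given by Linton tensor products, is a
Linton structure. -/
noncomputable def IsLintonLax.structure {S : MonoidalStructure E}
    {υ : LaxStructure S.toMonoidalData M.str.toMonoidalData s.u} (hL : IsLintonLax hs υ.toLaxData)
    (hC : IsRC0 M.carrier) : LintonStructure s hs :=
  let L : LintonData s := ⟨S, υ.phi ▷ R.underlying.t ≫ (s.precomp S.tensor).ν⟩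
  have hu : L.str.unit ≫ s.u = M.str.unit ≫ R.underlying.t := L.unit_comp hs hL.unit
  have ha : L.IsAlgebra :=
    (TensorMonad.map_extend (s.precomp S.tensor).alg υ.phi).trans (Category.assoc _ _ _)
  have hυ : L.uLax hu = υ.toLaxData := LaxData.ext
    ((Category.assoc _ _ _).symm.trans (TensorMonad.η_extend (s.precomp S.tensor).alg υ.phi))
    (eq_of_heq ((LintonData.uPhi₀_heq hu).trans hL.phi₀.symm))
  have hL' : IsLintonLax hs (L.uLax hu) := hυ.symm ▸ hL
  { toLintonData := L
    condition := (isLintonAt_iff.1 hL.linton).choose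
    isColimit := (isLintonAt_iff.1 hL.linton).choose_spec
    algebra := ha
    unit := hL.unit
    left := (ha.leftEq_iff hC hL').2 (hυ.symm ▸ υ.left)
    right := (ha.rightEq_iff hC hL').2 (hυ.symm ▸ υ.right)
    assoc := (ha.assocEqAt_iff _ _ _).2 (hυ.symm ▸ υ.assoc) }

/-- Every coequalizer of the Linton pair underlies a Linton structure. -/
theorem exists_lintonStructure (hC : IsRC0 M.carrier) (hT : IsRC1 M.str.tensor)
    (hR : IsRC1 R.underlying.t) (hs : IsEMObject R.underlying s)
    (c : Cofork (lintonFst (s.precomp p₁) (s.precomp p₂))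
      (lintonSnd (s.precomp p₁) (s.precomp p₂))) (hc : Nonempty (IsColimit c)) :
    ∃ (L : LintonStructure s hs) (h : L.str.tensor ≫ s.u = c.pt), L.q ≫ eqToHom h = c.π := by
  let T := stageMnd R.underlying (pr E E)
  have hq : IsCoeq (lintonFst (s.precomp p₁) (s.precomp p₂))
      (lintonSnd (s.precomp p₁) (s.precomp p₂)) c.π :=
    ⟨c.condition, hc.map fun hc => IsColimit.ofIsoColimit hc (Cofork.isoCoforkOfπ c)⟩
  obtain ⟨a, a_unit, a_assoc, ha⟩ := TensorMonad.exists_alg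
    (D := stage R (pr E E)) (P := (s.precomp p₁).alg) (Q := (s.precomp p₂).alg)
    (stage_rc hT hR (pr E E)) hq
  let W : Subeq R.underlying (pr E E) :=
    ⟨c.pt, a, (Category.assoc _ _ _).symm.trans a_unit,
      a_assoc.symm.trans (Category.assoc _ _ _)⟩
  let υ₀ : tens M.str.tensor (p₁ ≫ s.u) (p₂ ≫ s.u) ⟶ W.u := T.η _ ≫ c.π
  have hυ₀ : υ₀ ▷ R.underlying.t ≫ W.ν = c.π := TensorMonad.extend_η_comp W.alg ha
  have hl : IsLintonAt (s.precomp p₁) (s.precomp p₂) W υ₀ :=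
    isLintonAt_iff.2 ((congrArg (IsCoeq _ _) hυ₀).mpr hq)
  -- The Eilenberg-Moore property yields a tensor lying strictly over the given coequalizer.
  obtain ⟨t, ht⟩ := hs.exists_obj W
  have htu : t ≫ s.u = W.u := congrArg Subeq.u ht
  have ht' : IsLintonAt (s.precomp p₁) (s.precomp p₂) (s.precomp t) (υ₀ ≫ eqToHom htu.symm) :=
    hl.congr rfl rfl ht.symm (strip_right _ _).symm
  obtain ⟨S, υ, hL, rfl, hυ⟩ := exists_isLintonLax hC hT hR hs ht'
  refine ⟨hL.structure hC, htu, ?_⟩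
  have key : ∀ (x : Subeq R.underlying (pr E E))
      (w : tens M.str.tensor (p₁ ≫ s.u) (p₂ ≫ s.u) ⟶ x.u), x = W → w ≍ υ₀ →
      w ▷ R.underlying.t ≫ x.ν ≍ c.π := by
    rintro x w rfl hw
    cases hw
    exact heq_of_eq hυ₀
  exact eq_of_heq ((strip_right _ _).trans (key _ υ.phi ht (hυ.trans (strip_right _ _))))

theorem nonempty_lintonStructure (hC : IsRC0 M.carrier) (hT : IsRC1 M.str.tensor)
    (hR : IsRC1 R.underlying.t) (hs : IsEMObject R.underlying s) :
    Nonempty (LintonStructure s hs) := by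
  have := hC.1 (pr E E)
  have hr := isReflexivePair_linton (s.precomp (p₁ (C := E) (D := E))) (s.precomp p₂)
  have : HasCoequalizer (lintonFst (s.precomp (p₁ (C := E) (D := E))) (s.precomp p₂))
    (lintonSnd (s.precomp p₁) (s.precomp p₂)) := HasReflexiveCoequalizers.has_coeq _ _
  exact (exists_lintonStructure hC hT hR hs _ ⟨colimit.isColimit _⟩).nonempty

end LintonStructures

/-! ### Lax monoidal structures on composites with `U`. -/

section Lifting

variable {A : Type u} [Bicategory.{w, v} A] [Bicategory.Strict A] [FiniteProducts A]

/-! ### Composites of lax monoidal 1-cells at a stage -/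

namespace LaxData

variable {C D E : A} {R : MonoidalData C} {S : MonoidalData D} {T : MonoidalData E} {F : C ⟶ D}
  {G : D ⟶ E} {φ : LaxData R S F} {γ : LaxData S T G}

/-- The axiom of a composite with the coherence cells of both factors made visible, so that the one
of `U` can be cancelled. -/
theorem AssocAt.of_comp {X : A} {H K L : X ⟶ C} (h : (φ.comp γ).AssocAt H K L) :
    T.assocAt ((H ≫ F) ≫ G) ((K ≫ F) ≫ G) ((L ≫ F) ≫ G) ≫
        tensHom T.tensor (γ.phiAt (H ≫ F) (K ≫ F) ≫ φ.phiAt H K ▷ G) (𝟙 ((L ≫ F) ≫ G)) ≫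
          γ.phiAt (tens R.tensor H K ≫ F) (L ≫ F) ≫ φ.phiAt (tens R.tensor H K) L ▷ G =
      tensHom T.tensor (𝟙 ((H ≫ F) ≫ G)) (γ.phiAt (K ≫ F) (L ≫ F) ≫ φ.phiAt K L ▷ G) ≫
        (γ.phiAt (H ≫ F) (tens R.tensor K L ≫ F) ≫ φ.phiAt H (tens R.tensor K L) ▷ G) ≫
          R.assocAt H K L ▷ F ▷ G := by
  apply eq_of_heq
  refine HEq.trans (HEq.symm ?_) ((heq_of_eq h).trans (HEq.symm ?_))
  · refine heq_comp ?_ ?_ ?_ ?_ (heq_comp ?_ ?_ ?_ ?_ ?_)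
    any_goals simp only [assoc₁]
    · exact T.assocAt_congr (assoc₁ _ _ _).symm (assoc₁ _ _ _).symm (assoc₁ _ _ _).symm
    · refine tensHom_heq _ (by simp only [assoc₁]) (assoc₁ _ _ _).symm (by simp only [assoc₁])
        (by simp only [assoc₁]) (comp_phiAt_heq _ _ _ _) (id_heq (by simp only [assoc₁]))
    · refine (comp_phiAt_heq _ _ _ _).trans ?_
      exact heq_comp rfl rfl rfl HEq.rfl HEq.rfl
  · refine heq_comp ?_ ?_ ?_ ?_ (heq_comp ?_ ?_ ?_ ?_ ?_)
    any_goals simp only [assoc₁]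
    · refine tensHom_heq _ (by simp only [assoc₁]) (by simp only [assoc₁])
        (by simp only [assoc₁]) (by simp only [assoc₁]) (id_heq (by simp only [assoc₁]))
        (comp_phiAt_heq _ _ _ _).symm
    · exact (comp_phiAt_heq _ _ _ _).symm
    · exact (whiskerRight_comp_heq _ _ _).symm

theorem LeftAt.of_comp {X : A} {H : X ⟶ C} (h : (φ.comp γ).LeftAt H) :
    tensHom T.tensor (γ.phi₀At X ≫ φ.phi₀At X ▷ G) (𝟙 ((H ≫ F) ≫ G)) ≫
        (γ.phiAt (constAt X R.unit ≫ F) (H ≫ F) ≫ φ.phiAt (constAt X R.unit) H ▷ G) ≫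
          R.leftAt H ▷ F ▷ G = T.leftAt ((H ≫ F) ≫ G) := by
  apply eq_of_heq
  refine HEq.trans (HEq.symm ?_) ((heq_of_eq h).trans ?_)
  · refine heq_comp ?_ ?_ ?_ ?_ (heq_comp ?_ ?_ ?_ ?_ ?_)
    any_goals simp only [assoc₁]
    · exact tensHom_heq _ rfl (by simp only [assoc₁]) (by simp only [assoc₁])
        (by simp only [assoc₁]) (comp_phi₀At_heq _ _ _) (id_heq (by simp only [assoc₁]))
    · exact comp_phiAt_heq _ _ _ _
    · exact whiskerRight_comp_heq _ _ _
  · rw [assoc₁]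

theorem RightAt.of_comp {X : A} {H : X ⟶ C} (h : (φ.comp γ).RightAt H) :
    tensHom T.tensor (𝟙 ((H ≫ F) ≫ G)) (γ.phi₀At X ≫ φ.phi₀At X ▷ G) ≫
        (γ.phiAt (H ≫ F) (constAt X R.unit ≫ F) ≫ φ.phiAt H (constAt X R.unit) ▷ G) ≫
          R.rightAt H ▷ F ▷ G = T.rightAt ((H ≫ F) ≫ G) := by
  apply eq_of_heq
  refine HEq.trans (HEq.symm ?_) ((heq_of_eq h).trans ?_)
  · refine heq_comp ?_ ?_ ?_ ?_ (heq_comp ?_ ?_ ?_ ?_ ?_)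
    any_goals simp only [assoc₁]
    · exact tensHom_heq _ (by simp only [assoc₁]) (by simp only [assoc₁]) rfl
        (by simp only [assoc₁]) (id_heq (by simp only [assoc₁])) (comp_phi₀At_heq _ _ _)
    · exact comp_phiAt_heq _ _ _ _
    · exact whiskerRight_comp_heq _ _ _
  · rw [assoc₁]

end LaxData

/-! ### Lifting lax monoidal structures along `U` -/

variable {M : MonoidalObject A} {R : MonadOn M} {E : A} {s : Subeq R.underlying E}
  {hs : IsEMObject R.underlying s} {S : MonoidalStructure E}
  {υ : LaxStructure S.toMonoidalData M.str.toMonoidalData s.u}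

namespace IsLintonLax

/-- The action on `U` is monoidal. -/
theorem isMonoidalCell (h : IsLintonLax hs υ.toLaxData) :
    IsMonoidalCell (υ.toLaxData.comp (laxOf R)) υ.toLaxData s.ν := by
  constructor
  -- The tensor condition is the bilinearity of the coherence cell of `U`.
  · have e : (laxOf R).phiAt (p₁ ≫ s.u) (p₂ ≫ s.u) ≫ υ.phi ▷ R.underlying.t ≫
        (s.precomp S.tensor).ν =
        tensHom M.str.tensor (s.precomp p₁).ν (s.precomp p₂).ν ≫ υ.phi := h.linton.1
    apply eq_of_heq
    refine HEq.trans ?_ ((heq_of_eq e.symm).trans ?_)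
    · refine heq_comp ?_ rfl rfl ?_ HEq.rfl
      · rw [← assoc₁, ← assoc₁]; rfl
      · exact tensHom_heq _ (assoc₁ _ _ _).symm rfl (assoc₁ _ _ _).symm rfl
          (assoc_hom_comp_heq _ _ _ _).symm (assoc_hom_comp_heq _ _ _ _).symm
    · refine (heq_of_eq (Category.assoc _ _ _).symm).trans ?_
      refine heq_comp ?_ (assoc₁ _ _ _) rfl (LaxData.comp_phi_heq _ _).symm
        (assoc_hom_comp_heq _ _ _ _)
      rw [← assoc₁, ← assoc₁]
  -- The unit condition is a unit law of the action: the unit coherence of `R` is `η_I`, and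
  -- extending a map and restricting along `η` gives it back.
  · have e := TensorMonad.η_extend (T := stageMnd R.underlying (pt A)) (s.precomp S.unit).alg
      υ.phi₀
    apply eq_of_heq
    refine HEq.trans ?_ (heq_of_eq e)
    refine HEq.trans ?_ (heq_of_eq (Category.assoc _ _ _))
    refine heq_comp rfl (assoc₁ _ _ _).symm rfl ((LaxData.comp_phi₀_heq _ _).trans ?_)
      (assoc_hom_comp_heq _ _ _ _).symm
    refine heq_comp rfl rfl rfl ?_ HEq.rfl
    exact (laxOf_phi₀_heq R).trans (rightUnitor_inv_comp_heq _ _).symm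

variable {X : A} {S' : MonoidalStructure X} {K : X ⟶ E}

theorem isFree_phi₀ (h : IsLintonLax hs υ.toLaxData) :
    TensorMonad.IsFree (s.precomp S.unit).alg υ.phi₀ :=
  isFree_unit hs M.str.unit h.unit h.phi₀

/-- The coherence 2-cells of `γ : U(K(A)) ⊗ U(K(B)) ⟶ U(K(A ⊗ B))` come from those of `K`. -/
theorem exists_laxData (h : IsLintonLax hs υ.toLaxData) (hC : IsRC0 M.carrier)
    (hT : IsRC1 M.str.tensor) (hR : IsRC1 R.underlying.t)
    {γ : LaxData S'.toMonoidalData M.str.toMonoidalData (K ≫ s.u)}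
    (hγ : IsMonoidalCell (γ.comp (laxOf R)) γ (s.precomp K).ν) :
    ∃ κ : LaxData S'.toMonoidalData S.toMonoidalData K, κ.comp υ.toLaxData = γ := by
  have e₁ : tens M.str.tensor ((p₁ ≫ K) ≫ s.u) ((p₂ ≫ K) ≫ s.u) =
      tens M.str.tensor (p₁ ≫ K ≫ s.u) (p₂ ≫ K ≫ s.u) := by rw [assoc₁, assoc₁]
  have e₂ : S'.tensor ≫ K ≫ s.u = (S'.tensor ≫ K) ≫ s.u := (assoc₁ _ _ _).symm
  let f : tens M.str.tensor ((p₁ ≫ K) ≫ s.u) ((p₂ ≫ K) ≫ s.u) ⟶ (S'.tensor ≫ K) ≫ s.u :=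
    eqToHom e₁ ≫ γ.phi ≫ eqToHom e₂
  have hfγ : f ≍ γ.phi := strip _ _ _
  -- Monoidality of the action on `U(K)` says precisely that its coherence cell is bilinear, so it
  -- factors through the Linton tensor product.
  have hf : (stage R (pr X X)).Bilin (s.precomp (p₁ ≫ K)).alg (s.precomp (p₂ ≫ K)).alg
      (s.precomp (S'.tensor ≫ K)).alg f := by
    have hν : ∀ {Y : A} (L : Y ⟶ X), (s.precomp (L ≫ K)).ν ≍ L ◁ (s.precomp K).ν := by
      intro Y L
      rw [← Subeq.precomp_precomp]
      exact assoc_hom_comp_heq _ _ _ _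
    change (laxOf R).phiAt _ _ ≫ f ▷ R.underlying.t ≫ (s.precomp (S'.tensor ≫ K)).ν =
      tensHom M.str.tensor (s.precomp (p₁ ≫ K)).ν (s.precomp (p₂ ≫ K)).ν ≫ f
    apply eq_of_heq
    refine HEq.trans ?_ ((heq_of_eq hγ.tensor.symm).trans ?_)
    · refine (heq_of_eq (Category.assoc _ _ _).symm).trans ?_
      refine heq_comp ?_ ?_ ?_ (HEq.trans ?_ (LaxData.comp_phi_heq _ _).symm) (hν _)
      · simp only [assoc₁]
      · simp only [assoc₁]
      · exact e₂.symm
      · refine heq_comp ?_ ?_ ?_ ((laxOf R).phiAt_congr (assoc₁ _ _ _) (assoc₁ _ _ _)) ?_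
        · simp only [assoc₁]
        · simp only [assoc₁]
        · simp only [assoc₁]
        · exact whiskerRight_heq rfl e₁ e₂.symm hfγ
    · have e₃ : ∀ {Y : A} (L : Y ⟶ X), L ≫ (K ≫ s.u) ≫ R.underlying.t =
          ((L ≫ K) ≫ s.u) ≫ R.underlying.t := fun _ => by simp only [assoc₁]
      refine heq_comp ?_ e₁.symm e₂ ?_ hfγ.symm
      · exact congrArg₂ (tens _) (e₃ _) (e₃ _)
      · exact tensHom_heq _ (e₃ _) (assoc₁ _ _ _).symm (e₃ _)
          (assoc₁ _ _ _).symm (hν _).symm (hν _).symm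
  obtain ⟨g, hg⟩ := (h.phiAt hC (p₁ ≫ K) (p₂ ≫ K)).desc (stage_rc hT hR _) hf
  obtain ⟨n, hn⟩ := hs.exists_hom g
  let f₀ : M.str.unit ⟶ (S'.unit ≫ K) ≫ s.u := γ.phi₀ ≫ eqToHom (assoc₁ _ _ _).symm
  have hfγ₀ : f₀ ≍ γ.phi₀ := strip_right _ _
  -- For the unit, the factorization exists because the unit of `E` is free on `I`.
  obtain ⟨g₀, hg₀⟩ := h.isFree_phi₀.desc (K := (s.precomp (S'.unit ≫ K)).alg) f₀
  obtain ⟨n₀, hn₀⟩ := hs.exists_hom g₀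
  refine ⟨⟨n, n₀⟩, LaxData.ext (eq_of_heq ?_) (eq_of_heq ?_)⟩
  · refine (LaxData.comp_phi_heq _ _).trans (HEq.trans (heq_of_eq ?_) hfγ)
    exact (congrArg (_ ≫ ·) hn).trans hg
  · refine (LaxData.comp_phi₀_heq _ _).trans (HEq.trans (heq_of_eq ?_) hfγ₀)
    exact (congrArg (_ ≫ ·) hn₀).trans hg₀

theorem gen_phiAt (h : IsLintonLax hs υ.toLaxData) (hC : IsRC0 M.carrier)
    (hT : IsRC1 M.str.tensor) (hR : IsRC1 R.underlying.t) {Y : A} (G H : Y ⟶ E) :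
    TensorMonad.Gen (s.precomp (tens S.tensor G H)).alg (υ.phiAt G H) :=
  (h.phiAt hC G H).gen (stage_rc hT hR Y)

/-- The coherence cells of `U` generate, so those of `K` are determined by the composite. -/
theorem laxData_ext (h : IsLintonLax hs υ.toLaxData) (hC : IsRC0 M.carrier)
    (hT : IsRC1 M.str.tensor) (hR : IsRC1 R.underlying.t)
    {κ κ' : LaxData S'.toMonoidalData S.toMonoidalData K}
    (e : κ.comp υ.toLaxData = κ'.comp υ.toLaxData) : κ = κ' := by
  refine LaxData.ext ?_ ?_
  · refine IsGen.hom_ext hs (h.gen_phiAt hC hT hR _ _) (eq_of_heq ?_)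
    refine (LaxData.comp_phi_heq κ υ.toLaxData).symm.trans ?_
    rw [e]
    exact LaxData.comp_phi_heq κ' υ.toLaxData
  · refine IsGen.hom_ext hs h.isFree_phi₀.gen (eq_of_heq ?_)
    refine (LaxData.comp_phi₀_heq κ υ.toLaxData).symm.trans ?_
    rw [e]
    exact LaxData.comp_phi₀_heq κ' υ.toLaxData

/-- A lax monoidal structure on `U(K)` for which the action is monoidal comes from one on `K`. -/
theorem exists_laxStructure (h : IsLintonLax hs υ.toLaxData) (hC : IsRC0 M.carrier)
    (hT : IsRC1 M.str.tensor) (hR : IsRC1 R.underlying.t)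
    {γ : LaxStructure S'.toMonoidalData M.str.toMonoidalData (K ≫ s.u)}
    (hγ : IsMonoidalCell (γ.toLaxData.comp (laxOf R)) γ.toLaxData (s.precomp K).ν) :
    ∃ κ : LaxStructure S'.toMonoidalData S.toMonoidalData K, κ.comp υ = γ := by
  obtain ⟨κ, hκ⟩ := h.exists_laxData hC hT hR hγ
  refine ⟨⟨κ, ?_, ?_, ?_⟩, LaxStructure.toLaxData_injective hκ⟩
  · have e := γ.assoc
    rw [← hκ] at e
    have e := e.of_comp
    generalize (p₁ : pr X (pr X X) ⟶ X) = F at e ⊢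
    generalize (p₂ ≫ p₁ : pr X (pr X X) ⟶ X) = G at e ⊢
    generalize (p₂ ≫ p₂ : pr X (pr X X) ⟶ X) = H at e ⊢
    -- On the generators `UKF ⊗ (UKG ⊗ UKH)` the axiom for `K` becomes that for `U(K)`, by the axiom
    -- for `U` and the naturality of its coherence cell.
    refine IsGen.hom_ext hs ((h.phiAt hC (F ≫ K) _).gen_left (stage_rc hT hR _)
      (h.gen_phiAt hC hT hR (G ≫ K) (H ≫ K))) ?_
    change (tensHom M.str.tensor (𝟙 _) _ ≫ _) ≫ (_ ≫ _ ≫ _) ▷ s.u =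
      (tensHom M.str.tensor (𝟙 _) _ ≫ _) ≫ (_ ≫ _ ≫ _) ▷ s.u
    have n₁ := υ.phiAt_naturality (κ.phiAt F G) (𝟙 (H ≫ K))
    have n₂ := υ.phiAt_naturality (𝟙 (F ≫ K)) (κ.phiAt G H)
    rw [id_whiskerRight] at n₁ n₂
    have a : M.str.assocAt ((F ≫ K) ≫ s.u) ((G ≫ K) ≫ s.u) ((H ≫ K) ≫ s.u) ≫
        tensHom M.str.tensor (υ.phiAt (F ≫ K) (G ≫ K)) (𝟙 ((H ≫ K) ≫ s.u)) ≫
          υ.phiAt (tens S.tensor (F ≫ K) (G ≫ K)) (H ≫ K) =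
        tensHom M.str.tensor (𝟙 ((F ≫ K) ≫ s.u)) (υ.phiAt (G ≫ K) (H ≫ K)) ≫
          υ.phiAt (F ≫ K) (tens S.tensor (G ≫ K) (H ≫ K)) ≫
            S.assocAt (F ≫ K) (G ≫ K) (H ≫ K) ▷ s.u := υ.assocAt_all _ _ _
    rw [tensHom_comp_id, tensHom_id_comp, assoc₂, assoc₂, assoc₂, reassoc_of% n₁, reassoc_of% a,
      reassoc_of% n₂] at e
    simp only [comp_whiskerRight]
    exact (assoc₂ _ _ _).trans (e.trans (assoc₂ _ _ _).symm)
  · have e := γ.left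
    rw [← hκ] at e
    have e := e.of_comp
    generalize 𝟙 X = F at e ⊢
    refine IsGen.hom_ext hs ((h.phiAt hC _ (F ≫ K)).gen_right (stage_rc hT hR _)
      (h.isFree X).gen) ?_
    change (tensHom M.str.tensor _ (𝟙 _) ≫ _) ≫ (_ ≫ _ ≫ _) ▷ s.u =
      (tensHom M.str.tensor _ (𝟙 _) ≫ _) ≫ _ ▷ s.u
    have n₁ := υ.phiAt_naturality (κ.phi₀At X) (𝟙 (F ≫ K))
    rw [id_whiskerRight] at n₁
    have a := υ.leftAt_all (F ≫ K)
    rw [LaxData.LeftAt] at a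
    rw [tensHom_comp_id, assoc₂, assoc₂, reassoc_of% n₁] at e
    simp only [comp_whiskerRight]
    exact (assoc₂ _ _ _).trans ((e.trans a.symm).trans (assoc₂ _ _ _).symm)
  · have e := γ.right
    rw [← hκ] at e
    have e := e.of_comp
    generalize 𝟙 X = F at e ⊢
    refine IsGen.hom_ext hs ((h.phiAt hC (F ≫ K) _).gen_left (stage_rc hT hR _)
      (h.isFree X).gen) ?_
    change (tensHom M.str.tensor (𝟙 _) _ ≫ _) ≫ (_ ≫ _ ≫ _) ▷ s.u =
      (tensHom M.str.tensor (𝟙 _) _ ≫ _) ≫ _ ▷ s.u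
    have n₁ := υ.phiAt_naturality (𝟙 (F ≫ K)) (κ.phi₀At X)
    rw [id_whiskerRight] at n₁
    have a := υ.rightAt_all (F ≫ K)
    rw [LaxData.RightAt] at a
    rw [tensHom_id_comp, assoc₂, assoc₂, reassoc_of% n₁] at e
    simp only [comp_whiskerRight]
    exact (assoc₂ _ _ _).trans ((e.trans a.symm).trans (assoc₂ _ _ _).symm)

/-- A 2-cell is monoidal if its image under `U` is. -/
theorem isMonoidalCell_of_whiskerRight (h : IsLintonLax hs υ.toLaxData) (hC : IsRC0 M.carrier)
    (hT : IsRC1 M.str.tensor) (hR : IsRC1 R.underlying.t) {K' : X ⟶ E}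
    {κ : LaxData S'.toMonoidalData S.toMonoidalData K}
    {κ' : LaxData S'.toMonoidalData S.toMonoidalData K'} {n : K ⟶ K'}
    (hn : IsMonoidalCell (κ.comp υ.toLaxData) (κ'.comp υ.toLaxData) (n ▷ s.u)) :
    IsMonoidalCell κ κ' n := by
  constructor
  · refine IsGen.hom_ext hs (h.gen_phiAt hC hT hR _ _) (eq_of_heq ?_)
    rw [comp_whiskerRight, comp_whiskerRight]
    refine HEq.trans ?_ ((heq_of_eq hn.tensor).trans ?_)
    · refine (heq_of_eq (Category.assoc _ _ _).symm).trans ?_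
      refine (heq_of_eq (congrArg (· ≫ _) (υ.phiAt_naturality _ _).symm)).trans ?_
      refine (heq_of_eq (Category.assoc _ _ _)).trans ?_
      refine heq_comp ?_ ?_ (assoc₁ _ _ _) ?_ (LaxData.comp_phi_heq _ _).symm
      · simp only [assoc₁]
      · simp only [assoc₁]
      · exact tensHom_heq _ (assoc₁ _ _ _) (assoc₁ _ _ _) (assoc₁ _ _ _) (assoc₁ _ _ _)
          (whisker_assoc_heq _ _ _) (whisker_assoc_heq _ _ _)
    · refine HEq.trans ?_ (heq_of_eq (Category.assoc _ _ _))
      refine heq_comp ?_ (assoc₁ _ _ _).symm (assoc₁ _ _ _).symm (LaxData.comp_phi_heq _ _)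
        (whisker_assoc_heq _ _ _).symm
      simp only [assoc₁]
  · refine IsGen.hom_ext hs h.isFree_phi₀.gen (eq_of_heq ?_)
    rw [comp_whiskerRight]
    refine HEq.trans ?_ ((heq_of_eq hn.unit).trans (LaxData.comp_phi₀_heq _ _))
    refine (heq_of_eq (Category.assoc _ _ _).symm).trans ?_
    exact heq_comp rfl (assoc₁ _ _ _) (assoc₁ _ _ _) (LaxData.comp_phi₀_heq _ _).symm
      (whisker_assoc_heq _ _ _)

end IsLintonLax

end Lifting

/-! ### The Eilenberg-Moore object of a lax monoidal monad -/

section EilenbergMoore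

variable {A : Type u} [Bicategory.{w, v} A] [Bicategory.Strict A] [FiniteProducts A]
  {M : MonoidalObject A} {R : MonadOn M} {E : A} {s : Subeq R.underlying E}
  {hs : IsEMObject R.underlying s} {S : MonoidalStructure E}
  {υ : LaxStructure S.toMonoidalData M.str.toMonoidalData s.u}

/-- The underlying subequalizing 1-cell of one in `Mon_l(A)`. -/
noncomputable def Subeq.forget {N : MonoidalObject A} (x : Subeq R N) :
    Subeq R.underlying N.carrier where
  u := LaxMonoidalCell.cell x.u
  ν := MonoidalTransformation.cell x.ν
  unit := (congrArg₂ (· ≫ ·) (cell_rightUnitor_inv x.u).symm rfl).trans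
    (congrArg MonoidalTransformation.cell x.unit)
  assoc := (congrArg MonoidalTransformation.cell x.assoc).trans
    (congrArg₂ (· ≫ ·) (cell_associator_hom x.u R.t R.t) rfl)

theorem Subeq.forget_precomp {hβ : IsMonoidalCell (υ.toLaxData.comp (laxOf R)) υ.toLaxData s.ν}
    {N : MonoidalObject A} (L : N ⟶ MonoidalObject.mk E S) :
    ((s.monoidal υ hβ).precomp L).forget = s.precomp (LaxMonoidalCell.cell L) :=
  Subeq.hext rfl (heq_of_eq (congrArg (· ≫ LaxMonoidalCell.cell L ◁ s.ν)
    (cell_associator_hom L (s.monoidal υ hβ).u R.t)))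

/-- The universal property in `A` supplies the underlying cells. Their monoidal structure exists by
lifting along `U` and is unique because the coherence cells of `U` generate. -/
theorem IsLintonLax.isEMObject (h : IsLintonLax hs υ.toLaxData) (hC : IsRC0 M.carrier)
    (hT : IsRC1 M.str.tensor) (hR : IsRC1 R.underlying.t)
    (hβ : IsMonoidalCell (υ.toLaxData.comp (laxOf R)) υ.toLaxData s.ν) :
    IsEMObject R (s.monoidal υ hβ) := by
  intro N
  refine ⟨⟨?_, ?_⟩, ⟨?_⟩, ⟨?_⟩⟩
  · intro L L' e
    have e : (s.monoidal υ hβ).precomp L = (s.monoidal υ hβ).precomp L' := e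
    have e₁ : LaxMonoidalCell.cell L = LaxMonoidalCell.cell L' := by
      refine hs.obj_ext ?_
      rw [← Subeq.forget_precomp (hβ := hβ), ← Subeq.forget_precomp (hβ := hβ), e]
    have e₂ : LaxMonoidalCell.comp L ⟨s.u, υ⟩ = LaxMonoidalCell.comp L' ⟨s.u, υ⟩ :=
      congrArg Subeq.u e
    obtain ⟨K, κ⟩ := L
    obtain ⟨K', κ'⟩ := L'
    dsimp only at e₁
    subst e₁
    have e₃ : κ.toLaxData.comp υ.toLaxData = κ'.toLaxData.comp υ.toLaxData := by
      have := (LaxMonoidalCell.mk.injEq _ _ _ _).mp e₂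
      exact congrArg LaxStructure.toLaxData (eq_of_heq this.2)
    exact congrArg (LaxMonoidalCell.mk K)
      (LaxStructure.toLaxData_injective (h.laxData_ext hC hT hR e₃))
  · intro y
    obtain ⟨K, hK⟩ := hs.exists_obj y.forget
    obtain ⟨⟨cell, γ⟩, ⟨ν, hν⟩, _, _⟩ := y
    obtain rfl : K ≫ s.u = cell := congrArg Subeq.u hK
    have eν : (s.precomp K).ν = ν := by
      have := (Subeq.mk.injEq _ _ _ _ _ _ _ _).mp hK
      exact eq_of_heq this.2
    subst eν
    -- The lift `K` of the underlying algebra acquires a lax structure from the monoidality of the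
    -- given action.
    obtain ⟨κ, rfl⟩ := h.exists_laxStructure (S' := N.str) hC hT hR hν
    refine ⟨LaxMonoidalCell.mk K κ, Subeq.hext rfl (heq_of_eq ?_)⟩
    exact LaxMonoidalCell.hom_ext (congrArg (· ≫ K ◁ s.ν)
      (cell_associator_hom (LaxMonoidalCell.mk K κ) (s.monoidal υ hβ).u R.t))
  · intro L L' f
    have eν : ∀ L : N ⟶ MonoidalObject.mk E S,
        MonoidalTransformation.cell ((s.monoidal υ hβ).precomp L).ν =
          (s.precomp (LaxMonoidalCell.cell L)).ν := fun L =>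
      congrArg (· ≫ LaxMonoidalCell.cell L ◁ s.ν)
        (cell_associator_hom L (s.monoidal υ hβ).u R.t)
    have e := congrArg MonoidalTransformation.cell (Subeq.Hom.comm f)
    obtain ⟨n, hn⟩ := hs.exists_hom (K := LaxMonoidalCell.cell L) (K' := LaxMonoidalCell.cell L')
      (Mnd.Alg.Hom.mk (MonoidalTransformation.cell (Subeq.Hom.cell f))
        ((congrArg (_ ≫ ·) (eν L').symm).trans (e.trans (congrArg (· ≫ _) (eν L)))))
    have hm : IsMonoidalCell ((LaxMonoidalCell.lax L).toLaxData.comp υ.toLaxData)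
        ((LaxMonoidalCell.lax L').toLaxData.comp υ.toLaxData) (n ▷ s.u) :=
      hn ▸ MonoidalTransformation.isMonoidal (Subeq.Hom.cell f)
    exact ⟨MonoidalTransformation.mk n (h.isMonoidalCell_of_whiskerRight hC hT hR hm),
      Subeq.Hom.ext (LaxMonoidalCell.hom_ext hn)⟩
  · intro L L' n n' e
    have e' : MonoidalTransformation.cell n ▷ s.u = MonoidalTransformation.cell n' ▷ s.u :=
      congrArg MonoidalTransformation.cell (congrArg Subeq.Hom.cell e)
    exact LaxMonoidalCell.hom_ext (hs.hom_ext e')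

end EilenbergMoore

/-! ### The adjunction of an Eilenberg-Moore object -/

section Adjunction

theorem Subeq.ν_heq {B : Type*} [Bicategory B] {c : B} {R : MonadOn c} {X : B} {x y : Subeq R X}
    (h : x = y) : x.ν ≍ y.ν := by subst h; rfl

variable {B : Type*} [Bicategory B] [Bicategory.Strict B] {c E : B} {R : MonadOn c}
  {s : Subeq R E} (hs : IsEMObject R s)

theorem freeCell_whiskerLeft_ν : freeCell hs ◁ s.ν ≍ R.μ :=
  (assoc_hom_comp_heq _ _ _ _).symm.trans (Subeq.ν_heq (emFunctor_freeCell hs))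

/-- The action as a 2-cell `U F U ⟶ U`. -/
noncomputable def actCell : (s.u ≫ freeCell hs) ≫ s.u ⟶ 𝟙 E ≫ s.u :=
  (α_ s.u (freeCell hs) s.u).hom ≫ s.u ◁ eqToHom (freeCell_comp hs) ≫ s.ν ≫ (λ_ s.u).inv

theorem actCell_heq : actCell hs ≍ s.ν := by
  refine (assoc_hom_comp_heq _ _ _ _).trans ?_
  rw [whiskerLeft_eqToHom, Strict.leftUnitor_eqToIso, eqToIso.inv]
  exact strip _ _ _

/-- The associativity law makes the action a morphism from the free algebra on `U` to `U`, and `U`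
is full on such morphisms. -/
theorem exists_counit :
    ∃ θ : s.u ≫ freeCell hs ⟶ 𝟙 E, θ ▷ s.u = actCell hs := by
  have e₁ : (s.u ≫ freeCell hs) ≫ s.u = s.u ≫ R.t := by rw [assoc₁, freeCell_comp]
  have e₂ : 𝟙 E ≫ s.u = s.u := id_comp₁ _
  refine hs.exists_hom (Mnd.Alg.Hom.mk (actCell hs) ?_)
  change actCell hs ▷ R.t ≫ (s.precomp (𝟙 E)).ν = (s.precomp (s.u ≫ freeCell hs)).ν ≫ actCell hs
  apply eq_of_heq
  refine HEq.trans ?_ ((heq_of_eq s.assoc).trans ?_)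
  · refine heq_comp (congrArg (· ≫ R.t) e₁) (congrArg (· ≫ R.t) e₂) e₂
      (whiskerRight_heq rfl e₁ e₂ (actCell_heq hs)) ?_
    exact (assoc_hom_comp_heq _ _ _ _).trans (id_whiskerLeft_heq _)
  · refine (heq_of_eq (Category.assoc _ _ _).symm).trans ?_
    refine heq_comp (congrArg (· ≫ R.t) e₁.symm) e₁.symm e₂.symm ?_ (actCell_heq hs).symm
    exact (Subeq.ν_heq (precomp_freeCell hs s.u)).symm

/-- The free 1-cell of an Eilenberg-Moore object is left adjoint to the forgetful one, with unit the
unit of the monad and counit given by the action. -/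
theorem exists_adjunction :
    ∃ adj : Bicategory.Adjunction (freeCell hs) s.u,
      adj.unit ≫ eqToHom (freeCell_comp hs) = R.η ∧ adj.counit ▷ s.u = actCell hs := by
  obtain ⟨θ, hθ⟩ := exists_counit hs
  have e₁ : (s.u ≫ freeCell hs) ≫ s.u = s.u ≫ R.t := by rw [assoc₁, freeCell_comp]
  have e₂ : 𝟙 E ≫ s.u = s.u := id_comp₁ _
  have hF := freeCell_comp hs
  have hθ' : θ ▷ s.u ≍ s.ν := (heq_of_eq hθ).trans (actCell_heq hs)
  let η : 𝟙 c ⟶ freeCell hs ≫ s.u := R.η ≫ eqToHom hF.symm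
  have hη : η ≍ R.η := strip_right _ _
  refine ⟨⟨η, θ, ?_, ?_⟩, ?_, hθ⟩
  -- After applying `U`, the first triangle identity becomes a unit law of the monad, since the
  -- action on `F` is `μ`.
  · refine hs.hom_ext (eq_of_heq ?_)
    have e := R.left_unit
    rw [Strict.leftUnitor_eqToIso, eqToIso.inv] at e
    have e' : R.η ▷ R.t ≫ R.μ ≍ 𝟙 R.t := (strip_left _ _).symm.trans (heq_of_eq e)
    have z : leftZigzag η θ = η ▷ freeCell hs ≫ (α_ _ _ _).hom ≫ freeCell hs ◁ θ := by
      simp [leftZigzag, bicategoricalComp]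
    have hr : ((λ_ (freeCell hs)).hom ≫ (ρ_ (freeCell hs)).inv) ▷ s.u ≍ 𝟙 R.t := by
      rw [Strict.leftUnitor_eqToIso, Strict.rightUnitor_eqToIso, eqToIso.hom, eqToIso.inv,
        eqToHom_trans, eqToHom_whiskerRight]
      exact eqToHom_heq_id _ ((congrArg (· ≫ s.u) (id_comp₁ _)).trans hF)
    refine HEq.trans ?_ (e'.trans hr.symm)
    rw [z, comp_whiskerRight]
    refine heq_comp ?_ ?_ ?_ ?_ ?_
    · rw [assoc₁, hF]
    · rw [assoc₁, assoc₁, hF, ← assoc₁, hF]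
    · rw [comp_id₁, hF]
    · refine (whiskerRight_comp_heq _ _ _).symm.trans ?_
      exact whiskerRight_heq hF rfl hF hη
    · refine HEq.trans ?_ (freeCell_whiskerLeft_ν hs)
      refine HEq.trans (whiskerRight_heq rfl (assoc₁ _ _ _) rfl (assoc_hom_comp_heq _ _ _ _)) ?_
      refine (whisker_assoc_heq _ _ _).trans ?_
      exact whiskerLeft_heq rfl e₁ e₂ hθ'
  -- The second triangle identity is the unit law of the action.
  · have e := s.unit
    rw [Strict.rightUnitor_eqToIso, eqToIso.inv] at e
    have e' : s.u ◁ R.η ≫ s.ν ≍ 𝟙 s.u := (strip_left _ _).symm.trans (heq_of_eq e)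
    have z : rightZigzag η θ = s.u ◁ η ≫ (α_ _ _ _).inv ≫ θ ▷ s.u := by
      simp [rightZigzag, bicategoricalComp]
    have hr : (ρ_ s.u).hom ≫ (λ_ s.u).inv ≍ 𝟙 s.u := by
      rw [Strict.leftUnitor_eqToIso, Strict.rightUnitor_eqToIso, eqToIso.hom, eqToIso.inv,
        eqToHom_trans]
      exact eqToHom_heq_id _ (comp_id₁ _)
    refine eq_of_heq (HEq.trans ?_ (e'.trans hr.symm))
    rw [z]
    refine heq_comp rfl (congrArg _ hF) e₂ (whiskerLeft_heq rfl rfl hF hη) ?_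
    exact (assoc_inv_comp_heq _ _ _ _).trans hθ'
  · change (R.η ≫ eqToHom _) ≫ eqToHom _ = _
    simp

end Adjunction

/-! ### The free 1-cell is strong monoidal -/

section Strong

variable {A : Type u} [Bicategory.{w, v} A] [Bicategory.Strict A] [FiniteProducts A]
  {M : MonoidalObject A} {R : MonadOn M} {E : A} {s : Subeq R.underlying E}
  {hs : IsEMObject R.underlying s} {S : MonoidalStructure E}
  {υ : LaxStructure S.toMonoidalData M.str.toMonoidalData s.u}

namespace IsLintonLax

/-- Both `F(A) ⊗ F(B)` and `F(A ⊗ B)` are free on `A ⊗ B`, the former by `IsLinton.isFree`. The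
coherence cell respects the generators, hence is invertible. -/
theorem isIso_phi (h : IsLintonLax hs υ.toLaxData) (hC : IsRC0 M.carrier)
    (hT : IsRC1 M.str.tensor) (hR : IsRC1 R.underlying.t)
    {κ : LaxData M.str.toMonoidalData S.toMonoidalData (freeCell hs)}
    (hκ : κ.comp υ.toLaxData ≍ laxOf R) : IsIso κ.phi := by
  have hF := freeCell_comp hs
  have hφ : υ.phiAt (p₁ ≫ freeCell hs) (p₂ ≫ freeCell hs) ≫ κ.phi ▷ s.u ≍ (laxOf R).phi := by
    refine (LaxData.comp_phi_heq _ _).symm.trans ?_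
    have key : ∀ {G G' : M.carrier ⟶ M.carrier} (φ : LaxData M.str.toMonoidalData
        M.str.toMonoidalData G) (γ : LaxData M.str.toMonoidalData M.str.toMonoidalData G'),
        G = G' → φ ≍ γ → φ.phi ≍ γ.phi := by
      rintro G _ φ γ rfl h
      cases h
      rfl
    exact key _ _ hF hκ
  have hy : ∀ (K : pr M.carrier M.carrier ⟶ M.carrier),
      ∃ y : K ⟶ (K ≫ freeCell hs) ≫ s.u, y ≍ K ◁ R.underlying.η ∧
        TensorMonad.IsFree (s.precomp (K ≫ freeCell hs)).alg y := by
    intro K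
    have e : K ≫ R.underlying.t = (K ≫ freeCell hs) ≫ s.u := by rw [assoc₁, hF]
    have e' : (ρ_ K).inv ≫ K ◁ R.underlying.η ≫ eqToHom e ≍ K ◁ R.underlying.η :=
      (rightUnitor_inv_comp_heq _ _).trans (strip_right _ _)
    exact ⟨_, e', isFree_unit hs K rfl e'⟩
  obtain ⟨y₁, hy₁, hf₁⟩ := hy p₁
  obtain ⟨y₂, hy₂, hf₂⟩ := hy p₂
  have hw := (h.phiAt hC _ _).isFree (stage_rc hT hR _) hf₁ hf₂
  let w := tensHom M.str.tensor y₁ y₂ ≫ υ.phiAt (p₁ ≫ freeCell hs) (p₂ ≫ freeCell hs)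
  have e₁ : ∀ K : pr M.carrier M.carrier ⟶ M.carrier,
      (K ≫ freeCell hs) ≫ s.u = K ≫ R.underlying.t := fun K => by rw [assoc₁, hF]
  -- As `U` composed with `F` is `R` as a lax monoidal 1-cell, this is the monoidality of `η`.
  have hw' : w ≫ κ.phi ▷ s.u ≍ tens M.str.tensor p₁ p₂ ◁ R.underlying.η := by
    have e := (MonoidalTransformation.isMonoidal R.η).tensor
    refine (heq_of_eq (Category.assoc _ _ _)).trans ?_
    refine HEq.trans ?_ ((heq_of_eq e).trans ?_)
    · refine heq_comp ?_ ?_ (e₁ _) ?_ hφ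
      · exact congrArg₂ (tens _) (comp_id₁ _).symm (comp_id₁ _).symm
      · exact congrArg₂ (tens _) (e₁ _) (e₁ _)
      · exact tensHom_heq _ (comp_id₁ _).symm (e₁ _) (comp_id₁ _).symm (e₁ _) hy₁ hy₂
    · refine (strip_left (f := M.str.tensor ≫ 𝟙 M.carrier) ?_
        (M.str.tensor ◁ R.underlying.η)).trans ?_
      · exact (congrArg₂ (tens _) (comp_id₁ _) (comp_id₁ _)).trans
          ((tens_p₁_p₂ _).trans (comp_id₁ _).symm)
      · rw [tens_p₁_p₂]
  have hf' : TensorMonad.IsFree (s.precomp (M.str.tensor ≫ freeCell hs)).alg (w ≫ κ.phi ▷ s.u) :=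
    isFree_unit hs (tens M.str.tensor p₁ p₂) (by rw [tens_p₁_p₂]) hw'
  exact hs.isIso (TensorMonad.IsFree.isIso (g := algHom κ.phi) hw hf' rfl)

/-- Both the unit of `E` and `F(I)` are free on `I`, and the cell carries the one generator to the
other. -/
theorem isIso_phi₀ (h : IsLintonLax hs υ.toLaxData)
    {κ : LaxData M.str.toMonoidalData S.toMonoidalData (freeCell hs)}
    (hκ : κ.comp υ.toLaxData ≍ laxOf R) : IsIso κ.phi₀ := by
  have hφ : υ.phi₀ ≫ κ.phi₀ ▷ s.u ≍ M.str.unit ◁ R.underlying.η := by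
    refine (LaxData.comp_phi₀_heq _ _).symm.trans (HEq.trans ?_ (laxOf_phi₀_heq R))
    have key : ∀ {G G' : M.carrier ⟶ M.carrier} (φ : LaxData M.str.toMonoidalData
        M.str.toMonoidalData G) (γ : LaxData M.str.toMonoidalData M.str.toMonoidalData G'),
        G = G' → φ ≍ γ → φ.phi₀ ≍ γ.phi₀ := by
      rintro G _ φ γ rfl h
      cases h
      rfl
    exact key _ _ (freeCell_comp hs) hκ
  have hf' : TensorMonad.IsFree (s.precomp (M.str.unit ≫ freeCell hs)).alg
      (υ.phi₀ ≫ κ.phi₀ ▷ s.u) := isFree_unit hs M.str.unit rfl hφ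
  exact hs.isIso (TensorMonad.IsFree.isIso (g := algHom κ.phi₀) h.isFree_phi₀ hf' rfl)

/-- Both 1-cells classify the free algebra `(R, μ)`, and such a 1-cell is unique. -/
theorem cell_freeCell {hβ : IsMonoidalCell (υ.toLaxData.comp (laxOf R)) υ.toLaxData s.ν}
    (hm : IsEMObject R (s.monoidal υ hβ)) : LaxMonoidalCell.cell (freeCell hm) = freeCell hs := by
  refine hs.obj_ext ?_
  rw [← Subeq.forget_precomp (hβ := hβ)]
  refine Eq.trans (congrArg Subeq.forget (emFunctor_freeCell hm)) ?_
  exact (emFunctor_freeCell hs).symm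

theorem isStrong (h : IsLintonLax hs υ.toLaxData) (hC : IsRC0 M.carrier)
    (hT : IsRC1 M.str.tensor) (hR : IsRC1 R.underlying.t)
    {hβ : IsMonoidalCell (υ.toLaxData.comp (laxOf R)) υ.toLaxData s.ν}
    (hm : IsEMObject R (s.monoidal υ hβ)) : LaxMonoidalCell.IsStrong (freeCell hm) := by
  have hc := cell_freeCell (hs := hs) hm
  have key : ∀ G G' : LaxMonoidalCell M M, G = G' → G.lax.toLaxData ≍ G'.lax.toLaxData := by
    rintro G _ rfl
    rfl
  have hl : (LaxMonoidalCell.lax (freeCell hm)).toLaxData.comp υ.toLaxData ≍ laxOf R :=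
    key (LaxMonoidalCell.comp (freeCell hm) ⟨s.u, υ⟩) R.t (freeCell_comp hm)
  -- Only the underlying 1-cell and the composite with `U` matter from here on, so the 1-cell may be
  -- replaced by an arbitrary lax structure on the free 1-cell of `A`.
  generalize freeCell hm = F at hc hl ⊢
  obtain ⟨F, κ⟩ := F
  dsimp only at hc
  subst hc
  exact ⟨h.isIso_phi hC hT hR hl, h.isIso_phi₀ hl⟩

end IsLintonLax

end Strong
end MonLax

theorem mainTheorem1 {A : Type u} [Bicategory.{w, v} A]
    [Bicategory.Strict A] [FiniteProducts A]
    (M : MonoidalObject A) (R : MonadOn M)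
    (hC : IsRC0 M.carrier) (hT : IsRC1 M.str.tensor)
    (hR : IsRC1 R.underlying.t)
    {E : A} (s : Subeq R.underlying E) (hs : IsEMObject R.underlying s) :
    -- the Linton pair is reflexive, and each of its coequalizers underlies a Linton structure
    IsReflexivePair (lintonFst (s.precomp p₁) (s.precomp p₂))
        (lintonSnd (s.precomp p₁) (s.precomp p₂)) ∧
    Nonempty (LintonStructure s hs) ∧
    (∀ c : Cofork (lintonFst (s.precomp p₁) (s.precomp p₂))
        (lintonSnd (s.precomp p₁) (s.precomp p₂)), Nonempty (IsColimit c) →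
      ∃ (L : LintonStructure s hs) (h : L.str.tensor ≫ s.u = c.pt),
        L.q ≫ eqToHom h = c.π) ∧
    -- every Linton structure makes `E` an Eilenberg-Moore object in `Mon_l(A)`
    ∀ L : LintonStructure s hs,
      ∃ (υ : LaxStructure L.str.toMonoidalData M.str.toMonoidalData s.u)
        (hβ : IsMonoidalCell (υ.toLaxData.comp (laxOf R)) υ.toLaxData s.ν),
        υ.toLaxData = L.uLax (L.unit_comp hs L.unit) ∧
        IsEMObject R (s.monoidal υ hβ) ∧
        -- the monoidal adjunction with strong monoidal left adjoint
        ∃ (F : M ⟶ MonoidalObject.mk E L.str)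
          (adj : Bicategory.Adjunction F (s.monoidal υ hβ).u) (h : F ≫ (s.monoidal υ hβ).u = R.t),
          LaxMonoidalCell.cell F = freeCell hs ∧
          LaxMonoidalCell.IsStrong F ∧
          adj.unit ≫ eqToHom h = R.η ∧
          adj.counit ▷ (s.monoidal υ hβ).u =
            (α_ (s.monoidal υ hβ).u F (s.monoidal υ hβ).u).hom ≫
              (s.monoidal υ hβ).u ◁ eqToHom h ≫ (s.monoidal υ hβ).ν ≫
                (λ_ (s.monoidal υ hβ).u).inv := by
  refine ⟨isReflexivePair_linton _ _, nonempty_lintonStructure hC hT hR hs,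
    exists_lintonStructure hC hT hR hs, fun L => ?_⟩
  have hL : IsLintonLax hs (L.lax hC).toLaxData := L.isLintonLax
  have hβ := hL.isMonoidalCell
  have hm := hL.isEMObject hC hT hR hβ
  -- The general adjunction is taken in the strict 2-category `Mon_l(A)`, so its 1-cells and 2-cells
  -- are monoidal by construction.
  obtain ⟨adj, h₁, h₂⟩ := exists_adjunction hm
  exact ⟨L.lax hC, hβ, rfl, hm, freeCell hm, adj, freeCell_comp hm,
    IsLintonLax.cell_freeCell hm, hL.isStrong hC hT hR hm, h₁, h₂⟩
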